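/- Work in two-sorted logic over the vocabulary $\mathcal L^2_A=[0,1,+,\cdot,|\ |;\in,\le,=^1,=^2]$, with number variables $x,y,\dots$ and string variables $X,Y,\dots$; in the standard model the strings are the finite sets of natural numbers, $X(i)$ means $i\in X$, and $|X|$ is $0$ if $X=\emptyset$ and $1+\max X$ otherwise. For a set $\mathcal L$ of functions added to this vocabulary, $\Sigma^B_0(\mathcal L)$ is the class of formulas without string quantifiers in which all number quantifiers are bounded by $\mathcal L^2_A$-terms; $\Sigma^B_1$ (resp. $\Sigma^1_1$) formulas are $\Sigma^B_0$ formulas over $\mathcal L^2_A$ preceded by a block of quantifiers $\exists X\le t$ (resp. $\exists X$). The theory $V^0$ consists of the axioms 2-BASIC (B1–B12, L1, L2, SE) and the comprehension scheme $\exists X\le a\,\forall z<a\,(X(z)\leftrightarrow\varphi(z))$ for $\Sigma^B_0$ formulas $\varphi$ not containing $X$. Let $\langle x,y\rangle=(x+y)(x+y+1)+2y$, $\langle x,y,z\rangle=\langle\langle x,y\rangle,z\rangle$, and let $X^{[y]}$ and $Y^{[y,x]}$ denote the rows $X^{[y]}(z)\leftrightarrow X(\langle y,z\rangle)$ and $Y^{[y,x]}(z)\leftrightarrow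 Y(\langle y,x,z\rangle)$. Let $\varphi_{Init}(z,X)$ and $\varphi_{Next}(z,x,X,Y)$ be $\Sigma^B_0$ formulas, let $t(x,y)$ be an $\mathcal L^2_A$-term (a polynomial), and let $F(x,X)$ be the (polynomial-time) string function defined by the bounded recursion $$F(0,X)(z)\leftrightarrow z<t(0,|X|)\wedge\varphi_{Init}(z,X),$$ $$F(x+1,X)(z)\leftrightarrow z<t(x+1,|X|)\wedge\varphi_{Next}(z,x,X,F(x,X)).$$ Let $AXIOM_F$ be the $\Sigma^B_1$ axiom $\forall a\,\forall b\,\forall X\,\exists Y\le\langle b,a,t(a,|X|)\rangle\ \varphi_F(a,b,X,Y)$, where $\varphi_F(a,b,X,Y)$ says that for all $y<b$ and all $z<\langle b,a,t(a,|X|)\rangle$ $$Y^{[y,0]}(z)\leftrightarrow z<t(0,|X^{[y]}|)\wedge\varphi_{Init}(z,X^{[y]}),$$ $$\forall x<a\ \bigl(Y^{[y,x+1]}(z)\leftrightarrow z<t(x+1,|X^{[y]}|)\wedge\varphi_{Next}(z,x,X^{[y]},Y^{[y,x]})\bigr)$$ (the rows being eliminated in the usual way, so that $\varphi_F$ is a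 $\Sigma^B_0$ formula), and let $T=V^0+AXIOM_F$. Let $L_{FC}$ be the smallest class of number and string functions on the standard model that contains the functions of $\mathcal L^2_A$, the predecessor function $pd$, the function $f_{SE}(X,Y)=$ the least $z<|X|$ with $X(z)\not\leftrightarrow Y(z)$ ($|X|$ if there is none), and $F$, and that contains, for every quantifier-free formula $\alpha(z,\vec x,\vec X)$ over the class and every $\mathcal L^2_A$-term $s(\vec x,\vec X)$, the string function $\{z<s:\alpha(z,\vec x,\vec X)\}$ and the number function giving the least $z<s$ with $\alpha(z,\vec x,\vec X)$ ($s$ if there is none). A string function $G(\vec x,\vec X)$ is $\Sigma^1_1$-definable (resp. $\Sigma^B_1$-definable) in $T$ if there is a $\Sigma^1_1$ (resp. $\Sigma^B_1$) formula $\varphi$ such that $Y=G(\vec x,\vec X)\leftrightarrow\varphi(\vec x,\vec X,Y)$ holds in the standard model and $T\vdash\forall\vec x\,\forall\vec X\,\exists!Y\,\varphi(\vec x,\vec X,Y)$; similarly for number functions. A function is $\Sigma^B_0$-definable from a class $\mathcal L$ of functions if it is polynomially bounded and its graph (number functions) or bit graph (string functions) is represented by a $\Sigma^B_0(\mathcal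 L)$ formula; it is $AC^0$-reducible to $F$ if there are string functions $F_1,\dots,F_n$ ($n\ge 0$) such that each $F_i$ is $\Sigma^B_0$-definable from $\{F,F_1,\dots,F_{i-1}\}$ and the function is $\Sigma^B_0$-definable from $\{F,F_1,\dots,F_n\}$. Then: (1) $T$ is finitely axiomatizable, i.e. it has the same theorems as some finite set of sentences. (2) For every number function and every string function on the standard model, the following are equivalent: it is $\Sigma^1_1$-definable in $T$; it is $\Sigma^B_1$-definable in $T$; it belongs to $L_{FC}$; it is $AC^0$-reducible to $F$. -/

import Mathlib

namespace TwoSorted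

/-! ## Two-sorted syntax

A vocabulary lists the function symbols that are added to the base vocabulary
`[0, 1, +, ·, | |; ∈, ≤, =, =]`; a symbol of arity `(k, l)` takes `k` number arguments and
`l` string arguments. The symbols of the base vocabulary are built into terms and formulas. -/

/-- Function symbols, by the sort of the value and by arity, added to the base vocabulary. -/
structure Vocab where
  NumFn : ℕ → ℕ → Type
  StrFn : ℕ → ℕ → Type

/-- The base vocabulary `L²_A`: no further function symbols. -/
def L2A : Vocab where
  NumFn := fun _ _ => Empty
  StrFn := fun _ _ => Empty

mutual
/-- Number terms in `m` number variables and `n` string variables. -/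
inductive NumTerm (L : Vocab) (m n : ℕ) : Type
  | var (i : Fin m) : NumTerm L m n
  | zero : NumTerm L m n
  | one : NumTerm L m n
  | add (s t : NumTerm L m n) : NumTerm L m n
  | mul (s t : NumTerm L m n) : NumTerm L m n
  | len (T : StrTerm L m n) : NumTerm L m n
  | fn {k l : ℕ} (f : L.NumFn k l) (s : Fin k → NumTerm L m n) (T : Fin l → StrTerm L m n) :
      NumTerm L m n
/-- String terms in `m` number variables and `n` string variables. Over `L2A` these are just the
string variables. -/
inductive StrTerm (L : Vocab) (m n : ℕ) : Type
  | var (j : Fin n) : StrTerm L m n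
  | fn {k l : ℕ} (f : L.StrFn k l) (s : Fin k → NumTerm L m n) (T : Fin l → StrTerm L m n) :
      StrTerm L m n
end

/-- Formulas whose free variables are among `m` number variables and `n` string variables.
A quantifier binds the variable with index `0` of its body. -/
inductive Formula (L : Vocab) : ℕ → ℕ → Type
  | tru {m n : ℕ} : Formula L m n
  | fls {m n : ℕ} : Formula L m n
  | eqN {m n : ℕ} (s t : NumTerm L m n) : Formula L m n
  | eqS {m n : ℕ} (S T : StrTerm L m n) : Formula L m n
  | le {m n : ℕ} (s t : NumTerm L m n) : Formula L m n
  | mem {m n : ℕ} (s : NumTerm L m n) (T : StrTerm L m n) : Formula L m n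
  | not {m n : ℕ} (φ : Formula L m n) : Formula L m n
  | and {m n : ℕ} (φ ψ : Formula L m n) : Formula L m n
  | or {m n : ℕ} (φ ψ : Formula L m n) : Formula L m n
  | exN {m n : ℕ} (φ : Formula L (m + 1) n) : Formula L m n
  | allN {m n : ℕ} (φ : Formula L (m + 1) n) : Formula L m n
  | exS {m n : ℕ} (φ : Formula L m (n + 1)) : Formula L m n
  | allS {m n : ℕ} (φ : Formula L m (n + 1)) : Formula L m n

/-- Sentences of the base vocabulary. -/
abbrev Sentence : Type := Formula L2A 0 0

/-! ## Structures and truth -/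

/-- A two-sorted structure: two nonempty domains and an interpretation of every symbol. The two
equality symbols are always interpreted by equality. -/
structure Structure (L : Vocab) where
  Num : Type
  Str : Type
  str_nonempty : Nonempty Str
  zero : Num
  one : Num
  add : Num → Num → Num
  mul : Num → Num → Num
  len : Str → Num
  le : Num → Num → Prop
  mem : Num → Str → Prop
  numFn : ∀ {k l : ℕ}, L.NumFn k l → (Fin k → Num) → (Fin l → Str) → Num
  strFn : ∀ {k l : ℕ}, L.StrFn k l → (Fin k → Num) → (Fin l → Str) → Str

mutual
/-- Value of a number term. -/
def NumTerm.eval {L : Vocab} {m n : ℕ} (M : Structure L) (v : Fin m → M.Num)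
    (V : Fin n → M.Str) : NumTerm L m n → M.Num
  | .var i => v i
  | .zero => M.zero
  | .one => M.one
  | .add s t => M.add (s.eval M v V) (t.eval M v V)
  | .mul s t => M.mul (s.eval M v V) (t.eval M v V)
  | .len T => M.len (T.eval M v V)
  | .fn f s T => M.numFn f (fun i => (s i).eval M v V) (fun j => (T j).eval M v V)
/-- Value of a string term. -/
def StrTerm.eval {L : Vocab} {m n : ℕ} (M : Structure L) (v : Fin m → M.Num)
    (V : Fin n → M.Str) : StrTerm L m n → M.Str
  | .var j => V j
  | .fn f s T => M.strFn f (fun i => (s i).eval M v V) (fun j => (T j).eval M v V)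
end

/-- Truth of a formula under an assignment. -/
def Formula.Realize {L : Vocab} (M : Structure L) :
    {m n : ℕ} → Formula L m n → (Fin m → M.Num) → (Fin n → M.Str) → Prop
  | _, _, .tru, _, _ => True
  | _, _, .fls, _, _ => False
  | _, _, .eqN s t, v, V => s.eval M v V = t.eval M v V
  | _, _, .eqS S T, v, V => S.eval M v V = T.eval M v V
  | _, _, .le s t, v, V => M.le (s.eval M v V) (t.eval M v V)
  | _, _, .mem s T, v, V => M.mem (s.eval M v V) (T.eval M v V)
  | _, _, .not φ, v, V => ¬ φ.Realize M v V
  | _, _, .and φ ψ, v, V => φ.Realize M v V ∧ ψ.Realize M v V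
  | _, _, .or φ ψ, v, V => φ.Realize M v V ∨ ψ.Realize M v V
  | _, _, .exN φ, v, V => ∃ x : M.Num, φ.Realize M (Fin.cons x v) V
  | _, _, .allN φ, v, V => ∀ x : M.Num, φ.Realize M (Fin.cons x v) V
  | _, _, .exS φ, v, V => ∃ X : M.Str, φ.Realize M v (Fin.cons X V)
  | _, _, .allS φ, v, V => ∀ X : M.Str, φ.Realize M v (Fin.cons X V)

/-- Truth of a sentence of the base vocabulary. -/
def Structure.Satisfies (M : Structure L2A) (φ : Sentence) : Prop :=
  φ.Realize M Fin.elim0 Fin.elim0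

/-- Models of a set of sentences of the base vocabulary. -/
def Structure.IsModel (M : Structure L2A) (T : Set Sentence) : Prop :=
  ∀ φ ∈ T, M.Satisfies φ

/-- `T ⊢ φ`. As usual in Mathlib, first-order consequence is truth in all models; by the
completeness theorem this is derivability, and by the Löwenheim–Skolem theorem it does no harm
that the domains are taken in `Type`. -/
def Proves (T : Set Sentence) (φ : Sentence) : Prop :=
  ∀ M : Structure L2A, M.IsModel T → M.Satisfies φ

/-- `T` has the same theorems as some finite set of sentences. -/
def FinitelyAxiomatizable (T : Set Sentence) : Prop :=
  ∃ S : Set Sentence, S.Finite ∧ (∀ φ ∈ S, Proves T φ) ∧ (∀ φ ∈ T, Proves S φ)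

/-! ## Renaming and substitution over the base vocabulary -/

/-- Renaming of variables in a number term of the base vocabulary. -/
def NumTerm.rename {m n m₁ n₁ : ℕ} (ρ : Fin m → Fin m₁) (τ : Fin n → Fin n₁) :
    NumTerm L2A m n → NumTerm L2A m₁ n₁
  | .var i => .var (ρ i)
  | .zero => .zero
  | .one => .one
  | .add s t => .add (s.rename ρ τ) (t.rename ρ τ)
  | .mul s t => .mul (s.rename ρ τ) (t.rename ρ τ)
  | .len (.var j) => .len (.var (τ j))
  | .len (.fn f _ _) => nomatch f
  | .fn f _ _ => nomatch f

/-- A term read under one more number quantifier. -/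
def NumTerm.shiftN {m n : ℕ} (t : NumTerm L2A m n) : NumTerm L2A (m + 1) n :=
  t.rename Fin.succ id

/-- A term read under one more string quantifier. -/
def NumTerm.shiftS {m n : ℕ} (t : NumTerm L2A m n) : NumTerm L2A m (n + 1) :=
  t.rename id Fin.succ

/-- A number term of the base vocabulary is a number term over every vocabulary. -/
def NumTerm.ofBase {L : Vocab} {m n : ℕ} : NumTerm L2A m n → NumTerm L m n
  | .var i => .var i
  | .zero => .zero
  | .one => .one
  | .add s t => .add s.ofBase t.ofBase
  | .mul s t => .mul s.ofBase t.ofBase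
  | .len (.var j) => .len (.var j)
  | .len (.fn f _ _) => nomatch f
  | .fn f _ _ => nomatch f

/-- The pairing term `⟨x, y⟩ = (x + y)(x + y + 1) + 2y`. -/
def NumTerm.pair {L : Vocab} {m n : ℕ} (x y : NumTerm L m n) : NumTerm L m n :=
  .add (.mul (.add x y) (.add (.add x y) .one)) (.mul (.add .one .one) y)

namespace Formula

/-- `φ ⊃ ψ`. -/
def imp {L : Vocab} {m n : ℕ} (φ ψ : Formula L m n) : Formula L m n := or (not φ) ψ

/-- `φ ↔ ψ`. -/
def iff {L : Vocab} {m n : ℕ} (φ ψ : Formula L m n) : Formula L m n :=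
  and (imp φ ψ) (imp ψ φ)

/-- `s < t`, that is, `s ≤ t ∧ s ≠ t`. -/
def lt {L : Vocab} {m n : ℕ} (s t : NumTerm L m n) : Formula L m n :=
  and (le s t) (not (eqN s t))

/-- `∃ x ≤ t, φ`; bounding terms are terms of the base vocabulary. -/
def exLE {L : Vocab} {m n : ℕ} (t : NumTerm L2A m n) (φ : Formula L (m + 1) n) :
    Formula L m n :=
  exN (and (le (.var 0) t.shiftN.ofBase) φ)

/-- `∀ x ≤ t, φ`. -/
def allLE {L : Vocab} {m n : ℕ} (t : NumTerm L2A m n) (φ : Formula L (m + 1) n) :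
    Formula L m n :=
  allN (imp (le (.var 0) t.shiftN.ofBase) φ)

/-- `∃ x < t, φ`. -/
def exLT {L : Vocab} {m n : ℕ} (t : NumTerm L2A m n) (φ : Formula L (m + 1) n) :
    Formula L m n :=
  exLE t (and (not (eqN (.var 0) t.shiftN.ofBase)) φ)

/-- `∀ x < t, φ`. -/
def allLT {L : Vocab} {m n : ℕ} (t : NumTerm L2A m n) (φ : Formula L (m + 1) n) :
    Formula L m n :=
  allLE t (imp (not (eqN (.var 0) t.shiftN.ofBase)) φ)

/-- `∃ X ≤ t, φ`, that is, `∃ X (|X| ≤ t ∧ φ)`. -/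
def exSLE {L : Vocab} {m n : ℕ} (t : NumTerm L2A m n) (φ : Formula L m (n + 1)) :
    Formula L m n :=
  exS (and (le (.len (.var 0)) t.shiftS.ofBase) φ)

/-- Universal closure with respect to the number variables. -/
def closeNum : {m : ℕ} → Formula L2A m 0 → Sentence
  | 0, φ => φ
  | _ + 1, φ => closeNum (allN φ)

/-- Universal closure. -/
def close {m : ℕ} : {n : ℕ} → Formula L2A m n → Sentence
  | 0, φ => closeNum φ
  | _ + 1, φ => close (allS φ)

/-- Quantifier-free formulas. -/
def IsOpen {L : Vocab} : {m n : ℕ} → Formula L m n → Prop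
  | _, _, .not φ => φ.IsOpen
  | _, _, .and φ ψ => φ.IsOpen ∧ ψ.IsOpen
  | _, _, .or φ ψ => φ.IsOpen ∧ ψ.IsOpen
  | _, _, .exN _ => False
  | _, _, .allN _ => False
  | _, _, .exS _ => False
  | _, _, .allS _ => False
  | _, _, _ => True

/-- `Σ^B_0(L)`: no string quantifiers, and all number quantifiers bounded. -/
inductive IsSigma0B {L : Vocab} : {m n : ℕ} → Formula L m n → Prop
  | tru {m n : ℕ} : IsSigma0B (tru : Formula L m n)
  | fls {m n : ℕ} : IsSigma0B (fls : Formula L m n)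
  | eqN {m n : ℕ} (s t : NumTerm L m n) : IsSigma0B (eqN s t)
  | eqS {m n : ℕ} (S T : StrTerm L m n) : IsSigma0B (eqS S T)
  | le {m n : ℕ} (s t : NumTerm L m n) : IsSigma0B (le s t)
  | mem {m n : ℕ} (s : NumTerm L m n) (T : StrTerm L m n) : IsSigma0B (mem s T)
  | not {m n : ℕ} {φ : Formula L m n} : IsSigma0B φ → IsSigma0B (not φ)
  | and {m n : ℕ} {φ ψ : Formula L m n} : IsSigma0B φ → IsSigma0B ψ → IsSigma0B (and φ ψ)
  | or {m n : ℕ} {φ ψ : Formula L m n} : IsSigma0B φ → IsSigma0B ψ → IsSigma0B (or φ ψ)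
  | exLE {m n : ℕ} (t : NumTerm L2A m n) {φ : Formula L (m + 1) n} :
      IsSigma0B φ → IsSigma0B (exLE t φ)
  | allLE {m n : ℕ} (t : NumTerm L2A m n) {φ : Formula L (m + 1) n} :
      IsSigma0B φ → IsSigma0B (allLE t φ)

/-- `Σ^B_1(L)`: a block of bounded existential string quantifiers followed by a `Σ^B_0(L)`
formula. -/
inductive IsSigma1B {L : Vocab} : {m n : ℕ} → Formula L m n → Prop
  | base {m n : ℕ} {φ : Formula L m n} : IsSigma0B φ → IsSigma1B φ
  | exSLE {m n : ℕ} (t : NumTerm L2A m n) {φ : Formula L m (n + 1)} :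
      IsSigma1B φ → IsSigma1B (exSLE t φ)

/-- `Σ^1_1(L)`: a block of existential string quantifiers followed by a `Σ^B_0(L)` formula. -/
inductive IsSigma11 {L : Vocab} : {m n : ℕ} → Formula L m n → Prop
  | base {m n : ℕ} {φ : Formula L m n} : IsSigma0B φ → IsSigma11 φ
  | exS {m n : ℕ} {φ : Formula L m (n + 1)} : IsSigma11 φ → IsSigma11 (exS φ)

end Formula

/-- What may be substituted for a string variable: a string variable, or the row `X_j^{[r]}` of a
string variable, presented by its row index `r`, by `j`, and by a number term `len` for its
length. -/
inductive StrArg (m n : ℕ) : Type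
  | var (j : Fin n) : StrArg m n
  | row (len r : NumTerm L2A m n) (j : Fin n) : StrArg m n

namespace StrArg

/-- The argument read under one more number quantifier. -/
def shiftN {m n : ℕ} : StrArg m n → StrArg (m + 1) n
  | .var j => .var j
  | .row len r j => .row len.shiftN r.shiftN j

/-- The argument read under one more string quantifier. -/
def shiftS {m n : ℕ} : StrArg m n → StrArg m (n + 1)
  | .var j => .var j.succ
  | .row len r j => .row len.shiftS r.shiftS j.succ

/-- The length of the argument. -/
def lenTerm {m n : ℕ} : StrArg m n → NumTerm L2A m n
  | .var j => .len (.var j)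
  | .row len _ _ => len

/-- Membership in the argument: `X_j^{[r]}(s)` is `X_j(⟨r, s⟩)`. -/
def memFormula {m n : ℕ} (s : NumTerm L2A m n) : StrArg m n → Formula L2A m n
  | .var j => .mem s (.var j)
  | .row _ r j => .mem (.pair r s) (.var j)

/-- Equality of two arguments: equality of strings, or, if a row is involved, equal lengths and
equal elements. -/
def eqFormula {m n : ℕ} : StrArg m n → StrArg m n → Formula L2A m n
  | .var i, .var j => .eqS (.var i) (.var j)
  | A, B => .and (.eqN A.lenTerm B.lenTerm)
      (.allLT A.lenTerm (.iff (memFormula (.var 0) A.shiftN) (memFormula (.var 0) B.shiftN)))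

end StrArg

/-- Simultaneous substitution in a number term of the base vocabulary. -/
def NumTerm.subst {m n m₁ n₁ : ℕ} (ν : Fin m → NumTerm L2A m₁ n₁)
    (σ : Fin n → StrArg m₁ n₁) : NumTerm L2A m n → NumTerm L2A m₁ n₁
  | .var i => ν i
  | .zero => .zero
  | .one => .one
  | .add s t => .add (s.subst ν σ) (t.subst ν σ)
  | .mul s t => .mul (s.subst ν σ) (t.subst ν σ)
  | .len (.var j) => (σ j).lenTerm
  | .len (.fn f _ _) => nomatch f
  | .fn f _ _ => nomatch f

/-- The string argument that a string term of the base vocabulary (a variable) becomes. -/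
def StrTerm.subst {m n m₁ n₁ : ℕ} (σ : Fin n → StrArg m₁ n₁) : StrTerm L2A m n → StrArg m₁ n₁
  | .var j => σ j
  | .fn f _ _ => nomatch f

/-- Simultaneous capture-free substitution in a formula of the base vocabulary: number terms for
the number variables, string variables or rows for the string variables. -/
def Formula.subst : {m n m₁ n₁ : ℕ} → Formula L2A m n → (Fin m → NumTerm L2A m₁ n₁) →
    (Fin n → StrArg m₁ n₁) → Formula L2A m₁ n₁
  | _, _, _, _, .tru, _, _ => .tru
  | _, _, _, _, .fls, _, _ => .fls
  | _, _, _, _, .eqN s t, ν, σ => .eqN (s.subst ν σ) (t.subst ν σ)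
  | _, _, _, _, .eqS S T, _, σ => (S.subst σ).eqFormula (T.subst σ)
  | _, _, _, _, .le s t, ν, σ => .le (s.subst ν σ) (t.subst ν σ)
  | _, _, _, _, .mem s T, ν, σ => (T.subst σ).memFormula (s.subst ν σ)
  | _, _, _, _, .not φ, ν, σ => .not (φ.subst ν σ)
  | _, _, _, _, .and φ ψ, ν, σ => .and (φ.subst ν σ) (ψ.subst ν σ)
  | _, _, _, _, .or φ ψ, ν, σ => .or (φ.subst ν σ) (ψ.subst ν σ)
  | _, _, _, _, .exN φ, ν, σ =>
      .exN (φ.subst (Fin.cons (.var 0) fun i => (ν i).shiftN) fun j => (σ j).shiftN)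
  | _, _, _, _, .allN φ, ν, σ =>
      .allN (φ.subst (Fin.cons (.var 0) fun i => (ν i).shiftN) fun j => (σ j).shiftN)
  | _, _, _, _, .exS φ, ν, σ =>
      .exS (φ.subst (fun i => (ν i).shiftS) (Fin.cons (.var 0) fun j => (σ j).shiftS))
  | _, _, _, _, .allS φ, ν, σ =>
      .allS (φ.subst (fun i => (ν i).shiftS) (Fin.cons (.var 0) fun j => (σ j).shiftS))

namespace Formula

/-- Renaming of the variables of a formula of the base vocabulary. -/
def rename {m n m₁ n₁ : ℕ} (φ : Formula L2A m n) (ρ : Fin m → Fin m₁) (τ : Fin n → Fin n₁) :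
    Formula L2A m₁ n₁ :=
  φ.subst (fun i => .var (ρ i)) (fun j => .var (τ j))

/-- `∃! y φ(y)`, that is, `∃ y (φ(y) ∧ ∀ z (φ(z) ⊃ z = y))`. -/
def exUniqueN {m n : ℕ} (φ : Formula L2A (m + 1) n) : Formula L2A m n :=
  exN (and φ (allN (imp (φ.rename (Fin.cons 0 fun i => i.succ.succ) id)
    (eqN (.var 0) (.var 1)))))

/-- `∃! Y φ(Y)`, that is, `∃ Y (φ(Y) ∧ ∀ Z (φ(Z) ⊃ Z = Y))`. -/
def exUniqueS {m n : ℕ} (φ : Formula L2A m (n + 1)) : Formula L2A m n :=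
  exS (and φ (allS (imp (φ.rename id (Fin.cons 0 fun j => j.succ.succ))
    (eqS (.var 0) (.var 1)))))

end Formula

/-! ## The theory `V⁰` -/

open Formula in
/-- The axioms B1–B12, L1, L2 and SE, universally closed. -/
def basicAxioms : Set Sentence :=
  let x : {n : ℕ} → NumTerm L2A 1 n := .var 0
  let x₂ : NumTerm L2A 2 0 := .var 0
  let y₂ : NumTerm L2A 2 0 := .var 1
  let X : {m n : ℕ} → StrTerm L2A m (n + 1) := .var 0
  let Y : {m n : ℕ} → StrTerm L2A m (n + 2) := .var 1
  { close (n := 0) (not (eqN (.add x .one) .zero)),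
    close (imp (eqN (.add x₂ .one) (.add y₂ .one)) (eqN x₂ y₂)),
    close (n := 0) (eqN (.add x .zero) x),
    close (eqN (.add x₂ (.add y₂ .one)) (.add (.add x₂ y₂) .one)),
    close (n := 0) (eqN (.mul x .zero) .zero),
    close (eqN (.mul x₂ (.add y₂ .one)) (.add (.mul x₂ y₂) x₂)),
    close (imp (and (le x₂ y₂) (le y₂ x₂)) (eqN x₂ y₂)),
    close (n := 0) (le .zero x),
    close (m := 3) (n := 0)
      (imp (and (le (.var 0) (.var 1)) (le (.var 1) (.var 2))) (le (.var 0) (.var 2))),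
    close (or (le x₂ y₂) (le y₂ x₂)),
    close (iff (le x₂ y₂) (lt x₂ (.add y₂ .one))),
    close (n := 0)
      (imp (not (eqN x .zero)) (exLT x (eqN (.add (.var 0) .one) (.var 1)))),
    close (n := 1) (imp (mem x X) (lt x (.len X))),
    close (n := 1) (imp (eqN (.add x .one) (.len X)) (mem x X)),
    close (m := 0) (n := 2)
      (iff (eqS X Y)
        (and (eqN (.len X) (.len Y)) (allLT (.len X) (iff (mem (.var 0) X) (mem (.var 0) Y))))) }

open Formula in
/-- The comprehension axiom `∃ X ≤ a ∀ z < a (X(z) ↔ φ(z))`, universally closed. In `φ` the number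
variables are `z`, `a` and `m` parameters, and the string variables are `n` parameters. -/
def comprehension {m n : ℕ} (φ : Formula L2A (m + 2) n) : Sentence :=
  close (m := m + 1) (n := n)
    (exSLE (.var 0) (allLT (.var 0) (iff (mem (.var 0) (.var 0)) (φ.rename id Fin.succ))))

/-- The theory `V⁰`: the basic axioms and the `Σ^B_0` comprehension scheme. -/
def V0 : Set Sentence :=
  basicAxioms ∪ {ψ | ∃ (m n : ℕ) (φ : Formula L2A (m + 2) n), φ.IsSigma0B ∧ ψ = comprehension φ}

/-! ## The axiom for a bounded recursion -/

open Formula in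
/-- `ℓ = |X_j^{[r]}|`, where `X_j^{[r]} = {i : X_j(⟨r, i⟩)}`: every element of the row is below
`ℓ`, and if `ℓ ≠ 0` then its predecessor is an element of the row. -/
def rowLength {m n : ℕ} (ℓ r : NumTerm L2A m n) (j : Fin n) : Formula L2A m n :=
  and
    (allLT (.len (.var j)) (imp (mem (.pair r.shiftN (.var 0)) (.var j)) (lt (.var 0) ℓ.shiftN)))
    (or (eqN ℓ .zero)
      (exLT ℓ (and (eqN (.add (.var 0) .one) ℓ.shiftN)
        (mem (.pair r.shiftN (.var 0)) (.var j)))))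

/-- The bound `⟨⟨b, a⟩, t(a, |X|)⟩` in number variables `b, a` (indices `0`, `1`) for a string
variable `X` with index `j`. -/
def recBound {n : ℕ} (t : NumTerm L2A 2 0) (j : Fin n) : NumTerm L2A 2 n :=
  .pair (.pair (.var 0) (.var 1)) (t.subst ![.var 1, .len (.var j)] Fin.elim0)

open Formula in
/-- The formula `φ_F(a, b, X, Y)`: for every `y < b`,
`Y^{[y,0]}(z) ↔ z < t(0, |X^{[y]}|) ∧ φInit(z, X^{[y]})` and, for every `x < a`,
`Y^{[y,x+1]}(z) ↔ z < t(x+1, |X^{[y]}|) ∧ φNext(z, x, X^{[y]}, Y^{[y,x]})`,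
where `z` ranges over the numbers below `⟨⟨b, a⟩, t(a, |X|)⟩`. The number variables are `b, a` and
the string variables are `Y, X`, in the order of their indices. The rows that occur are removed
with the help of number variables `ℓ = |X^{[y]}|` and `k = |Y^{[y,x]}|`. -/
def recFormula (φInit : Formula L2A 1 1) (φNext : Formula L2A 2 2) (t : NumTerm L2A 2 0) :
    Formula L2A 2 2 :=
  allLT (.var 0) <|
  -- number variables y, b, a
  exLE (.len (.var 1)) <|
  -- number variables ℓ, y, b, a
  and (rowLength (.var 0) (.var 1) 1) <|
  and
    (allLT ((recBound t 1).rename ![2, 3] id) <|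
      -- number variables z, ℓ, y, b, a
      iff (mem (.pair (.pair (.var 2) .zero) (.var 0)) (.var 0))
        (and (lt (.var 0) (t.subst ![.zero, .var 1] Fin.elim0))
          (φInit.subst ![.var 0] ![.row (.var 1) (.var 2) 1])))
    (allLT (.var 3) <|
      -- number variables x, ℓ, y, b, a
      exLE (.len (.var 0)) <|
      -- number variables k, x, ℓ, y, b, a
      and (rowLength (.var 0) (.pair (.var 3) (.var 1)) 0) <|
      allLT ((recBound t 1).rename ![4, 5] id) <|
      -- number variables z, k, x, ℓ, y, b, a
      iff (mem (.pair (.pair (.var 4) (.add (.var 2) .one)) (.var 0)) (.var 0))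
        (and (lt (.var 0) (t.subst ![.add (.var 2) .one, .var 3] Fin.elim0))
          (φNext.subst ![.var 0, .var 2]
            ![.row (.var 3) (.var 4) 1, .row (.var 1) (.pair (.var 4) (.var 2)) 0])))

open Formula in
/-- `AXIOM_F`, that is, `∀ a ∀ b ∀ X ∃ Y ≤ ⟨⟨b, a⟩, t(a, |X|)⟩ φ_F(a, b, X, Y)`. -/
def recAxiom (φInit : Formula L2A 1 1) (φNext : Formula L2A 2 2) (t : NumTerm L2A 2 0) :
    Sentence :=
  allN (allN (allS (exSLE (recBound t 0) (recFormula φInit φNext t))))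

/-- The theory `V⁰ + AXIOM_F`. -/
def recTheory (φInit : Formula L2A 1 1) (φNext : Formula L2A 2 2) (t : NumTerm L2A 2 0) :
    Set Sentence :=
  V0 ∪ {recAxiom φInit φNext t}

/-! ## Functions on the standard model -/

/-- Number functions with `k` number and `l` string arguments; strings are finite sets. -/
abbrev NumFun (k l : ℕ) : Type := (Fin k → ℕ) → (Fin l → Finset ℕ) → ℕ

/-- String functions with `k` number and `l` string arguments. -/
abbrev StrFun (k l : ℕ) : Type := (Fin k → ℕ) → (Fin l → Finset ℕ) → Finset ℕ

/-- The length of a string: `0` for the empty set, otherwise one plus the largest element. -/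
def strLen (X : Finset ℕ) : ℕ := X.sup fun i => i + 1

/-- The expansion of the standard structure by an interpretation of the function symbols. -/
abbrev stdStructure (L : Vocab) (numFn : ∀ k l : ℕ, L.NumFn k l → NumFun k l)
    (strFn : ∀ k l : ℕ, L.StrFn k l → StrFun k l) : Structure L where
  Num := ℕ
  Str := Finset ℕ
  str_nonempty := ⟨∅⟩
  zero := 0
  one := 1
  add := fun x y => x + y
  mul := fun x y => x * y
  len := strLen
  le := fun x y => x ≤ y
  mem := fun x X => x ∈ X
  numFn := fun {k l} f => numFn k l f
  strFn := fun {k l} f => strFn k l f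

/-- The standard structure for the base vocabulary. -/
abbrev N2 : Structure L2A :=
  stdStructure L2A (fun _ _ f => nomatch f) (fun _ _ f => nomatch f)

open Classical in
/-- The function `F(x, X)` defined by the bounded recursion
`F(0, X)(z) ↔ z < t(0, |X|) ∧ φInit(z, X)` and
`F(x+1, X)(z) ↔ z < t(x+1, |X|) ∧ φNext(z, x, X, F(x, X))`. -/
noncomputable def boundedRec (φInit : Formula L2A 1 1) (φNext : Formula L2A 2 2)
    (t : NumTerm L2A 2 0) : ℕ → Finset ℕ → Finset ℕ
  | 0, X => (Finset.range (t.eval N2 (![0, strLen X] : Fin 2 → ℕ) Fin.elim0)).filter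
      fun z : ℕ => φInit.Realize N2 ![z] ![X]
  | x + 1, X => (Finset.range (t.eval N2 (![x + 1, strLen X] : Fin 2 → ℕ) Fin.elim0)).filter
      fun z : ℕ => φNext.Realize N2 ![z, x] ![X, boundedRec φInit φNext t x X]

/-- The function `F(x, X)` as a string function with one number and one string argument. -/
noncomputable def recFun (φInit : Formula L2A 1 1) (φNext : Formula L2A 2 2)
    (t : NumTerm L2A 2 0) : StrFun 1 1 :=
  fun x X => boundedRec φInit φNext t (x 0) (X 0)

/-! ## Definability in a theory -/

/-- The number function `f` is `Γ`-definable in `T`: some formula `φ` in `Γ` defines the graph of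
`f` on the standard model, and `T ⊢ ∀ x ∀ X ∃! y φ`. The variable `y` has index `0`. -/
def NumDefinable (T : Set Sentence) (Γ : {m n : ℕ} → Formula L2A m n → Prop) {k l : ℕ}
    (f : NumFun k l) : Prop :=
  ∃ φ : Formula L2A (k + 1) l, Γ φ ∧
    (∀ (y : ℕ) (x : Fin k → ℕ) (X : Fin l → Finset ℕ),
      y = f x X ↔ φ.Realize N2 (Fin.cons y x) X) ∧
    Proves T φ.exUniqueN.close

/-- The string function `G` is `Γ`-definable in `T`: some formula `φ` in `Γ` defines the graph of
`G` on the standard model, and `T ⊢ ∀ x ∀ X ∃! Y φ`. The variable `Y` has index `0`. -/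
def StrDefinable (T : Set Sentence) (Γ : {m n : ℕ} → Formula L2A m n → Prop) {k l : ℕ}
    (G : StrFun k l) : Prop :=
  ∃ φ : Formula L2A k (l + 1), Γ φ ∧
    (∀ (Y : Finset ℕ) (x : Fin k → ℕ) (X : Fin l → Finset ℕ),
      Y = G x X ↔ φ.Realize N2 x (Fin.cons Y X)) ∧
    Proves T φ.exUniqueS.close

/-! ## Classes of functions -/

/-- A class of number functions and string functions. -/
structure FunClass where
  num : ∀ k l : ℕ, Set (NumFun k l)
  str : ∀ k l : ℕ, Set (StrFun k l)

namespace FunClass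

/-- The vocabulary with a symbol for every function of the class. -/
def vocab (C : FunClass) : Vocab where
  NumFn := fun k l => {f : NumFun k l // f ∈ C.num k l}
  StrFn := fun k l => {G : StrFun k l // G ∈ C.str k l}

/-- The standard structure, in which every function of the class interprets its symbol. -/
abbrev std (C : FunClass) : Structure C.vocab :=
  stdStructure C.vocab (fun _ _ f => f.1) (fun _ _ G => G.1)

open Classical in
/-- The string function `F_{α,t}(x, X) = {z < t(x, X) : α(z, x, X)}`. -/
noncomputable def bitFun (C : FunClass) {k l : ℕ} (α : Formula C.vocab (k + 1) l)
    (t : NumTerm L2A k l) : StrFun k l :=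
  fun x X => (Finset.range (t.eval N2 x X)).filter
    fun z : ℕ => α.Realize C.std (Fin.cons z x) X

/-- The number function `f_{α,t}(x, X)`: the least `z < t(x, X)` with `α(z, x, X)`, and
`t(x, X)` if there is none. -/
noncomputable def minFun (C : FunClass) {k l : ℕ} (α : Formula C.vocab (k + 1) l)
    (t : NumTerm L2A k l) : NumFun k l :=
  fun x X => sInf {z : ℕ | z = t.eval N2 x X ∨
    (z < t.eval N2 x X ∧ α.Realize C.std (Fin.cons z x) X)}

/-- The class contains the functions of the base vocabulary, the predecessor function `pd`, the
function `f_SE` (the least number below `|X|` that distinguishes `X` from `Y`, and `|X|` if there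
is none) and the function `F`, and with every open formula `α` over the class and every term `t`
of the base vocabulary it contains `F_{α,t}` and `f_{α,t}`. -/
structure IsClosed (F : StrFun 1 1) (C : FunClass) : Prop where
  zero_mem : (fun _ _ => 0) ∈ C.num 0 0
  one_mem : (fun _ _ => 1) ∈ C.num 0 0
  add_mem : (fun x _ => x 0 + x 1) ∈ C.num 2 0
  mul_mem : (fun x _ => x 0 * x 1) ∈ C.num 2 0
  len_mem : (fun _ X => strLen (X 0)) ∈ C.num 0 1
  pd_mem : (fun x _ => x 0 - 1) ∈ C.num 1 0
  fSE_mem : (fun _ X => sInf {z : ℕ | z = strLen (X 0) ∨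
    (z < strLen (X 0) ∧ ¬ (z ∈ X 0 ↔ z ∈ X 1))}) ∈ C.num 0 2
  rec_mem : F ∈ C.str 1 1
  bitFun_mem : ∀ {k l : ℕ} (α : Formula C.vocab (k + 1) l) (t : NumTerm L2A k l),
    α.IsOpen → C.bitFun α t ∈ C.str k l
  minFun_mem : ∀ {k l : ℕ} (α : Formula C.vocab (k + 1) l) (t : NumTerm L2A k l),
    α.IsOpen → C.minFun α t ∈ C.num k l

/-- The functions of `L_FC`: the smallest class that is closed in the above sense. -/
def LFC (F : StrFun 1 1) : FunClass where
  num := fun k l => {f | ∀ C : FunClass, C.IsClosed F → f ∈ C.num k l}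
  str := fun k l => {G | ∀ C : FunClass, C.IsClosed F → G ∈ C.str k l}

/-- The number function `f` is polynomially bounded: `f(x, X) < p(x, |X|)` for a polynomial `p`. -/
def NumPBounded {k l : ℕ} (f : NumFun k l) : Prop :=
  ∃ p : MvPolynomial (Fin k ⊕ Fin l) ℕ, ∀ (x : Fin k → ℕ) (X : Fin l → Finset ℕ),
    f x X < MvPolynomial.eval (Sum.elim x fun j => strLen (X j)) p

/-- The string function `G` is polynomially bounded: `|G(x, X)| < p(x, |X|)` for a
polynomial `p`. -/
def StrPBounded {k l : ℕ} (G : StrFun k l) : Prop :=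
  ∃ p : MvPolynomial (Fin k ⊕ Fin l) ℕ, ∀ (x : Fin k → ℕ) (X : Fin l → Finset ℕ),
    strLen (G x X) < MvPolynomial.eval (Sum.elim x fun j => strLen (X j)) p

/-- The number function `f` is `Σ^B_0`-definable from the class: it is polynomially bounded and its
graph is represented by a `Σ^B_0` formula over the class. -/
def NumSigma0BDefinable (C : FunClass) {k l : ℕ} (f : NumFun k l) : Prop :=
  NumPBounded f ∧ ∃ φ : Formula C.vocab (k + 1) l, φ.IsSigma0B ∧
    ∀ (y : ℕ) (x : Fin k → ℕ) (X : Fin l → Finset ℕ),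
      y = f x X ↔ φ.Realize C.std (Fin.cons y x) X

/-- The string function `G` is `Σ^B_0`-definable from the class: it is polynomially bounded and its
bit graph is represented by a `Σ^B_0` formula over the class. -/
def StrSigma0BDefinable (C : FunClass) {k l : ℕ} (G : StrFun k l) : Prop :=
  StrPBounded G ∧ ∃ φ : Formula C.vocab (k + 1) l, φ.IsSigma0B ∧
    ∀ (z : ℕ) (x : Fin k → ℕ) (X : Fin l → Finset ℕ),
      z ∈ G x X ↔ φ.Realize C.std (Fin.cons z x) X

/-- The class whose only function is the string function `F`. -/
def single (F : StrFun 1 1) : FunClass where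
  num := fun _ _ => ∅
  str := fun k l => {G | (⟨k, l, G⟩ : (k l : ℕ) × StrFun k l) = ⟨1, 1, F⟩}

/-- The class enlarged by the string functions in a list. -/
def adjoin (C : FunClass) (Gs : List ((k l : ℕ) × StrFun k l)) : FunClass where
  num := C.num
  str := fun k l => {G | G ∈ C.str k l ∨ ⟨k, l, G⟩ ∈ Gs}

/-- A sequence of string functions, the latest first, each of which is `Σ^B_0`-definable from the
class and the earlier ones. -/
inductive IsChain (C : FunClass) : List ((k l : ℕ) × StrFun k l) → Prop
  | nil : IsChain C []
  | cons {k l : ℕ} {G : StrFun k l} {Gs : List ((k l : ℕ) × StrFun k l)} :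
      IsChain C Gs → (C.adjoin Gs).StrSigma0BDefinable G → IsChain C (⟨k, l, G⟩ :: Gs)

/-- The number function `f` is `AC⁰`-reducible to the class. -/
def NumAC0Reducible (C : FunClass) {k l : ℕ} (f : NumFun k l) : Prop :=
  ∃ Gs, C.IsChain Gs ∧ (C.adjoin Gs).NumSigma0BDefinable f

/-- The string function `G` is `AC⁰`-reducible to the class. -/
def StrAC0Reducible (C : FunClass) {k l : ℕ} (G : StrFun k l) : Prop :=
  ∃ Gs, C.IsChain Gs ∧ (C.adjoin Gs).StrSigma0BDefinable G

end FunClass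

end TwoSorted

open TwoSorted

-- All the function classes are compared with a single one, the functions computed by straight-line
-- programs (`RecData.PF`, and `RecData.PFnum` for numbers written in unary). A step of a program is
-- either bounded comprehension with a `Σ^B_0` formula or one run of the recursion, which produces
-- all stages `F(x, X^{[y]})`, `x ≤ a`, `y < b`, at once. The equivalences follow from the cycle:
-- `Σ¹₁`-definable ⟹ program ⟹ `AC⁰`-reducible ⟹ `L_FC` ⟹ program ⟹ `Σ^B_1`-definable ⟹
-- `Σ¹₁`-definable.
--
-- Finite axiomatizability is proved in the manner of Gödel and Bernays. Finitely many comprehension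
-- instances give enough induction to make the numbers an ordered semiring with an injective
-- pairing. Finitely many more give set operations (complement, intersection, projection, graphs of
-- `+` and `·`, and so on), by which the set of codes of tuples satisfying a bounded formula is
-- built along the formula (`Structure.coded_realize`). Hence all of `V⁰` follows, and `AXIOM_F` is
-- only one more sentence.
--
-- From programs to definability: every step has a `Σ^B_0` graph and, in every model of the theory,
-- exactly one value of bounded length. For the recursion step this requires trimming the string
-- given by `AXIOM_F` (`RecData.exists_recGraph`, `RecData.RecGraph.unique`). Quantifying over the
-- intermediate strings gives a `Σ^B_1` definition (`Prog.exists_wrap`).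
--
-- From `L_FC` to programs: open formulas over the class may nest functions of the class under the
-- variable `z` of a comprehension or a minimization, so a program has to evaluate a function at all
-- `z` below a bound simultaneously. This is `RecData.collect_mem_PF`; its main case merges many
-- runs of the recursion into one run with more rows, for which the parameter `b` of `AXIOM_F` is
-- made.
--
-- From programs to `AC⁰` reductions, each step becomes a member of the chain. From `AC⁰` reductions
-- to `L_FC`, bounded quantifiers are eliminated by minimization
-- (`FunClass.exists_isOpen_of_isSigma0B`).
--
-- Witnessing is model-theoretic. The functions computed by programs, modulo an ultrafilter on the
-- set of inputs, form a model of the theory (`RecData.isModel_ultra`). A provably total function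
-- therefore has a value at the generic input of this model, and that value is the germ of a
-- program. A `Σ¹₁` formula true there is true on a set of inputs decided by a program. Since this
-- holds for every ultrafilter, finitely many programs combined by cases compute the function
-- everywhere (`RecData.mem_PF_of_locally`).

namespace TwoSorted

/-! ## Terms and formulas of the base vocabulary -/

/-- Induction on number terms of the base vocabulary, whose only string terms are variables. -/
theorem NumTerm.baseInduction {m n : ℕ} {P : NumTerm L2A m n → Prop}
    (var : ∀ i, P (.var i)) (zero : P .zero) (one : P .one)
    (add : ∀ s t, P s → P t → P (.add s t)) (mul : ∀ s t, P s → P t → P (.mul s t))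
    (len : ∀ j, P (.len (.var j))) : ∀ t, P t
  | .var i => var i
  | .zero => zero
  | .one => one
  | .add s t => add s t (baseInduction var zero one add mul len s)
      (baseInduction var zero one add mul len t)
  | .mul s t => mul s t (baseInduction var zero one add mul len s)
      (baseInduction var zero one add mul len t)
  | .len (.var j) => len j
  | .len (.fn f _ _) => nomatch f
  | .fn f _ _ => nomatch f

theorem StrTerm.exists_eq_var {m n : ℕ} : ∀ T : StrTerm L2A m n, ∃ j, T = .var j
  | .var j => ⟨j, rfl⟩
  | .fn f _ _ => nomatch f

theorem NumTerm.ofBase_eq_self {m n : ℕ} (t : NumTerm L2A m n) : (t.ofBase : NumTerm L2A m n) = t := by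
  induction t using NumTerm.baseInduction <;> simp_all [NumTerm.ofBase]

/-- The restriction of a structure to the base vocabulary. -/
abbrev Structure.reduct {L : Vocab} (M : Structure L) : Structure L2A where
  Num := M.Num
  Str := M.Str
  str_nonempty := M.str_nonempty
  zero := M.zero
  one := M.one
  add := M.add
  mul := M.mul
  len := M.len
  le := M.le
  mem := M.mem
  numFn := fun f => nomatch f
  strFn := fun f => nomatch f

theorem NumTerm.eval_ofBase {L : Vocab} {m n : ℕ} (M : Structure L) (v : Fin m → M.Num)
    (V : Fin n → M.Str) (t : NumTerm L2A m n) :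
    (t.ofBase : NumTerm L m n).eval M v V = t.eval M.reduct v V := by
  induction t using NumTerm.baseInduction <;>
    simp_all [NumTerm.ofBase, NumTerm.eval, StrTerm.eval, Structure.reduct]

theorem NumTerm.eval_rename {m n m₁ n₁ : ℕ} (M : Structure L2A) (ρ : Fin m → Fin m₁)
    (τ : Fin n → Fin n₁) (v : Fin m₁ → M.Num) (V : Fin n₁ → M.Str) (t : NumTerm L2A m n) :
    (t.rename ρ τ).eval M v V = t.eval M (fun i => v (ρ i)) (fun j => V (τ j)) := by
  induction t using NumTerm.baseInduction <;>
    simp_all [NumTerm.rename, NumTerm.eval, StrTerm.eval]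

@[simp] theorem NumTerm.eval_shiftN {m n : ℕ} (M : Structure L2A) (x : M.Num) (v : Fin m → M.Num)
    (V : Fin n → M.Str) (t : NumTerm L2A m n) :
    t.shiftN.eval M (Fin.cons x v : Fin (m + 1) → M.Num) V = t.eval M v V := by
  simp [NumTerm.shiftN, NumTerm.eval_rename]

@[simp] theorem NumTerm.eval_shiftS {m n : ℕ} (M : Structure L2A) (X : M.Str) (v : Fin m → M.Num)
    (V : Fin n → M.Str) (t : NumTerm L2A m n) :
    t.shiftS.eval M v (Fin.cons X V : Fin (n + 1) → M.Str) = t.eval M v V := by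
  simp [NumTerm.shiftS, NumTerm.eval_rename]

@[simp] theorem NumTerm.eval_base_ofBase {m n : ℕ} (M : Structure L2A) (v : Fin m → M.Num)
    (V : Fin n → M.Str) (t : NumTerm L2A m n) :
    (t.ofBase : NumTerm L2A m n).eval M v V = t.eval M v V := by
  rw [NumTerm.ofBase_eq_self]

/-- `x < y`, that is, `x ≤ y` and `x ≠ y`. -/
def Structure.lt {L : Vocab} (M : Structure L) (x y : M.Num) : Prop := M.le x y ∧ x ≠ y

/-- The pairing function of a structure. -/
def Structure.pair {L : Vocab} (M : Structure L) (x y : M.Num) : M.Num :=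
  M.add (M.mul (M.add x y) (M.add (M.add x y) M.one)) (M.mul (M.add M.one M.one) y)

-- Truth of connectives and bounded quantifiers.

section Realize
variable {L : Vocab} (M : Structure L) {m n : ℕ} (v : Fin m → M.Num) (V : Fin n → M.Str)

@[simp] theorem NumTerm.eval_var (i : Fin m) : (.var i : NumTerm L m n).eval M v V = v i := by
  simp [NumTerm.eval]
@[simp] theorem NumTerm.eval_zero : (.zero : NumTerm L m n).eval M v V = M.zero := by
  simp [NumTerm.eval]
@[simp] theorem NumTerm.eval_one : (.one : NumTerm L m n).eval M v V = M.one := by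
  simp [NumTerm.eval]
@[simp] theorem NumTerm.eval_add (s t : NumTerm L m n) :
    (NumTerm.add s t).eval M v V = M.add (s.eval M v V) (t.eval M v V) := by simp [NumTerm.eval]
@[simp] theorem NumTerm.eval_mul (s t : NumTerm L m n) :
    (NumTerm.mul s t).eval M v V = M.mul (s.eval M v V) (t.eval M v V) := by simp [NumTerm.eval]
@[simp] theorem NumTerm.eval_len (T : StrTerm L m n) :
    (NumTerm.len T).eval M v V = M.len (T.eval M v V) := by simp [NumTerm.eval]
@[simp] theorem StrTerm.eval_var (j : Fin n) : (.var j : StrTerm L m n).eval M v V = V j := by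
  simp [StrTerm.eval]
@[simp] theorem NumTerm.eval_pair (s t : NumTerm L m n) :
    (NumTerm.pair s t).eval M v V = M.pair (s.eval M v V) (t.eval M v V) := by
  simp [NumTerm.pair, Structure.pair]

namespace Formula

@[simp] theorem realize_tru : (tru : Formula L m n).Realize M v V ↔ True := Iff.rfl
@[simp] theorem realize_fls : (fls : Formula L m n).Realize M v V ↔ False := Iff.rfl
@[simp] theorem realize_eqN (s t : NumTerm L m n) :
    (eqN s t).Realize M v V ↔ s.eval M v V = t.eval M v V := Iff.rfl
@[simp] theorem realize_eqS (S T : StrTerm L m n) :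
    (eqS S T).Realize M v V ↔ S.eval M v V = T.eval M v V := Iff.rfl
@[simp] theorem realize_le (s t : NumTerm L m n) :
    (le s t).Realize M v V ↔ M.le (s.eval M v V) (t.eval M v V) := Iff.rfl
@[simp] theorem realize_mem (s : NumTerm L m n) (T : StrTerm L m n) :
    (mem s T).Realize M v V ↔ M.mem (s.eval M v V) (T.eval M v V) := Iff.rfl
@[simp] theorem realize_not (φ : Formula L m n) : (not φ).Realize M v V ↔ ¬ φ.Realize M v V :=
  Iff.rfl
@[simp] theorem realize_and (φ ψ : Formula L m n) :
    (and φ ψ).Realize M v V ↔ φ.Realize M v V ∧ ψ.Realize M v V := Iff.rfl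
@[simp] theorem realize_or (φ ψ : Formula L m n) :
    (or φ ψ).Realize M v V ↔ φ.Realize M v V ∨ ψ.Realize M v V := Iff.rfl
@[simp] theorem realize_exN (φ : Formula L (m + 1) n) :
    (exN φ).Realize M v V ↔ ∃ x : M.Num, φ.Realize M (Fin.cons x v) V := Iff.rfl
@[simp] theorem realize_allN (φ : Formula L (m + 1) n) :
    (allN φ).Realize M v V ↔ ∀ x : M.Num, φ.Realize M (Fin.cons x v) V := Iff.rfl
@[simp] theorem realize_exS (φ : Formula L m (n + 1)) :
    (exS φ).Realize M v V ↔ ∃ X : M.Str, φ.Realize M v (Fin.cons X V) := Iff.rfl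
@[simp] theorem realize_allS (φ : Formula L m (n + 1)) :
    (allS φ).Realize M v V ↔ ∀ X : M.Str, φ.Realize M v (Fin.cons X V) := Iff.rfl
@[simp] theorem realize_imp (φ ψ : Formula L m n) :
    (imp φ ψ).Realize M v V ↔ (φ.Realize M v V → ψ.Realize M v V) := by
  simp [imp, imp_iff_not_or]
@[simp] theorem realize_iff (φ ψ : Formula L m n) :
    (iff φ ψ).Realize M v V ↔ (φ.Realize M v V ↔ ψ.Realize M v V) := by
  simp [iff, iff_iff_implies_and_implies]
@[simp] theorem realize_lt (s t : NumTerm L m n) :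
    (lt s t).Realize M v V ↔ M.lt (s.eval M v V) (t.eval M v V) := Iff.rfl

theorem realize_exLE' (t : NumTerm L2A m n) (φ : Formula L (m + 1) n) :
    (exLE t φ).Realize M v V ↔
      ∃ x, M.le x (t.eval M.reduct v V) ∧ φ.Realize M (Fin.cons x v) V := by
  have h := fun x : M.Num => NumTerm.eval_shiftN M.reduct x v V t
  simp [exLE, NumTerm.eval_ofBase, h]

theorem realize_allLE' (t : NumTerm L2A m n) (φ : Formula L (m + 1) n) :
    (allLE t φ).Realize M v V ↔
      ∀ x, M.le x (t.eval M.reduct v V) → φ.Realize M (Fin.cons x v) V := by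
  have h := fun x : M.Num => NumTerm.eval_shiftN M.reduct x v V t
  simp [allLE, NumTerm.eval_ofBase, h]

end Formula
end Realize

section Base
variable (M : Structure L2A) {m n : ℕ} (v : Fin m → M.Num) (V : Fin n → M.Str)

namespace Formula

@[simp] theorem realize_exLE (t : NumTerm L2A m n) (φ : Formula L2A (m + 1) n) :
    (exLE t φ).Realize M v V ↔ ∃ x, M.le x (t.eval M v V) ∧ φ.Realize M (Fin.cons x v) V := by
  simp [exLE]
@[simp] theorem realize_allLE (t : NumTerm L2A m n) (φ : Formula L2A (m + 1) n) :
    (allLE t φ).Realize M v V ↔ ∀ x, M.le x (t.eval M v V) → φ.Realize M (Fin.cons x v) V := by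
  simp [allLE]
@[simp] theorem realize_exLT (t : NumTerm L2A m n) (φ : Formula L2A (m + 1) n) :
    (exLT t φ).Realize M v V ↔ ∃ x, M.lt x (t.eval M v V) ∧ φ.Realize M (Fin.cons x v) V := by
  simp [exLT, Structure.lt, and_assoc]
@[simp] theorem realize_allLT (t : NumTerm L2A m n) (φ : Formula L2A (m + 1) n) :
    (allLT t φ).Realize M v V ↔ ∀ x, M.lt x (t.eval M v V) → φ.Realize M (Fin.cons x v) V := by
  simp [allLT, Structure.lt]
@[simp] theorem realize_exSLE (t : NumTerm L2A m n) (φ : Formula L2A m (n + 1)) :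
    (exSLE t φ).Realize M v V ↔
      ∃ X, M.le (M.len X) (t.eval M v V) ∧ φ.Realize M v (Fin.cons X V) := by
  simp [exSLE]

theorem satisfies_closeNum : ∀ {m : ℕ} (φ : Formula L2A m 0),
    M.Satisfies φ.closeNum ↔ ∀ v : Fin m → M.Num, φ.Realize M v Fin.elim0
  | 0, φ => by
      constructor
      · intro h v
        rw [Subsingleton.elim v Fin.elim0]
        exact h
      · intro h
        exact h _
  | m + 1, φ => by
      rw [closeNum, satisfies_closeNum]
      constructor
      · intro h v
        rw [← Fin.cons_self_tail v]
        exact h _ _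
      · intro h v x
        exact h _

theorem satisfies_close {m : ℕ} : ∀ {n : ℕ} (φ : Formula L2A m n),
    M.Satisfies φ.close ↔ ∀ (v : Fin m → M.Num) (V : Fin n → M.Str), φ.Realize M v V
  | 0, φ => by
      rw [close, satisfies_closeNum]
      refine forall_congr' fun v => ⟨fun h V => ?_, fun h => h _⟩
      rwa [Subsingleton.elim V Fin.elim0]
  | n + 1, φ => by
      rw [close, satisfies_close]
      refine forall_congr' fun v => ⟨fun h V => ?_, fun h V X => h _⟩
      rw [← Fin.cons_self_tail V]
      exact h _ _

end Formula
end Base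

/-- Extensionality of strings: the axiom SE. -/
def Structure.Ext (M : Structure L2A) : Prop :=
  ∀ X Y : M.Str, X = Y ↔ M.len X = M.len Y ∧ ∀ z, M.lt z (M.len X) → (M.mem z X ↔ M.mem z Y)

/-- The string `X` is a value of the argument `A`. -/
def StrArg.Denotes (M : Structure L2A) {m n : ℕ} (v : Fin m → M.Num) (V : Fin n → M.Str) :
    StrArg m n → M.Str → Prop
  | .var j, X => X = V j
  | .row len r j, X => M.len X = len.eval M v V ∧
      ∀ z, M.mem z X ↔ M.mem (M.pair (r.eval M v V) z) (V j)

-- Soundness of substituting terms and rows.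

section Subst
variable {M : Structure L2A} {m n m₁ n₁ : ℕ}

theorem StrArg.Denotes.shiftN {v : Fin m → M.Num} {V : Fin n → M.Str} {A : StrArg m n}
    {X : M.Str} (h : A.Denotes M v V X) (x : M.Num) :
    A.shiftN.Denotes M (Fin.cons x v : Fin (m + 1) → M.Num) V X := by
  cases A <;> simpa [StrArg.shiftN, StrArg.Denotes] using h

theorem StrArg.Denotes.shiftS {v : Fin m → M.Num} {V : Fin n → M.Str} {A : StrArg m n}
    {X : M.Str} (h : A.Denotes M v V X) (Y : M.Str) :
    A.shiftS.Denotes M v (Fin.cons Y V : Fin (n + 1) → M.Str) X := by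
  cases A <;> simpa [StrArg.shiftS, StrArg.Denotes] using h

theorem StrArg.Denotes.eval_lenTerm {v : Fin m → M.Num} {V : Fin n → M.Str} {A : StrArg m n}
    {X : M.Str} (h : A.Denotes M v V X) : A.lenTerm.eval M v V = M.len X := by
  cases A with
  | var j => simp only [StrArg.Denotes] at h; simp [StrArg.lenTerm, h]
  | row len r j => exact h.1.symm

theorem StrArg.Denotes.realize_memFormula {v : Fin m → M.Num} {V : Fin n → M.Str}
    {A : StrArg m n} {X : M.Str} (h : A.Denotes M v V X) (s : NumTerm L2A m n) :
    (A.memFormula s).Realize M v V ↔ M.mem (s.eval M v V) X := by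
  cases A with
  | var j => simp only [StrArg.Denotes] at h; simp [StrArg.memFormula, h]
  | row len r j => simp [StrArg.memFormula, h.2]

/-- Equality with a row is only expressed through lengths and elements, so identifying it with
equality of strings requires SE. Between two variables it is literal equality, in any structure. -/
theorem StrArg.Denotes.realize_eqFormula {v : Fin m → M.Num} {V : Fin n → M.Str}
    {A B : StrArg m n} {X Y : M.Str} (hA : A.Denotes M v V X) (hB : B.Denotes M v V Y)
    (hM : M.Ext ∨ (∃ i, A = .var i) ∧ ∃ i, B = .var i) :
    (A.eqFormula B).Realize M v V ↔ X = Y := by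
  by_cases hv : (∃ i, A = .var i) ∧ ∃ i, B = .var i
  · obtain ⟨⟨i, rfl⟩, j, rfl⟩ := hv
    simp only [StrArg.Denotes] at hA hB
    simp [StrArg.eqFormula, hA, hB]
  · have key : (Formula.and (.eqN A.lenTerm B.lenTerm) (.allLT A.lenTerm
        (.iff (memFormula (.var 0) A.shiftN) (memFormula (.var 0) B.shiftN)))).Realize M v V ↔
        X = Y := by
      rw [(hM.resolve_right hv) X Y]
      simp [hA.eval_lenTerm, hB.eval_lenTerm, (hA.shiftN _).realize_memFormula,
        (hB.shiftN _).realize_memFormula]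
    cases A <;> cases B <;> first | exact key | exact absurd ⟨⟨_, rfl⟩, _, rfl⟩ hv

theorem NumTerm.eval_subst {ν : Fin m → NumTerm L2A m₁ n₁} {σ : Fin n → StrArg m₁ n₁}
    {v : Fin m₁ → M.Num} {V : Fin n₁ → M.Str} {W : Fin n → M.Str}
    (h : ∀ j, (σ j).Denotes M v V (W j)) (t : NumTerm L2A m n) :
    (t.subst ν σ).eval M v V = t.eval M (fun i => (ν i).eval M v V) W := by
  induction t using NumTerm.baseInduction <;>
    simp_all [NumTerm.subst, (h _).eval_lenTerm]

/-- The second hypothesis covers two uses: plain renamings, which are sound in every structure and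
serve to unfold `exUniqueN`, `exUniqueS` and `comprehension` before any axiom is available, and
rows, which need extensionality. -/
theorem Formula.realize_subst {φ : Formula L2A m n} : ∀ {m₁ n₁ : ℕ}
    {ν : Fin m → NumTerm L2A m₁ n₁} {σ : Fin n → StrArg m₁ n₁}
    {v : Fin m₁ → M.Num} {V : Fin n₁ → M.Str} {W : Fin n → M.Str}
    (_ : ∀ j, (σ j).Denotes M v V (W j)) (_ : M.Ext ∨ ∀ j, ∃ i, σ j = .var i),
    (φ.subst ν σ).Realize M v V ↔ φ.Realize M (fun i => (ν i).eval M v V) W := by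
  have hN : ∀ {m m₁ n₁ : ℕ} (x : M.Num) (v : Fin m₁ → M.Num) (V : Fin n₁ → M.Str)
      (ν : Fin m → NumTerm L2A m₁ n₁),
      (fun i => ((Fin.cons (.var 0) fun i => (ν i).shiftN : Fin (m + 1) → NumTerm L2A _ _) i).eval M
        (Fin.cons x v : Fin (m₁ + 1) → M.Num) V) =
      (Fin.cons x fun i => (ν i).eval M v V : Fin (m + 1) → M.Num) := by
    intro m m₁ n₁ x v V ν
    funext i
    refine Fin.cases ?_ (fun i => ?_) i <;> simp
  have eN : ∀ {n m₁ n₁ : ℕ} {σ : Fin n → StrArg m₁ n₁}, (M.Ext ∨ ∀ j, ∃ i, σ j = .var i) →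
      (M.Ext ∨ ∀ j, ∃ i, (σ j).shiftN = .var i) := by
    rintro n m₁ n₁ σ (h | h)
    · exact .inl h
    · refine .inr fun j => ?_
      obtain ⟨i, hi⟩ := h j
      exact ⟨i, by rw [hi]; rfl⟩
  have eS : ∀ {n m₁ n₁ : ℕ} {σ : Fin n → StrArg m₁ n₁}, (M.Ext ∨ ∀ j, ∃ i, σ j = .var i) →
      (M.Ext ∨ ∀ j, ∃ i, (Fin.cons (.var 0) fun j => (σ j).shiftS :
        Fin (n + 1) → StrArg m₁ (n₁ + 1)) j = .var i) := by
    rintro n m₁ n₁ σ (h | h)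
    · exact .inl h
    · refine .inr fun j => ?_
      refine Fin.cases ⟨0, rfl⟩ (fun j => ?_) j
      obtain ⟨i, hi⟩ := h j
      exact ⟨i.succ, by simp [hi, StrArg.shiftS]⟩
  have dS : ∀ {n m₁ n₁ : ℕ} {σ : Fin n → StrArg m₁ n₁} {v : Fin m₁ → M.Num} {V : Fin n₁ → M.Str}
      {W : Fin n → M.Str}, (∀ j, (σ j).Denotes M v V (W j)) → ∀ (X : M.Str) (j : Fin (n + 1)),
      ((Fin.cons (.var 0) fun j => (σ j).shiftS : Fin (n + 1) → StrArg m₁ (n₁ + 1)) j).Denotes M v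
        (Fin.cons X V : Fin (n₁ + 1) → M.Str) ((Fin.cons X W : Fin (n + 1) → M.Str) j) := by
    intro n m₁ n₁ σ v V W h X j
    refine Fin.cases ?_ (fun j => ?_) j
    · simp [StrArg.Denotes]
    · simpa using (h j).shiftS X
  induction φ with
  | tru => intros; rfl
  | fls => intros; rfl
  | eqN s t => intro m₁ n₁ ν σ v V W h hM; simp [subst, NumTerm.eval_subst h]
  | le s t => intro m₁ n₁ ν σ v V W h hM; simp [subst, NumTerm.eval_subst h]
  | eqS S T =>
      intro m₁ n₁ ν σ v V W h hM
      obtain ⟨i, rfl⟩ := S.exists_eq_var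
      obtain ⟨j, rfl⟩ := T.exists_eq_var
      simp only [subst, StrTerm.subst]
      rw [(h i).realize_eqFormula (h j) (hM.imp id fun h => ⟨h i, h j⟩)]
      simp
  | mem s T =>
      intro m₁ n₁ ν σ v V W h hM
      obtain ⟨j, rfl⟩ := T.exists_eq_var
      simp only [subst, StrTerm.subst]
      rw [(h j).realize_memFormula]
      simp [NumTerm.eval_subst h]
  | not φ ih => intro m₁ n₁ ν σ v V W h hM; simp [subst, ih h hM]
  | and φ ψ ih ih' => intro m₁ n₁ ν σ v V W h hM; simp [subst, ih h hM, ih' h hM]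
  | or φ ψ ih ih' => intro m₁ n₁ ν σ v V W h hM; simp [subst, ih h hM, ih' h hM]
  | exN φ ih =>
      intro m₁ n₁ ν σ v V W h hM
      simp only [subst, realize_exN]
      refine exists_congr fun x => ?_
      rw [ih (fun j => (h j).shiftN x) (eN hM), hN]
  | allN φ ih =>
      intro m₁ n₁ ν σ v V W h hM
      simp only [subst, realize_allN]
      refine forall_congr' fun x => ?_
      rw [ih (fun j => (h j).shiftN x) (eN hM), hN]
  | exS φ ih =>
      intro m₁ n₁ ν σ v V W h hM
      simp only [subst, realize_exS]
      refine exists_congr fun X => ?_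
      rw [ih (dS h X) (eS hM)]
      simp
  | allS φ ih =>
      intro m₁ n₁ ν σ v V W h hM
      simp only [subst, realize_allS]
      refine forall_congr' fun X => ?_
      rw [ih (dS h X) (eS hM)]
      simp

theorem Formula.realize_rename (φ : Formula L2A m n) (ρ : Fin m → Fin m₁) (τ : Fin n → Fin n₁)
    (v : Fin m₁ → M.Num) (V : Fin n₁ → M.Str) :
    (φ.rename ρ τ).Realize M v V ↔ φ.Realize M (fun i => v (ρ i)) (fun j => V (τ j)) := by
  rw [rename, Formula.realize_subst (σ := fun j => .var (τ j)) (V := V) (W := fun j => V (τ j))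
    (fun j => by simp [StrArg.Denotes]) (.inr fun j => ⟨_, rfl⟩)]
  simp

theorem Formula.realize_exUniqueN (φ : Formula L2A (m + 1) n) (v : Fin m → M.Num)
    (V : Fin n → M.Str) :
    φ.exUniqueN.Realize M v V ↔ ∃! y, φ.Realize M (Fin.cons y v) V := by
  have : ∀ x y : M.Num, (fun i => (Fin.cons y (Fin.cons x v : Fin (m + 1) → M.Num) :
      Fin (m + 1 + 1) → M.Num) ((Fin.cons 0 fun i => i.succ.succ : Fin (m + 1) → Fin (m + 1 + 1)) i))
      = (Fin.cons y v : Fin (m + 1) → M.Num) := by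
    intro x y
    funext i
    refine Fin.cases ?_ (fun i => ?_) i <;> simp
  simp [exUniqueN, realize_rename, this, ExistsUnique]

theorem Formula.realize_exUniqueS (φ : Formula L2A m (n + 1)) (v : Fin m → M.Num)
    (V : Fin n → M.Str) :
    φ.exUniqueS.Realize M v V ↔ ∃! Y, φ.Realize M v (Fin.cons Y V) := by
  have : ∀ x y : M.Str, (fun i => (Fin.cons y (Fin.cons x V : Fin (n + 1) → M.Str) :
      Fin (n + 1 + 1) → M.Str) ((Fin.cons 0 fun i => i.succ.succ : Fin (n + 1) → Fin (n + 1 + 1)) i))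
      = (Fin.cons y V : Fin (n + 1) → M.Str) := by
    intro x y
    funext i
    refine Fin.cases ?_ (fun i => ?_) i <;> simp
  simp [exUniqueS, realize_rename, this, ExistsUnique]

theorem satisfies_comprehension (φ : Formula L2A (m + 2) n) :
    M.Satisfies (comprehension φ) ↔ ∀ (v : Fin (m + 1) → M.Num) (V : Fin n → M.Str),
      ∃ X, M.le (M.len X) (v 0) ∧
        ∀ z, M.lt z (v 0) → (M.mem z X ↔ φ.Realize M (Fin.cons z v) V) := by
  rw [comprehension, Formula.satisfies_close]
  refine forall_congr' fun v => forall_congr' fun V => ?_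
  simp [Formula.realize_rename]

end Subst

/-! ## Preservation of the class of bounded formulas -/

theorem StrArg.lenTerm_shiftN {m n : ℕ} (A : StrArg m n) : A.shiftN.lenTerm = A.lenTerm.shiftN := by
  cases A <;> simp [StrArg.shiftN, StrArg.lenTerm, NumTerm.shiftN, NumTerm.rename]

/-- This commutation is what keeps a bounded quantifier syntactically bounded after a substitution.
-/
theorem NumTerm.subst_shiftN {m n m₁ n₁ : ℕ} (ν : Fin m → NumTerm L2A m₁ n₁)
    (σ : Fin n → StrArg m₁ n₁) (t : NumTerm L2A m n) :
    t.shiftN.subst (Fin.cons (.var 0) fun i => (ν i).shiftN) (fun j => (σ j).shiftN) =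
      (t.subst ν σ).shiftN := by
  induction t using NumTerm.baseInduction <;>
    simp_all [NumTerm.shiftN, NumTerm.rename, NumTerm.subst, StrArg.lenTerm_shiftN]

namespace Formula
variable {L : Vocab} {m n : ℕ}

theorem IsSigma0B.imp {φ ψ : Formula L m n} (h : φ.IsSigma0B) (h' : ψ.IsSigma0B) :
    (imp φ ψ).IsSigma0B := .or (.not h) h'
theorem IsSigma0B.iff {φ ψ : Formula L m n} (h : φ.IsSigma0B) (h' : ψ.IsSigma0B) :
    (iff φ ψ).IsSigma0B := .and (h.imp h') (h'.imp h)
theorem IsSigma0B.lt (s t : NumTerm L m n) : (lt s t).IsSigma0B := .and (.le _ _) (.not (.eqN _ _))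
theorem IsSigma0B.exLT (t : NumTerm L2A m n) {φ : Formula L (m + 1) n} (h : φ.IsSigma0B) :
    (exLT t φ).IsSigma0B := .exLE _ (.and (.not (.eqN _ _)) h)
theorem IsSigma0B.allLT (t : NumTerm L2A m n) {φ : Formula L (m + 1) n} (h : φ.IsSigma0B) :
    (allLT t φ).IsSigma0B := .allLE _ (.imp (.not (.eqN _ _)) h)

theorem IsSigma0B.subst {φ : Formula L2A m n} (h : φ.IsSigma0B) : ∀ {m₁ n₁ : ℕ}
    (ν : Fin m → NumTerm L2A m₁ n₁) (σ : Fin n → StrArg m₁ n₁), (φ.subst ν σ).IsSigma0B := by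
  have hmem : ∀ {m n : ℕ} (s : NumTerm L2A m n) (A : StrArg m n), (A.memFormula s).IsSigma0B := by
    intro m n s A
    cases A <;> exact .mem _ _
  induction h with
  | tru => intros; exact .tru
  | fls => intros; exact .fls
  | eqN s t => intros; exact .eqN _ _
  | le s t => intros; exact .le _ _
  | mem s T => intros; exact hmem _ _
  | eqS S T =>
      intro m₁ n₁ ν σ
      simp only [Formula.subst]
      generalize StrTerm.subst σ S = A
      generalize StrTerm.subst σ T = B
      cases A <;> cases B <;> first
        | exact .eqS _ _
        | exact .and (.eqN _ _) (.allLT _ (.iff (hmem _ _) (hmem _ _)))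
  | not _ ih => intros; exact .not (ih _ _)
  | and _ _ ih ih' => intros; exact .and (ih _ _) (ih' _ _)
  | or _ _ ih ih' => intros; exact .or (ih _ _) (ih' _ _)
  | exLE t _ ih =>
      intro m₁ n₁ ν σ
      have := IsSigma0B.exLE (t.subst ν σ)
        (ih (Fin.cons (.var 0) fun i => (ν i).shiftN) fun j => (σ j).shiftN)
      simpa [Formula.exLE, Formula.subst, NumTerm.ofBase_eq_self, NumTerm.subst_shiftN,
        NumTerm.subst] using this
  | allLE t _ ih =>
      intro m₁ n₁ ν σ
      have := IsSigma0B.allLE (t.subst ν σ)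
        (ih (Fin.cons (.var 0) fun i => (ν i).shiftN) fun j => (σ j).shiftN)
      simpa [Formula.allLE, Formula.subst, NumTerm.ofBase_eq_self, NumTerm.subst_shiftN,
        NumTerm.subst, Formula.imp] using this

theorem IsSigma0B.rename {φ : Formula L2A m n} (h : φ.IsSigma0B) {m₁ n₁ : ℕ}
    (ρ : Fin m → Fin m₁) (τ : Fin n → Fin n₁) : (φ.rename ρ τ).IsSigma0B := h.subst _ _

end Formula

end TwoSorted

namespace TwoSorted

/-! ## Arithmetic in models of finitely many axioms -/

/-- The content of the axioms B1–B12, L1, L2 and SE. -/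
structure Structure.IsBasic (M : Structure L2A) : Prop where
  add_one_ne_zero : ∀ x, M.add x M.one ≠ M.zero
  add_one_inj : ∀ x y, M.add x M.one = M.add y M.one → x = y
  add_zero : ∀ x, M.add x M.zero = x
  add_succ : ∀ x y, M.add x (M.add y M.one) = M.add (M.add x y) M.one
  mul_zero : ∀ x, M.mul x M.zero = M.zero
  mul_succ : ∀ x y, M.mul x (M.add y M.one) = M.add (M.mul x y) x
  le_antisymm : ∀ x y, M.le x y → M.le y x → x = y
  zero_le : ∀ x, M.le M.zero x
  le_trans : ∀ x y z, M.le x y → M.le y z → M.le x z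
  le_total : ∀ x y, M.le x y ∨ M.le y x
  le_iff_lt_succ : ∀ x y, M.le x y ↔ M.lt x (M.add y M.one)
  exists_pred : ∀ x, x ≠ M.zero → ∃ y, M.lt y x ∧ M.add y M.one = x
  lt_len_of_mem : ∀ x X, M.mem x X → M.lt x (M.len X)
  mem_of_succ_eq_len : ∀ x X, M.add x M.one = M.len X → M.mem x X
  ext : M.Ext

theorem Structure.isModel_basicAxioms_iff (M : Structure L2A) :
    M.IsModel basicAxioms ↔ M.IsBasic := by
  -- A universal closure ranges over assignments; these equivalences turn it into separate
  -- quantifiers over the entries.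
  have e1 : ∀ (P : (Fin 1 → M.Num) → Prop), (∀ v, P v) ↔ ∀ x, P ![x] := fun P =>
    ⟨fun h x => h _, fun h v => by
      have := h (v 0)
      rwa [show ![v 0] = v by ext i; fin_cases i; rfl] at this⟩
  have e2 : ∀ (P : (Fin 2 → M.Num) → Prop), (∀ v, P v) ↔ ∀ x y, P ![x, y] := fun P =>
    ⟨fun h x y => h _, fun h v => by
      have := h (v 0) (v 1)
      rwa [show ![v 0, v 1] = v by ext i; fin_cases i <;> rfl] at this⟩
  have e3 : ∀ (P : (Fin 3 → M.Num) → Prop), (∀ v, P v) ↔ ∀ x y z, P ![x, y, z] := fun P =>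
    ⟨fun h x y z => h _, fun h v => by
      have := h (v 0) (v 1) (v 2)
      rwa [show ![v 0, v 1, v 2] = v by ext i; fin_cases i <;> rfl] at this⟩
  have s1 : ∀ (P : (Fin 1 → M.Str) → Prop), (∀ v, P v) ↔ ∀ x, P ![x] := fun P =>
    ⟨fun h x => h _, fun h v => by
      have := h (v 0)
      rwa [show ![v 0] = v by ext i; fin_cases i; rfl] at this⟩
  have s2 : ∀ (P : (Fin 2 → M.Str) → Prop), (∀ v, P v) ↔ ∀ x y, P ![x, y] := fun P =>
    ⟨fun h x y => h _, fun h v => by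
      have := h (v 0) (v 1)
      rwa [show ![v 0, v 1] = v by ext i; fin_cases i <;> rfl] at this⟩
  have hS : Nonempty (Fin 0 → M.Str) := ⟨Fin.elim0⟩
  simp only [Structure.IsModel, basicAxioms, Set.mem_insert_iff, Set.mem_singleton_iff,
    forall_eq_or_imp, forall_eq, Formula.satisfies_close, e1, e2, e3, s1, s2]
  simp [forall_const]
  constructor
  · rintro ⟨h1, h2, h3, h4, h5, h6, h7, h8, h9, h10, h11, h12, h13, h14, h15⟩
    exact ⟨h1, h2, h3, h4, h5, h6, h7, h8, h9, h10, h11, h12, h13, h14, h15⟩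
  · rintro ⟨h1, h2, h3, h4, h5, h6, h7, h8, h9, h10, h11, h12, h13, h14, h15⟩
    exact ⟨h1, h2, h3, h4, h5, h6, h7, h8, h9, h10, h11, h12, h13, h14, h15⟩

/-- `∀ y ≤ z, φ(y)`, where `z` is the variable `0` of the result. -/
def Formula.allBelow {m n : ℕ} (φ : Formula L2A (m + 1) n) : Formula L2A (m + 1) n :=
  .allLE (.var 0) (φ.rename (Fin.cons 0 fun i => i.succ.succ) id)

theorem Formula.realize_allBelow {M : Structure L2A} {m n : ℕ} (φ : Formula L2A (m + 1) n) (z : M.Num)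
    (v : Fin m → M.Num) (V : Fin n → M.Str) :
    φ.allBelow.Realize M (Fin.cons z v) V ↔ ∀ y, M.le y z → φ.Realize M (Fin.cons y v) V := by
  have : ∀ x y : M.Num, (fun i => (Fin.cons y (Fin.cons x v : Fin (m + 1) → M.Num) :
      Fin (m + 1 + 1) → M.Num) ((Fin.cons 0 fun i => i.succ.succ : Fin (m + 1) → Fin (m + 1 + 1)) i))
      = (Fin.cons y v : Fin (m + 1) → M.Num) := by
    intro x y
    funext i
    refine Fin.cases ?_ (fun i => ?_) i <;> simp
  simp [allBelow, Formula.realize_rename, this]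

theorem Formula.IsSigma0B.allBelow {m n : ℕ} {φ : Formula L2A (m + 1) n} (h : φ.IsSigma0B) :
    φ.allBelow.IsSigma0B := .allLE _ (h.rename _ _)

-- Order and induction from the basic axioms and single comprehension instances.

namespace Structure.IsBasic
variable {M : Structure L2A}

theorem le_refl (hM : M.IsBasic) (x : M.Num) : M.le x x := (hM.le_total x x).elim id id

theorem lt_succ (hM : M.IsBasic) (x : M.Num) : M.lt x (M.add x M.one) := (hM.le_iff_lt_succ _ _).1 (hM.le_refl x)

theorem le_succ_iff (hM : M.IsBasic) (x y : M.Num) : M.le y (M.add x M.one) ↔ M.le y x ∨ y = M.add x M.one := by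
  constructor
  · intro h
    by_cases hy : y = M.add x M.one
    · exact .inr hy
    · exact .inl ((hM.le_iff_lt_succ _ _).2 ⟨h, hy⟩)
  · rintro (h | rfl)
    · exact ((hM.le_iff_lt_succ _ _).1 h).1
    · exact hM.le_refl _

theorem le_zero (hM : M.IsBasic) {y : M.Num} (h : M.le y M.zero) : y = M.zero := hM.le_antisymm _ _ h (hM.zero_le _)

/-- Let `X` be the set of `z < a + 1` such that `P` holds up to `z`. It contains `0`, so by L2 it
has a last element `u`, with `u + 1 = |X|`. If `u + 1 < a + 1` then `u + 1` would belong to `X` too,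
against L1; hence `u = a`. No arithmetic is used beyond the basic axioms, so this can serve to
derive arithmetic. -/
theorem induction_of_comprehension (hM : M.IsBasic) {m n : ℕ} {φ : Formula L2A (m + 2) n}
    (h : M.Satisfies (comprehension φ.allBelow)) (v : Fin m → M.Num) (V : Fin n → M.Str)
    (P : M.Num → Prop)
    (hP : ∀ a z, φ.Realize M (Fin.cons z (Fin.cons a v : Fin (m + 1) → M.Num)) V ↔ P z)
    (zero : P M.zero) (succ : ∀ z, P z → P (M.add z M.one)) (a : M.Num) : P a := by
  obtain ⟨X, hX, hmem⟩ := satisfies_comprehension φ.allBelow |>.1 h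
    (Fin.cons (M.add a M.one) v) V
  simp only [Fin.cons_zero, Formula.realize_allBelow, hP] at hX hmem
  have h0 : M.mem M.zero X := by
    refine (hmem _ ((hM.le_iff_lt_succ _ _).1 (hM.zero_le a))).2 fun y hy => ?_
    rwa [hM.le_zero hy]
  have hne : M.len X ≠ M.zero := fun h => by
    have := hM.lt_len_of_mem _ _ h0
    rw [h] at this
    exact this.2 rfl
  obtain ⟨u, hu, hu1⟩ := hM.exists_pred _ hne
  have hmu := hM.mem_of_succ_eq_len _ _ hu1
  have hua : M.le (M.add u M.one) (M.add a M.one) := hu1 ▸ hX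
  have hlt : M.lt u (M.add a M.one) := by
    refine (hM.le_iff_lt_succ _ _).1 ?_
    rcases (hM.le_succ_iff _ _).1 hua with h | h
    · exact hM.le_trans _ _ _ (hM.lt_succ u).1 h
    · rw [hM.add_one_inj _ _ h]
      exact hM.le_refl _
  have hall := (hmem u hlt).1 hmu
  by_cases hc : M.lt (M.add u M.one) (M.add a M.one)
  · exfalso
    have : M.mem (M.add u M.one) X := (hmem _ hc).2 fun y hy => by
      rcases (hM.le_succ_iff _ _).1 hy with h | rfl
      · exact hall y h
      · exact succ _ (hall u (hM.le_refl u))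
    have := hM.lt_len_of_mem _ _ this
    rw [← hu1] at this
    exact this.2 rfl
  · have : M.add u M.one = M.add a M.one := by
      by_contra hne
      exact hc ⟨hua, hne⟩
    rw [← hM.add_one_inj _ _ this]
    exact hall u (hM.le_refl u)

end Structure.IsBasic

-- The finite list of comprehension instances.

section
open NumTerm Formula

/-- The properties whose inductive proofs yield the arithmetic of discretely ordered semirings. The
variable `0` is the induction variable, the variable `1` does not occur. -/
def arithFormulas : List ((m : ℕ) × (n : ℕ) × Formula L2A (m + 2) n) :=
  -- The order matters: the inductive proof of each property uses only properties that come earlier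
  -- in the list.
  [⟨2, 0, eqN (add (add (var 2) (var 3)) (var 0)) (add (var 2) (add (var 3) (var 0)))⟩,
   ⟨0, 0, eqN (add zero (var 0)) (var 0)⟩,
   ⟨1, 0, eqN (add (add (var 2) one) (var 0)) (add (add (var 2) (var 0)) one)⟩,
   ⟨1, 0, eqN (add (var 2) (var 0)) (add (var 0) (var 2))⟩,
   ⟨0, 0, eqN (mul zero (var 0)) zero⟩,
   ⟨2, 0, eqN (mul (var 2) (add (var 3) (var 0))) (add (mul (var 2) (var 3)) (mul (var 2) (var 0)))⟩,
   ⟨2, 0, eqN (mul (add (var 2) (var 3)) (var 0)) (add (mul (var 2) (var 0)) (mul (var 3) (var 0)))⟩,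
   ⟨0, 0, eqN (mul one (var 0)) (var 0)⟩,
   ⟨1, 0, eqN (mul (var 2) (var 0)) (mul (var 0) (var 2))⟩,
   ⟨2, 0, eqN (mul (mul (var 2) (var 3)) (var 0)) (mul (var 2) (mul (var 3) (var 0)))⟩,
   ⟨2, 0, imp (eqN (add (var 2) (var 0)) (add (var 3) (var 0))) (eqN (var 2) (var 3))⟩,
   ⟨1, 0, le (var 2) (add (var 2) (var 0))⟩,
   -- The difference is sought below `z`, so that the formula stays bounded.
   ⟨1, 0, imp (le (var 2) (var 0)) (exLE (var 0) (eqN (add (var 3) (var 0)) (var 1)))⟩]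

/-- Operations on strings from which every bounded formula can be evaluated. The variable `0` is
the candidate for membership, the variable `1` does not occur, the others are parameters. -/
def operationFormulas : List ((m : ℕ) × (n : ℕ) × Formula L2A (m + 2) n) :=
  -- In order: complement, intersection, projection, insertion of a dummy coordinate in second
  -- place, the diagonal `v = x` on triples `⟨v, ⟨x, e⟩⟩`, the graph of a constant, sum and product
  -- of two coded functions, the relations `≤`, `=` and `∈` between coded values, and the section at
  -- a fixed second coordinate.
  [⟨0, 1, not (mem (var 0) (.var 0))⟩,
   ⟨0, 2, and (mem (var 0) (.var 0)) (mem (var 0) (.var 1))⟩,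
   ⟨1, 1, exLE (var 2) (mem (pair (var 0) (var 1)) (.var 0))⟩,
   ⟨0, 1, exLE (var 0) (exLE (var 1) (exLE (var 2) (and
      (eqN (var 3) (pair (var 2) (pair (var 1) (var 0))))
      (mem (pair (var 2) (var 0)) (.var 0)))))⟩,
   ⟨0, 0, exLE (var 0) (exLE (var 1) (eqN (var 2) (pair (var 1) (pair (var 1) (var 0)))))⟩,
   ⟨1, 0, exLE (var 0) (eqN (var 1) (pair (var 3) (var 0)))⟩,
   ⟨1, 2, exLE (var 0) (exLE (var 3) (exLE (var 4) (and
      (eqN (var 3) (pair (add (var 1) (var 0)) (var 2)))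
      (and (mem (pair (var 1) (var 2)) (.var 0)) (mem (pair (var 0) (var 2)) (.var 1))))))⟩,
   ⟨1, 2, exLE (var 0) (exLE (var 3) (exLE (var 4) (and
      (eqN (var 3) (pair (mul (var 1) (var 0)) (var 2)))
      (and (mem (pair (var 1) (var 2)) (.var 0)) (mem (pair (var 0) (var 2)) (.var 1))))))⟩,
   ⟨1, 2, exLE (var 2) (exLE (var 3) (and (le (var 1) (var 0))
      (and (mem (pair (var 1) (var 2)) (.var 0)) (mem (pair (var 0) (var 2)) (.var 1)))))⟩,
   ⟨1, 2, exLE (var 2) (and (mem (pair (var 0) (var 1)) (.var 0))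
      (mem (pair (var 0) (var 1)) (.var 1)))⟩,
   ⟨1, 2, exLE (var 2) (and (mem (pair (var 0) (var 1)) (.var 0)) (mem (var 0) (.var 1)))⟩,
   ⟨1, 1, mem (pair (var 0) (var 2)) (.var 0)⟩]

end

/-- A finite set of axioms of `V⁰`, sufficient to prove all of `V⁰`. -/
def finAxioms : Set Sentence :=
  basicAxioms ∪ ({ψ | ∃ e ∈ arithFormulas, ψ = comprehension e.2.2.allBelow} ∪
    {ψ | ∃ e ∈ operationFormulas, ψ = comprehension e.2.2})

/-- Models of `finAxioms`. -/
class Structure.IsFin (M : Structure L2A) : Prop where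
  isModel : M.IsModel finAxioms

namespace Structure
variable (M : Structure L2A) [hM : M.IsFin]

theorem isBasic : M.IsBasic :=
  M.isModel_basicAxioms_iff.1 fun φ h => hM.isModel φ (.inl h)

variable {M}

theorem arith_induction {m n : ℕ} {φ : Formula L2A (m + 2) n} (h : ⟨m, n, φ⟩ ∈ arithFormulas)
    (v : Fin m → M.Num) (V : Fin n → M.Str) (P : M.Num → Prop)
    (hP : ∀ a z, φ.Realize M (Fin.cons z (Fin.cons a v : Fin (m + 1) → M.Num)) V ↔ P z)
    (zero : P M.zero) (succ : ∀ z, P z → P (M.add z M.one)) (a : M.Num) : P a :=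
  M.isBasic.induction_of_comprehension
    (hM.isModel _ (.inr (.inl ⟨_, h, rfl⟩))) v V P hP zero succ a

theorem operation {m n : ℕ} {φ : Formula L2A (m + 2) n} (h : ⟨m, n, φ⟩ ∈ operationFormulas)
    (a : M.Num) (v : Fin m → M.Num) (V : Fin n → M.Str) :
    ∃ X, M.le (M.len X) a ∧ ∀ z, M.lt z a →
      (M.mem z X ↔ φ.Realize M (Fin.cons z (Fin.cons a v : Fin (m + 1) → M.Num)) V) := by
  simpa using (satisfies_comprehension φ).1 (hM.isModel _ (.inr (.inr ⟨_, h, rfl⟩)))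
    (Fin.cons a v) V

theorem add_assoc' (x y z : M.Num) : M.add (M.add x y) z = M.add x (M.add y z) := by
  have B := M.isBasic
  refine arith_induction (.head _) ![x, y] Fin.elim0 (fun z => M.add (M.add x y) z = M.add x (M.add y z)) (fun a z => Iff.rfl) ?_ ?_ z
  · simp [B.add_zero]
  · intro z hz
    simp only [B.add_succ, hz]

theorem zero_add' (x : M.Num) : M.add M.zero x = x := by
  have B := M.isBasic
  refine arith_induction (.tail _ <| .head _) ![] Fin.elim0 (fun z => M.add M.zero z = z)
    (fun a z => Iff.rfl) ?_ ?_ x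
  · exact B.add_zero _
  · intro z hz
    simp only [B.add_succ, hz]

theorem succ_add' (x y : M.Num) : M.add (M.add x M.one) y = M.add (M.add x y) M.one := by
  have B := M.isBasic
  refine arith_induction (.tail _ <| .tail _ <| .head _) ![x] Fin.elim0 (fun z => M.add (M.add x M.one) z = M.add (M.add x z) M.one)
    (fun a z => Iff.rfl) ?_ ?_ y
  · simp only [B.add_zero]
  · intro z hz
    simp only [B.add_succ, hz]

theorem add_comm' (x y : M.Num) : M.add x y = M.add y x := by
  have B := M.isBasic
  refine arith_induction (.tail _ <| .tail _ <| .tail _ <| .head _) ![x] Fin.elim0 (fun z => M.add x z = M.add z x)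
    (fun a z => Iff.rfl) ?_ ?_ y
  · simp only [B.add_zero, zero_add']
  · intro z hz
    simp only [B.add_succ, succ_add', hz]

theorem zero_mul' (x : M.Num) : M.mul M.zero x = M.zero := by
  have B := M.isBasic
  refine arith_induction (.tail _ <| .tail _ <| .tail _ <| .tail _ <| .head _) ![] Fin.elim0
    (fun z => M.mul M.zero z = M.zero) (fun a z => Iff.rfl) ?_ ?_ x
  · exact B.mul_zero _
  · intro z hz
    simp only [B.mul_succ, hz, B.add_zero]

theorem mul_add' (x y z : M.Num) : M.mul x (M.add y z) = M.add (M.mul x y) (M.mul x z) := by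
  have B := M.isBasic
  refine arith_induction (.tail _ <| .tail _ <| .tail _ <| .tail _ <| .tail _ <| .head _)
    ![x, y] Fin.elim0 (fun z => M.mul x (M.add y z) = M.add (M.mul x y) (M.mul x z)) (fun a z => Iff.rfl) ?_ ?_ z
  · simp only [B.add_zero, B.mul_zero]
  · intro z hz
    rw [B.add_succ, B.mul_succ, hz, B.mul_succ, add_assoc']

theorem add_mul' (x y z : M.Num) : M.mul (M.add x y) z = M.add (M.mul x z) (M.mul y z) := by
  have B := M.isBasic
  refine arith_induction (.tail _ <| .tail _ <| .tail _ <| .tail _ <| .tail _ <| .tail _ <| .head _)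
    ![x, y] Fin.elim0 (fun z => M.mul (M.add x y) z = M.add (M.mul x z) (M.mul y z)) (fun a z => Iff.rfl) ?_ ?_ z
  · simp only [B.add_zero, B.mul_zero]
  · intro z hz
    simp only [B.mul_succ, hz, add_assoc']
    rw [← add_assoc' (M.mul y z) x y, add_comm' (M.mul y z) x, add_assoc']

theorem one_mul' (x : M.Num) : M.mul M.one x = x := by
  have B := M.isBasic
  refine arith_induction (.tail _ <| .tail _ <| .tail _ <| .tail _ <| .tail _ <| .tail _ <|
    .tail _ <| .head _) ![] Fin.elim0 (fun z => M.mul M.one z = z) (fun a z => Iff.rfl) ?_ ?_ x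
  · exact B.mul_zero _
  · intro z hz
    simp only [B.mul_succ, hz]

theorem mul_comm' (x y : M.Num) : M.mul x y = M.mul y x := by
  have B := M.isBasic
  refine arith_induction (.tail _ <| .tail _ <| .tail _ <| .tail _ <| .tail _ <| .tail _ <|
    .tail _ <| .tail _ <| .head _) ![x] Fin.elim0 (fun z => M.mul x z = M.mul z x) (fun a z => Iff.rfl) ?_ ?_ y
  · simp only [B.mul_zero, zero_mul']
  · intro z hz
    simp only [B.mul_succ, hz, add_mul', one_mul']

theorem mul_assoc' (x y z : M.Num) : M.mul (M.mul x y) z = M.mul x (M.mul y z) := by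
  have B := M.isBasic
  refine arith_induction (.tail _ <| .tail _ <| .tail _ <| .tail _ <| .tail _ <| .tail _ <|
    .tail _ <| .tail _ <| .tail _ <| .head _) ![x, y] Fin.elim0 (fun z => M.mul (M.mul x y) z = M.mul x (M.mul y z))
    (fun a z => Iff.rfl) ?_ ?_ z
  · simp only [B.mul_zero]
  · intro z hz
    simp only [B.mul_succ, hz, mul_add']

theorem add_right_cancel' (x y z : M.Num) : M.add x z = M.add y z → x = y := by
  have B := M.isBasic
  refine arith_induction (.tail _ <| .tail _ <| .tail _ <| .tail _ <| .tail _ <| .tail _ <|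
    .tail _ <| .tail _ <| .tail _ <| .tail _ <| .head _) ![x, y] Fin.elim0
    (fun z => M.add x z = M.add y z → x = y) (fun a z => by rw [Formula.realize_imp]; simp; try rfl) ?_ ?_ z
  · simp only [B.add_zero, imp_self]
  · intro z hz h
    simp only [B.add_succ] at h
    exact hz (B.add_one_inj _ _ h)

theorem le_add_right' (x z : M.Num) : M.le x (M.add x z) := by
  have B := M.isBasic
  refine arith_induction (.tail _ <| .tail _ <| .tail _ <| .tail _ <| .tail _ <| .tail _ <|
    .tail _ <| .tail _ <| .tail _ <| .tail _ <| .tail _ <| .head _) ![x] Fin.elim0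
    (fun z => M.le x (M.add x z)) (fun a z => Iff.rfl) ?_ ?_ z
  · simpa [B.add_zero] using B.le_refl x
  · intro z hz
    rw [B.add_succ]
    exact B.le_trans _ _ _ hz (B.lt_succ _).1

/-- Together with `le_add_right'` this makes `≤` the order induced by addition. -/
theorem exists_add_of_le' (x z : M.Num) : M.le x z → ∃ w, M.le w z ∧ M.add x w = z := by
  have B := M.isBasic
  refine arith_induction (.tail _ <| .tail _ <| .tail _ <| .tail _ <| .tail _ <| .tail _ <|
    .tail _ <| .tail _ <| .tail _ <| .tail _ <| .tail _ <| .tail _ <| .head _) ![x] Fin.elim0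
    (fun z => M.le x z → ∃ w, M.le w z ∧ M.add x w = z) (fun a z => by rw [Formula.realize_imp]; simp; try rfl) ?_ ?_ z
  · intro h
    exact ⟨M.zero, B.le_refl _, by rw [B.add_zero, B.le_zero h]⟩
  · intro z hz h
    rcases (B.le_succ_iff _ _).1 h with h | rfl
    · obtain ⟨w, hw, rfl⟩ := hz h
      refine ⟨M.add w M.one, ?_, B.add_succ _ _⟩
      rw [← B.add_succ, add_comm' x]
      exact le_add_right' _ _
    · exact ⟨M.zero, B.zero_le _, B.add_zero _⟩

-- The numbers of a model as an ordered semiring; pairing and lengths.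

instance : Zero M.Num := ⟨M.zero⟩
instance : One M.Num := ⟨M.one⟩
instance : Add M.Num := ⟨M.add⟩
instance : Mul M.Num := ⟨M.mul⟩

noncomputable instance : CommSemiring M.Num where
  add_assoc := add_assoc'
  zero_add := zero_add'
  add_zero := M.isBasic.add_zero
  add_comm := add_comm'
  left_distrib := mul_add'
  right_distrib := add_mul'
  zero_mul := zero_mul'
  mul_zero := M.isBasic.mul_zero
  mul_assoc := mul_assoc'
  one_mul := one_mul'
  mul_one x := (mul_comm' x M.one).trans (one_mul' x)
  mul_comm := mul_comm'
  nsmul := nsmulRec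

open Classical in
noncomputable instance : LinearOrder M.Num where
  le := M.le
  lt := M.lt
  le_refl := M.isBasic.le_refl
  le_trans := M.isBasic.le_trans
  le_antisymm := M.isBasic.le_antisymm
  le_total := M.isBasic.le_total
  lt_iff_le_not_ge x y := by
    refine and_congr_right fun h => ⟨fun hne h' => hne (M.isBasic.le_antisymm _ _ h h'), ?_⟩
    rintro h' rfl
    exact h' h
  toDecidableLE := fun _ _ => Classical.propDecidable _

instance : CanonicallyOrderedAdd M.Num where
  exists_add_of_le {x y} h := by
    obtain ⟨w, -, h⟩ := exists_add_of_le' x y h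
    exact ⟨w, h.symm⟩
  le_add_self x y := by
    rw [add_comm]
    exact le_add_right' x y
  le_self_add := le_add_right'

instance : IsOrderedCancelAddMonoid M.Num where
  add_le_add_left x y h z := by
    obtain ⟨w, rfl⟩ := exists_add_of_le h
    rw [add_right_comm]
    exact le_self_add
  le_of_add_le_add_left x y z h := by
    obtain ⟨w, hw⟩ := exists_add_of_le h
    have : z = y + w := add_right_cancel' _ _ x (by
      show z + x = y + w + x
      rw [add_comm, hw]
      ring)
    rw [this]
    exact le_self_add

theorem lt_iff_add_one_le {x y : M.Num} : x < y ↔ x + 1 ≤ y := by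
  constructor
  · intro h
    by_contra h'
    exact not_lt_of_ge ((M.isBasic.le_iff_lt_succ y x).2 (not_le.1 h')) h
  · exact fun h => lt_of_lt_of_le (M.isBasic.lt_succ x) h

theorem lt_add_one_iff' {x y : M.Num} : x < y + 1 ↔ x ≤ y := (M.isBasic.le_iff_lt_succ x y).symm

instance : IsStrictOrderedRing M.Num where
  zero_le_one := zero_le
  exists_pair_ne := ⟨0, 1, fun h => M.isBasic.add_one_ne_zero 0 (by
    show (0 : M.Num) + 1 = 0
    rw [← h, add_zero])⟩
  mul_lt_mul_of_pos_left a ha b c hbc := by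
    obtain ⟨d, rfl⟩ := exists_add_of_le (lt_iff_add_one_le.1 hbc)
    show a * b < a * (b + 1 + d)
    rw [mul_add, mul_add, mul_one, add_assoc]
    exact lt_add_of_pos_right _ (lt_of_lt_of_le ha le_self_add)
  mul_lt_mul_of_pos_right a ha b c hbc := by
    obtain ⟨d, rfl⟩ := exists_add_of_le (lt_iff_add_one_le.1 hbc)
    show b * a < (b + 1 + d) * a
    rw [add_mul, add_mul, one_mul, add_assoc]
    exact lt_add_of_pos_right _ (lt_of_lt_of_le ha le_self_add)

theorem pair_def {M : Structure L2A} (x y : M.Num) : M.pair x y = (x + y) * (x + y + 1) + (1 + 1) * y := rfl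

/-- Pairs are ordered first by their sum: with `s = x + y`, one has `s(s+1) + 2y ≤ s(s+1) + 2s <
(s+1)(s+2)`, and the last number is a lower bound for all pairs of larger sum. Injectivity follows,
since pairs with equal codes have equal sums. -/
theorem pair_lt_of_add_lt {x y x' y' : M.Num} (h : x + y < x' + y') : M.pair x y < M.pair x' y' := by
  have h1 : x + y + 1 ≤ x' + y' := lt_iff_add_one_le.1 h
  have hy : y ≤ x + y := le_add_self
  calc M.pair x y = (x + y) * (x + y + 1) + (1 + 1) * y := rfl
    _ ≤ (x + y) * (x + y + 1) + (1 + 1) * (x + y) := by gcongr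
    _ < (x + y) * (x + y + 1) + (1 + 1) * (x + y) + (1 + 1) :=
        lt_add_of_pos_right _ (by positivity)
    _ = (x + y + 1) * (x + y + 1 + 1) := by ring
    _ ≤ (x' + y') * (x' + y' + 1) := by gcongr
    _ ≤ M.pair x' y' := le_self_add

theorem pair_inj {x y x' y' : M.Num} : M.pair x y = M.pair x' y' ↔ x = x' ∧ y = y' := by
  refine ⟨fun h => ?_, by rintro ⟨rfl, rfl⟩; rfl⟩
  have hs : x + y = x' + y' := by
    rcases lt_trichotomy (x + y) (x' + y') with h' | h' | h'
    · exact absurd h (pair_lt_of_add_lt h').ne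
    · exact h'
    · exact absurd h (pair_lt_of_add_lt h').ne'
  have hy : y = y' := by
    rw [pair_def, pair_def, hs] at h
    exact mul_left_cancel₀ (by positivity) (add_left_cancel h)
  subst hy
  exact ⟨add_right_cancel hs, rfl⟩

theorem pair_mono {x y x' y' : M.Num} (hx : x ≤ x') (hy : y ≤ y') : M.pair x y ≤ M.pair x' y' := by
  simp only [pair_def]
  gcongr

theorem pair_lt_pair {x y x' y' : M.Num} (hx : x ≤ x') (hy : y < y') :
    M.pair x y < M.pair x' y' := pair_lt_of_add_lt (add_lt_add_of_le_of_lt hx hy)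

theorem pair_lt_pair' {x y x' y' : M.Num} (hx : x < x') (hy : y ≤ y') :
    M.pair x y < M.pair x' y' := pair_lt_of_add_lt (add_lt_add_of_lt_of_le hx hy)

theorem le_pair (x y : M.Num) : x + y ≤ M.pair x y := by
  rw [pair_def]
  calc x + y = (x + y) * 1 := (mul_one _).symm
    _ ≤ (x + y) * (x + y + 1) := by gcongr; exact le_add_self
    _ ≤ _ := le_self_add

theorem left_le_pair (x y : M.Num) : x ≤ M.pair x y := le_self_add.trans (le_pair x y)
theorem right_le_pair (x y : M.Num) : y ≤ M.pair x y := le_add_self.trans (le_pair x y)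

theorem lt_len_of_mem {x : M.Num} {X : M.Str} (h : M.mem x X) : x < M.len X :=
  M.isBasic.lt_len_of_mem x X h

/-- SE also asks for equal lengths, but the elements determine the length: if `|X| ≠ 0`, its
predecessor is an element of `X` by L2, hence of `Y`, hence below `|Y|` by L1. -/
theorem str_ext {X Y : M.Str} (h : ∀ z, M.mem z X ↔ M.mem z Y) : X = Y := by
  refine (M.isBasic.ext X Y).2 ⟨?_, fun z _ => h z⟩
  have key : ∀ {X Y : M.Str}, (∀ z, M.mem z X → M.mem z Y) → M.len X ≤ M.len Y := by
    intro X Y h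
    by_cases h0 : M.len X = 0
    · rw [h0]
      exact zero_le
    · obtain ⟨u, -, hu⟩ := M.isBasic.exists_pred _ h0
      rw [← hu]
      exact lt_iff_add_one_le.1 (lt_len_of_mem (h _ (M.isBasic.mem_of_succ_eq_len _ _ hu)))
  exact le_antisymm (key fun z => (h z).1) (key fun z => (h z).2)

/-- Characterisation of the length of a string. -/
theorem len_le_iff {X : M.Str} {a : M.Num} : M.len X ≤ a ↔ ∀ z, M.mem z X → z < a := by
  constructor
  · exact fun h z hz => (lt_len_of_mem hz).trans_le h
  · intro h
    by_cases h0 : M.len X = 0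
    · rw [h0]
      exact zero_le
    · obtain ⟨u, -, hu⟩ := M.isBasic.exists_pred _ h0
      rw [← hu]
      exact lt_iff_add_one_le.1 (h _ (M.isBasic.mem_of_succ_eq_len _ _ hu))

end Structure

/-- Terms of the base vocabulary are monotone in the number variables and in the lengths of the
string variables. -/
theorem NumTerm.eval_mono {M : Structure L2A} [M.IsFin] {m n : ℕ} (t : NumTerm L2A m n)
    {v v' : Fin m → M.Num} {V V' : Fin n → M.Str} (hv : ∀ i, v i ≤ v' i)
    (hV : ∀ j, M.len (V j) ≤ M.len (V' j)) : t.eval M v V ≤ t.eval M v' V' := by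
  induction t using NumTerm.baseInduction with
  | var i => simpa using hv i
  | zero => simp
  | one => simp
  | add s t hs ht =>
    simp only [NumTerm.eval_add]
    exact add_le_add hs ht
  | mul s t hs ht =>
    simp only [NumTerm.eval_mul]
    exact mul_le_mul' hs ht
  | len j => simpa using hV j

end TwoSorted

namespace TwoSorted

/-! ## Bounded comprehension from finitely many axioms -/

namespace Structure
variable {M : Structure L2A} [M.IsFin]

theorem exists_compl (a : M.Num) (X : M.Str) : ∃ Z, ∀ z < a, M.mem z Z ↔ ¬ M.mem z X :=
  (operation (.head _) a ![] ![X]).imp fun _ h => h.2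

theorem exists_inter (a : M.Num) (X Y : M.Str) :
    ∃ Z, ∀ z < a, M.mem z Z ↔ M.mem z X ∧ M.mem z Y :=
  (operation (.tail _ <| .head _) a ![] ![X, Y]).imp fun _ h => h.2

theorem exists_proj (a c : M.Num) (X : M.Str) :
    ∃ Z, ∀ z < a, M.mem z Z ↔ ∃ y ≤ c, M.mem (M.pair y z) X := by
  obtain ⟨Z, -, h⟩ := operation (.tail _ <| .tail _ <| .head _) a ![c] ![X]
  refine ⟨Z, fun z hz => (h z hz).trans ?_⟩
  simp only [Formula.realize_exLE]
  exact Iff.rfl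

theorem exists_lift (a : M.Num) (X : M.Str) : ∃ Z, ∀ v x e, M.pair v (M.pair x e) < a →
    (M.mem (M.pair v (M.pair x e)) Z ↔ M.mem (M.pair v e) X) := by
  obtain ⟨Z, -, h⟩ := operation (.tail _ <| .tail _ <| .tail _ <| .head _) a ![] ![X]
  refine ⟨Z, fun v x e hz => (h _ hz).trans ?_⟩
  simp only [Formula.realize_exLE]
  constructor
  · rintro ⟨v', -, x', -, e', -, h1, h2⟩
    obtain ⟨h3, h4⟩ := pair_inj.1 (show M.pair v (M.pair x e) = M.pair v' (M.pair x' e') from h1)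
    rw [h3, (pair_inj.1 h4).2]
    exact h2
  · intro h
    have h1 := right_le_pair v (M.pair x e)
    exact ⟨v, left_le_pair _ _, x, (left_le_pair x e).trans h1, e, (right_le_pair x e).trans h1,
      rfl, h⟩

theorem exists_diag (a : M.Num) : ∃ Z, ∀ v x e, M.pair v (M.pair x e) < a →
    (M.mem (M.pair v (M.pair x e)) Z ↔ v = x) := by
  obtain ⟨Z, -, h⟩ := operation (.tail _ <| .tail _ <| .tail _ <| .tail _ <| .head _) a ![] ![]
  refine ⟨Z, fun v x e hz => (h _ hz).trans ?_⟩
  simp only [Formula.realize_exLE]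
  constructor
  · rintro ⟨v', -, e', -, h1⟩
    obtain ⟨rfl, h1⟩ := pair_inj.1 (show M.pair v (M.pair x e) = M.pair v' (M.pair v' e') from h1)
    exact (pair_inj.1 h1).1.symm
  · rintro rfl
    exact ⟨v, left_le_pair _ _, e, (right_le_pair _ _).trans (right_le_pair _ _), rfl⟩

theorem exists_const (a c : M.Num) :
    ∃ Z, ∀ v e, M.pair v e < a → (M.mem (M.pair v e) Z ↔ v = c) := by
  obtain ⟨Z, -, h⟩ := operation (.tail _ <| .tail _ <| .tail _ <| .tail _ <| .tail _ <| .head _)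
    a ![c] ![]
  refine ⟨Z, fun v e hz => (h _ hz).trans ?_⟩
  simp only [Formula.realize_exLE]
  constructor
  · rintro ⟨e', -, h1⟩
    exact (pair_inj.1 (show M.pair v e = M.pair c e' from h1)).1
  · rintro rfl
    exact ⟨e, right_le_pair _ _, rfl⟩

theorem exists_add (a c : M.Num) (X Y : M.Str) : ∃ Z, ∀ v e, M.pair v e < a →
    (M.mem (M.pair v e) Z ↔ ∃ u ≤ c, ∃ w ≤ c, v = u + w ∧ M.mem (M.pair u e) X ∧
      M.mem (M.pair w e) Y) := by
  obtain ⟨Z, -, h⟩ := operation (.tail _ <| .tail _ <| .tail _ <| .tail _ <| .tail _ <| .tail _ <|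
    .head _) a ![c] ![X, Y]
  refine ⟨Z, fun v e hz => (h _ hz).trans ?_⟩
  simp only [Formula.realize_exLE]
  constructor
  · rintro ⟨e', -, u, hu, w, hw, h1, h2⟩
    obtain ⟨rfl, rfl⟩ := pair_inj.1 (show M.pair v e = M.pair (u + w) e' from h1)
    exact ⟨u, hu, w, hw, rfl, h2⟩
  · rintro ⟨u, hu, w, hw, rfl, h⟩
    exact ⟨e, right_le_pair _ _, u, hu, w, hw, rfl, h⟩

theorem exists_mul (a c : M.Num) (X Y : M.Str) : ∃ Z, ∀ v e, M.pair v e < a →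
    (M.mem (M.pair v e) Z ↔ ∃ u ≤ c, ∃ w ≤ c, v = u * w ∧ M.mem (M.pair u e) X ∧
      M.mem (M.pair w e) Y) := by
  obtain ⟨Z, -, h⟩ := operation (.tail _ <| .tail _ <| .tail _ <| .tail _ <| .tail _ <| .tail _ <|
    .tail _ <| .head _) a ![c] ![X, Y]
  refine ⟨Z, fun v e hz => (h _ hz).trans ?_⟩
  simp only [Formula.realize_exLE]
  constructor
  · rintro ⟨e', -, u, hu, w, hw, h1, h2⟩
    obtain ⟨rfl, rfl⟩ := pair_inj.1 (show M.pair v e = M.pair (u * w) e' from h1)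
    exact ⟨u, hu, w, hw, rfl, h2⟩
  · rintro ⟨u, hu, w, hw, rfl, h⟩
    exact ⟨e, right_le_pair _ _, u, hu, w, hw, rfl, h⟩

theorem exists_leRel (a c : M.Num) (X Y : M.Str) : ∃ Z, ∀ e < a,
    (M.mem e Z ↔ ∃ u ≤ c, ∃ w ≤ c, u ≤ w ∧ M.mem (M.pair u e) X ∧ M.mem (M.pair w e) Y) := by
  obtain ⟨Z, -, h⟩ := operation (.tail _ <| .tail _ <| .tail _ <| .tail _ <| .tail _ <| .tail _ <|
    .tail _ <| .tail _ <| .head _) a ![c] ![X, Y]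
  refine ⟨Z, fun e hz => (h _ hz).trans ?_⟩
  simp only [Formula.realize_exLE]
  exact Iff.rfl

theorem exists_eqRel (a c : M.Num) (X Y : M.Str) : ∃ Z, ∀ e < a,
    (M.mem e Z ↔ ∃ u ≤ c, M.mem (M.pair u e) X ∧ M.mem (M.pair u e) Y) := by
  obtain ⟨Z, -, h⟩ := operation (.tail _ <| .tail _ <| .tail _ <| .tail _ <| .tail _ <| .tail _ <|
    .tail _ <| .tail _ <| .tail _ <| .head _) a ![c] ![X, Y]
  refine ⟨Z, fun e hz => (h _ hz).trans ?_⟩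
  simp only [Formula.realize_exLE]
  exact Iff.rfl

theorem exists_memRel (a c : M.Num) (X Y : M.Str) : ∃ Z, ∀ e < a,
    (M.mem e Z ↔ ∃ u ≤ c, M.mem (M.pair u e) X ∧ M.mem u Y) := by
  obtain ⟨Z, -, h⟩ := operation (.tail _ <| .tail _ <| .tail _ <| .tail _ <| .tail _ <| .tail _ <|
    .tail _ <| .tail _ <| .tail _ <| .tail _ <| .head _) a ![c] ![X, Y]
  refine ⟨Z, fun e hz => (h _ hz).trans ?_⟩
  simp only [Formula.realize_exLE]
  exact Iff.rfl

theorem exists_section (a c : M.Num) (X : M.Str) :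
    ∃ Z, M.len Z ≤ a ∧ ∀ z < a, (M.mem z Z ↔ M.mem (M.pair z c) X) :=
  operation (.tail _ <| .tail _ <| .tail _ <| .tail _ <| .tail _ <| .tail _ <|
    .tail _ <| .tail _ <| .tail _ <| .tail _ <| .tail _ <| .head _) a ![c] ![X]

/-- The number coding a tuple, with the pairing function iterated. -/
def code (M : Structure L2A) : {m : ℕ} → (Fin m → M.Num) → M.Num
  | 0, _ => M.zero
  | _ + 1, v => M.pair (v 0) (M.code (Fin.tail v))

@[simp] theorem code_cons {M : Structure L2A} {m : ℕ} (x : M.Num) (v : Fin m → M.Num) :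
    M.code (Fin.cons x v : Fin (m + 1) → M.Num) = M.pair x (M.code v) := by
  simp [code]

theorem le_code : ∀ {m : ℕ} (v : Fin m → M.Num) (i : Fin m), v i ≤ M.code v
  | m + 1, v, i => by
      rw [← Fin.cons_self_tail v, code_cons]
      refine Fin.cases ?_ (fun i => ?_) i
      · exact left_le_pair _ _
      · exact (le_code (Fin.tail v) i).trans (right_le_pair _ _)

/-- The relation `R` is represented by a string on every initial segment of codes of tuples. -/
def Coded (M : Structure L2A) [M.IsFin] {m : ℕ} (R : (Fin m → M.Num) → Prop) : Prop :=
  ∀ b : M.Num, ∃ X, ∀ v, M.code v < b → (M.mem (M.code v) X ↔ R v)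

/-- The graph of the function `f` is represented by a string on every initial segment. -/
def CodedFn (M : Structure L2A) [M.IsFin] {m : ℕ} (f : (Fin m → M.Num) → M.Num) : Prop :=
  ∀ b : M.Num, ∃ X, ∀ u v, M.pair u (M.code v) < b → (M.mem (M.pair u (M.code v)) X ↔ u = f v)

namespace Coded
variable {m : ℕ} {R S : (Fin m → M.Num) → Prop}

protected theorem not (h : M.Coded R) : M.Coded fun v => ¬ R v := fun b => by
  obtain ⟨X, hX⟩ := h b
  obtain ⟨Z, hZ⟩ := exists_compl b X
  exact ⟨Z, fun v hv => by rw [hZ _ hv, hX v hv]⟩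

protected theorem and (h : M.Coded R) (h' : M.Coded S) : M.Coded fun v => R v ∧ S v := fun b => by
  obtain ⟨X, hX⟩ := h b
  obtain ⟨Y, hY⟩ := h' b
  obtain ⟨Z, hZ⟩ := exists_inter b X Y
  exact ⟨Z, fun v hv => by rw [hZ _ hv, hX v hv, hY v hv]⟩

theorem congr (h : M.Coded R) (hR : ∀ v, R v ↔ S v) : M.Coded S := by
  rwa [← show R = S from funext fun v => propext (hR v)]

protected theorem or (h : M.Coded R) (h' : M.Coded S) : M.Coded fun v => R v ∨ S v :=
  (h.not.and h'.not).not.congr fun v => by tauto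

protected theorem const (p : Prop) : M.Coded fun _ : Fin m → M.Num => p := by
  have : M.Coded fun _ : Fin m → M.Num => False := fun b => by
    obtain ⟨X⟩ := M.str_nonempty
    obtain ⟨Y, hY⟩ := exists_compl b X
    obtain ⟨Z, hZ⟩ := exists_inter b X Y
    exact ⟨Z, fun v hv => by rw [hZ _ hv, hY _ hv]; tauto⟩
  by_cases hp : p
  · exact this.not.congr fun _ => by simp [hp]
  · exact this.congr fun _ => by simp [hp]

end Coded

theorem eval_le_of_code_lt {m n : ℕ} (s : NumTerm L2A m n) (V : Fin n → M.Str) {v : Fin m → M.Num}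
    {b : M.Num} (hv : M.code v < b) : s.eval M v V ≤ s.eval M (fun _ => b) V :=
  s.eval_mono (fun i => (le_code v i).trans hv.le) fun _ => le_rfl

/-- The graph of a term is assembled from the graphs of its subterms. Monotonicity bounds the
intermediate values uniformly on an initial segment of codes, so bounded operations suffice. -/
theorem codedFn_eval {m n : ℕ} (s : NumTerm L2A m n) (V : Fin n → M.Str) :
    M.CodedFn fun v => s.eval M v V := by
  have const : ∀ c : M.Num, M.CodedFn fun _ : Fin m → M.Num => c := fun c b => by
    obtain ⟨Z, hZ⟩ := exists_const b c
    exact ⟨Z, fun u v h => hZ u _ h⟩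
  induction s using NumTerm.baseInduction with
  | zero => exact const _
  | one => exact const _
  | len j => exact const (M.len (V j))
  | var i =>
    simp only [NumTerm.eval_var]
    clear const
    -- The first coordinate is read off with the diagonal; a later one is a coordinate of the tail,
    -- lifted by a dummy coordinate.
    induction m with
    | zero => exact i.elim0
    | succ m ih =>
      intro b
      refine Fin.cases ?_ (fun i => ?_) i
      · obtain ⟨Z, hZ⟩ := exists_diag b
        exact ⟨Z, fun u v h => hZ _ _ _ h⟩
      · obtain ⟨X, hX⟩ := ih i b
        obtain ⟨Z, hZ⟩ := exists_lift b X
        refine ⟨Z, fun u v h => (hZ _ _ _ h).trans (hX u (Fin.tail v) ?_)⟩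
        exact (pair_mono le_rfl (right_le_pair _ _)).trans_lt h
  | add s t hs ht =>
    intro b
    -- A tuple with code below `b` has entries below `b`, so `c` bounds both subterms on all these
    -- tuples, and their graphs are needed only for pairs up to `⟨c, b⟩`.
    obtain ⟨c, hc⟩ : ∃ c, c = s.eval M (fun _ => b) V + t.eval M (fun _ => b) V := ⟨_, rfl⟩
    obtain ⟨X, hX⟩ := hs (M.pair c b + 1)
    obtain ⟨Y, hY⟩ := ht (M.pair c b + 1)
    obtain ⟨Z, hZ⟩ := exists_add b c X Y
    refine ⟨Z, fun u v h => ?_⟩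
    have hv : M.code v < b := (right_le_pair _ _).trans_lt h
    have hb : ∀ {w}, w ≤ c → M.pair w (M.code v) < M.pair c b + 1 := fun hw =>
      lt_add_one_iff'.2 (pair_mono hw hv.le)
    have hsc : s.eval M v V ≤ c := hc ▸ (eval_le_of_code_lt s V hv).trans le_self_add
    have htc : t.eval M v V ≤ c := hc ▸ (eval_le_of_code_lt t V hv).trans le_add_self
    rw [hZ _ _ h]
    constructor
    · rintro ⟨x, hx, y, hy, rfl, h1, h2⟩
      rw [(hX _ _ (hb hx)).1 h1, (hY _ _ (hb hy)).1 h2]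
      rfl
    · rintro rfl
      exact ⟨_, hsc, _, htc, rfl, (hX _ _ (hb hsc)).2 rfl, (hY _ _ (hb htc)).2 rfl⟩
  | mul s t hs ht =>
    intro b
    obtain ⟨c, hc⟩ : ∃ c, c = s.eval M (fun _ => b) V + t.eval M (fun _ => b) V := ⟨_, rfl⟩
    obtain ⟨X, hX⟩ := hs (M.pair c b + 1)
    obtain ⟨Y, hY⟩ := ht (M.pair c b + 1)
    obtain ⟨Z, hZ⟩ := exists_mul b c X Y
    refine ⟨Z, fun u v h => ?_⟩
    have hv : M.code v < b := (right_le_pair _ _).trans_lt h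
    have hb : ∀ {w}, w ≤ c → M.pair w (M.code v) < M.pair c b + 1 := fun hw =>
      lt_add_one_iff'.2 (pair_mono hw hv.le)
    have hsc : s.eval M v V ≤ c := hc ▸ (eval_le_of_code_lt s V hv).trans le_self_add
    have htc : t.eval M v V ≤ c := hc ▸ (eval_le_of_code_lt t V hv).trans le_add_self
    rw [hZ _ _ h]
    constructor
    · rintro ⟨x, hx, y, hy, rfl, h1, h2⟩
      rw [(hX _ _ (hb hx)).1 h1, (hY _ _ (hb hy)).1 h2]
      rfl
    · rintro rfl
      exact ⟨_, hsc, _, htc, rfl, (hX _ _ (hb hsc)).2 rfl, (hY _ _ (hb htc)).2 rfl⟩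

theorem CodedFn.exists_graph {m n : ℕ} (s : NumTerm L2A m n) (V : Fin n → M.Str) (b c : M.Num) :
    ∃ X, ∀ u ≤ c, ∀ v, M.code v < b → (M.mem (M.pair u (M.code v)) X ↔ u = s.eval M v V) := by
  obtain ⟨X, hX⟩ := codedFn_eval s V (M.pair c b)
  exact ⟨X, fun u hu v hv => hX u v (pair_lt_pair hu hv)⟩

/-- The strings `V` are fixed parameters, so an equation between string variables is a constant
relation. Other atoms compare coded graphs of terms, a bounded `∃` is a projection, and a bounded
`∀` is its dual. -/
theorem coded_realize {m n : ℕ} {φ : Formula L2A m n} (h : φ.IsSigma0B) (V : Fin n → M.Str) :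
    M.Coded fun v => φ.Realize M v V := by
  have hle : ∀ {m n : ℕ} (s t : NumTerm L2A m n) (V : Fin n → M.Str),
      M.Coded fun v => (Formula.le s t).Realize M v V := by
    intro m n s t V b
    obtain ⟨c, hc⟩ : ∃ c, c = s.eval M (fun _ => b) V + t.eval M (fun _ => b) V := ⟨_, rfl⟩
    obtain ⟨X, hX⟩ := CodedFn.exists_graph s V b c
    obtain ⟨Y, hY⟩ := CodedFn.exists_graph t V b c
    obtain ⟨Z, hZ⟩ := exists_leRel b c X Y
    refine ⟨Z, fun v hv => ?_⟩
    have hsc : s.eval M v V ≤ c := hc ▸ (eval_le_of_code_lt s V hv).trans le_self_add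
    have htc : t.eval M v V ≤ c := hc ▸ (eval_le_of_code_lt t V hv).trans le_add_self
    rw [hZ _ hv]
    constructor
    · rintro ⟨x, hx, y, hy, hxy, h1, h2⟩
      rw [(hX _ hx _ hv).1 h1, (hY _ hy _ hv).1 h2] at hxy
      exact hxy
    · intro h
      exact ⟨_, hsc, _, htc, h, (hX _ hsc _ hv).2 rfl, (hY _ htc _ hv).2 rfl⟩
  have hex : ∀ {m n : ℕ} (t : NumTerm L2A m n) (φ : Formula L2A (m + 1) n) (V : Fin n → M.Str),
      (M.Coded fun v => φ.Realize M v V) → M.Coded fun v => (Formula.exLE t φ).Realize M v V := by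
    intro m n t φ V ih b
    obtain ⟨c, hc⟩ : ∃ c, c = t.eval M (fun _ => b) V := ⟨_, rfl⟩
    -- Projection offers only the uniform bound `c`, so the true bound `y ≤ t`, which varies with
    -- the tuple, is put into the projected relation.
    obtain ⟨X, hX⟩ := (hle (.var 0) t.shiftN V).and ih (M.pair c b)
    obtain ⟨Z, hZ⟩ := exists_proj b c X
    refine ⟨Z, fun v hv => ?_⟩
    have hb : ∀ {y}, y ≤ c → (M.mem (M.pair y (M.code v)) X ↔
        y ≤ t.eval M v V ∧ φ.Realize M (Fin.cons y v) V) := by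
      intro y hy
      have := hX (Fin.cons y v) (by rw [code_cons]; exact pair_lt_pair hy hv)
      rw [code_cons] at this
      simp only [Formula.realize_le, NumTerm.eval_var, Fin.cons_zero, NumTerm.eval_shiftN] at this
      exact this
    rw [hZ _ hv]
    refine Iff.trans ?_ (Formula.realize_exLE M v V t φ).symm
    constructor
    · rintro ⟨y, hy, h⟩
      exact ⟨y, (hb hy).1 h⟩
    · rintro ⟨y, hy, h⟩
      have hyc : y ≤ c := hc ▸ le_trans hy (eval_le_of_code_lt t V hv)
      exact ⟨y, hyc, (hb hyc).2 ⟨hy, h⟩⟩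
  induction h with
  | tru => exact .const _
  | fls => exact .const _
  | le s t => exact hle s t V
  | eqS S T =>
    obtain ⟨i, rfl⟩ := S.exists_eq_var
    obtain ⟨j, rfl⟩ := T.exists_eq_var
    exact (Coded.const (V i = V j)).congr fun v => by simp
  | eqN s t =>
    intro b
    obtain ⟨c, hc⟩ : ∃ c, c = s.eval M (fun _ => b) V := ⟨_, rfl⟩
    obtain ⟨X, hX⟩ := CodedFn.exists_graph s V b c
    obtain ⟨Y, hY⟩ := CodedFn.exists_graph t V b c
    obtain ⟨Z, hZ⟩ := exists_eqRel b c X Y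
    refine ⟨Z, fun v hv => ?_⟩
    have hsc : s.eval M v V ≤ c := hc ▸ eval_le_of_code_lt s V hv
    rw [hZ _ hv]
    constructor
    · rintro ⟨x, hx, h1, h2⟩
      exact ((hX _ hx _ hv).1 h1).symm.trans ((hY _ hx _ hv).1 h2)
    · intro h
      exact ⟨_, hsc, (hX _ hsc _ hv).2 rfl, (hY _ hsc _ hv).2 h⟩
  | mem s T =>
    obtain ⟨j, rfl⟩ := T.exists_eq_var
    intro b
    obtain ⟨c, hc⟩ : ∃ c, c = s.eval M (fun _ => b) V := ⟨_, rfl⟩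
    obtain ⟨X, hX⟩ := CodedFn.exists_graph s V b c
    obtain ⟨Z, hZ⟩ := exists_memRel b c X (V j)
    refine ⟨Z, fun v hv => ?_⟩
    have hsc : s.eval M v V ≤ c := hc ▸ eval_le_of_code_lt s V hv
    rw [hZ _ hv]
    constructor
    · rintro ⟨x, hx, h1, h2⟩
      rw [(hX _ hx _ hv).1 h1] at h2
      exact h2
    · intro h
      exact ⟨_, hsc, (hX _ hsc _ hv).2 rfl, h⟩
  | not _ ih => exact (ih V).not
  | and _ _ ih ih' => exact (ih V).and (ih' V)
  | or _ _ ih ih' => exact (ih V).or (ih' V)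
  | exLE t _ ih => exact hex t _ V (ih V)
  | @allLE m n t φ _ ih =>
    exact (hex t (.not φ) V (ih V).not).not.congr fun v => by simp

/-- Comprehension for bounded formulas. -/
theorem exists_comprehension {m n : ℕ} {φ : Formula L2A (m + 1) n} (h : φ.IsSigma0B) (a : M.Num)
    (v : Fin m → M.Num) (V : Fin n → M.Str) :
    ∃ X, M.len X ≤ a ∧ ∀ z < a, (M.mem z X ↔ φ.Realize M (Fin.cons z v) V) := by
  -- With the parameters fixed at `v`, the required set is the section at `M.code v` of the coded
  -- relation.
  obtain ⟨X, hX⟩ := coded_realize h V (M.pair a (M.code v))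
  obtain ⟨Z, hZ, hmem⟩ := exists_section a (M.code v) X
  refine ⟨Z, hZ, fun z hz => (hmem z hz).trans ?_⟩
  have := hX (Fin.cons z v) (by rw [code_cons]; exact pair_lt_pair' hz le_rfl)
  rwa [code_cons] at this

theorem isModel_V0 : M.IsModel V0 := by
  rintro φ (h | ⟨m, n, φ, hφ, rfl⟩)
  · exact IsFin.isModel _ (.inl h)
  · rw [satisfies_comprehension]
    intro v V
    exact exists_comprehension hφ (v 0) v V

end Structure

theorem isSigma0B_of_mem_arithFormulas : ∀ e ∈ arithFormulas, e.2.2.IsSigma0B := by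
  simp only [arithFormulas, List.forall_mem_cons, List.not_mem_nil, false_imp_iff, implies_true,
    and_true]
  repeat' constructor

theorem isSigma0B_of_mem_operationFormulas : ∀ e ∈ operationFormulas, e.2.2.IsSigma0B := by
  simp only [operationFormulas, List.forall_mem_cons, List.not_mem_nil, false_imp_iff, implies_true,
    and_true]
  repeat' constructor

theorem finAxioms_subset_V0 : finAxioms ⊆ V0 := by
  rintro φ (h | ⟨e, he, rfl⟩ | ⟨e, he, rfl⟩)
  · exact .inl h
  · exact .inr ⟨_, _, _, (isSigma0B_of_mem_arithFormulas e he).allBelow, rfl⟩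
  · exact .inr ⟨_, _, _, isSigma0B_of_mem_operationFormulas e he, rfl⟩

theorem finite_finAxioms : finAxioms.Finite := by
  refine .union ?_ (.union ?_ ?_)
  · simp [basicAxioms]
  · have : {ψ | ∃ e ∈ arithFormulas, ψ = comprehension e.2.2.allBelow} =
        {ψ | ψ ∈ arithFormulas.map fun e => comprehension e.2.2.allBelow} := by
      ext ψ
      simp [eq_comm]
    rw [this]
    exact List.finite_toSet _
  · have : {ψ | ∃ e ∈ operationFormulas, ψ = comprehension e.2.2} =
        {ψ | ψ ∈ operationFormulas.map fun e => comprehension e.2.2} := by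
      ext ψ
      simp [eq_comm]
    rw [this]
    exact List.finite_toSet _

theorem Structure.IsModel.isFin {M : Structure L2A} (h : M.IsModel V0) : M.IsFin :=
  ⟨fun φ hφ => h φ (finAxioms_subset_V0 hφ)⟩

theorem finitelyAxiomatizable_V0_union {S : Set Sentence} (hS : S.Finite) :
    FinitelyAxiomatizable (V0 ∪ S) := by
  refine ⟨finAxioms ∪ S, finite_finAxioms.union hS, ?_, ?_⟩
  · rintro φ (h | h) M hM
    · exact hM φ (.inl (finAxioms_subset_V0 h))
    · exact hM φ (.inr h)
  · rintro φ (h | h) M hM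
    · have : M.IsFin := ⟨fun ψ hψ => hM ψ (.inl hψ)⟩
      exact Structure.isModel_V0 φ h
    · exact hM φ (.inr h)

end TwoSorted

namespace TwoSorted

/-! ## Rows and the axiom for a bounded recursion -/

namespace Structure

/-- The row `X^{[r]} = {z : X(⟨r, z⟩)}`. -/
noncomputable def row (M : Structure L2A) (X : M.Str) (r : M.Num) : M.Str :=
  @Classical.epsilon _ M.str_nonempty fun R => ∀ z, M.mem z R ↔ M.mem (M.pair r z) X

variable {M : Structure L2A} [M.IsFin]

-- The choice in `row` is justified because comprehension up to `|X|` already catches the whole row: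
-- `z ≤ ⟨r, z⟩ < |X|`.
@[simp] theorem mem_row {X : M.Str} {r z : M.Num} :
    M.mem z (M.row X r) ↔ M.mem (M.pair r z) X := by
  have : ∃ R, ∀ z, M.mem z R ↔ M.mem (M.pair r z) X := by
    obtain ⟨R, hR, h⟩ := exists_comprehension
      (.mem (.pair (.var 1) (.var 0)) (.var 0) : (Formula.mem _ _ : Formula L2A 2 1).IsSigma0B)
      (M.len X) ![r] ![X]
    refine ⟨R, fun z => ?_⟩
    have e : ∀ z, (Formula.mem (.pair (.var 1) (.var 0)) (.var 0) : Formula L2A 2 1).Realize M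
        (Fin.cons z ![r]) ![X] ↔ M.mem (M.pair r z) X := fun z => Iff.rfl
    by_cases hz : z < M.len X
    · rw [h z hz, e]
    · refine iff_of_false (fun h => hz ((lt_len_of_mem h).trans_le hR)) fun h => hz ?_
      exact (right_le_pair r z).trans_lt (lt_len_of_mem h)
  exact Classical.epsilon_spec this z

theorem row_eq {X R : M.Str} {r : M.Num} (h : ∀ z, M.mem z R ↔ M.mem (M.pair r z) X) :
    M.row X r = R := str_ext fun z => by rw [mem_row, h]

theorem len_row_le (X : M.Str) (r : M.Num) : M.len (M.row X r) ≤ M.len X :=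
  len_le_iff.2 fun z hz => (right_le_pair r z).trans_lt (lt_len_of_mem (mem_row.1 hz))

theorem eq_len_iff {X : M.Str} {a : M.Num} :
    a = M.len X ↔ (∀ z, M.mem z X → z < a) ∧ (a = 0 ∨ ∃ z, z < a ∧ z + 1 = a ∧ M.mem z X) := by
  constructor
  · rintro rfl
    refine ⟨fun z => lt_len_of_mem, ?_⟩
    by_cases h0 : M.len X = 0
    · exact .inl h0
    · obtain ⟨u, h, hu⟩ := M.isBasic.exists_pred _ h0
      exact .inr ⟨u, h, hu, M.isBasic.mem_of_succ_eq_len _ _ hu⟩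
  · rintro ⟨h1, h2⟩
    refine le_antisymm ?_ (len_le_iff.2 h1)
    rcases h2 with rfl | ⟨z, -, rfl, hz⟩
    · exact zero_le
    · exact lt_iff_add_one_le.1 (lt_len_of_mem hz)

theorem realize_rowLength {m n : ℕ} (ℓ r : NumTerm L2A m n) (j : Fin n) (v : Fin m → M.Num)
    (V : Fin n → M.Str) : (rowLength ℓ r j).Realize M v V ↔
      ℓ.eval M v V = M.len (M.row (V j) (r.eval M v V)) := by
  rw [eq_len_iff]
  simp only [rowLength, Formula.realize_and, Formula.realize_allLT, Formula.realize_imp,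
    Formula.realize_or, Formula.realize_exLT, Formula.realize_eqN, Formula.realize_mem,
    Formula.realize_lt, NumTerm.eval_shiftN, NumTerm.eval_pair, NumTerm.eval_var, Fin.cons_zero,
    StrTerm.eval_var, NumTerm.eval_len, NumTerm.eval_zero, NumTerm.eval_add, NumTerm.eval_one,
    mem_row]
  refine and_congr ⟨fun h z hz => ?_, fun h z _ hz => h z hz⟩ Iff.rfl
  exact h z ((right_le_pair _ z).trans_lt (lt_len_of_mem hz)) hz

theorem induction_sigma0B {m n : ℕ} {φ : Formula L2A (m + 1) n} (h : φ.IsSigma0B)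
    (v : Fin m → M.Num) (V : Fin n → M.Str) (P : M.Num → Prop)
    (hP : ∀ z, φ.Realize M (Fin.cons z v) V ↔ P z) (zero : P 0) (succ : ∀ z, P z → P (z + 1))
    (a : M.Num) : P a := by
  refine M.isBasic.induction_of_comprehension (m := m) (n := n)
    -- The comprehension scheme reserves variable `1` for the bound; the renaming inserts it as a
    -- variable that does not occur.
    (φ := φ.rename (Fin.cons 0 fun i => i.succ.succ) id)
    (isModel_V0 _ (.inr ⟨_, _, _, (h.rename _ _).allBelow, rfl⟩)) v V P (fun b z => ?_) zero succ a
  rw [Formula.realize_rename, ← hP]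
  have : (fun i => (Fin.cons z (Fin.cons b v : Fin (m + 1) → M.Num) : Fin (m + 2) → M.Num)
      ((Fin.cons 0 fun i => i.succ.succ : Fin (m + 1) → Fin (m + 2)) i)) =
      (Fin.cons z v : Fin (m + 1) → M.Num) := by
    funext i
    refine Fin.cases ?_ (fun i => ?_) i <;> simp
  rw [this]
  rfl

end Structure

theorem isSigma0B_rowLength {m n : ℕ} (ℓ r : NumTerm L2A m n) (j : Fin n) :
    (rowLength ℓ r j).IsSigma0B :=
  .and (.allLT _ (.imp (.mem _ _) (.lt _ _)))
    (.or (.eqN _ _) (.exLT _ (.and (.eqN _ _) (.mem _ _))))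

/-- The data of a bounded recursion. -/
structure RecData where
  φInit : Formula L2A 1 1
  φNext : Formula L2A 2 2
  t : NumTerm L2A 2 0
  hInit : φInit.IsSigma0B
  hNext : φNext.IsSigma0B

namespace RecData
variable (D : RecData)

/-- The theory of the recursion. -/
abbrev theory : Set Sentence := recTheory D.φInit D.φNext D.t

/-- The value of the bounding term of the recursion. -/
def bd (M : Structure L2A) (x l : M.Num) : M.Num := D.t.eval M ![x, l] Fin.elim0

/-- The bound on the string that contains the rows of the recursion. -/
def bound (M : Structure L2A) (b a : M.Num) (X : M.Str) : M.Num :=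
  M.pair (M.pair b a) (D.bd M a (M.len X))

/-- The content of the formula `recFormula`. -/
def RecSpec (M : Structure L2A) (b a : M.Num) (X Y : M.Str) : Prop :=
  ∀ y, M.lt y b →
    (∀ z, M.lt z (D.bound M b a X) → (M.mem (M.pair (M.pair y M.zero) z) Y ↔
      M.lt z (D.bd M M.zero (M.len (M.row X y))) ∧ D.φInit.Realize M ![z] ![M.row X y])) ∧
    ∀ x, M.lt x a → ∀ z, M.lt z (D.bound M b a X) →
      (M.mem (M.pair (M.pair y (M.add x M.one)) z) Y ↔
        M.lt z (D.bd M (M.add x M.one) (M.len (M.row X y))) ∧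
          D.φNext.Realize M ![z, x] ![M.row X y, M.row Y (M.pair y x)])

variable {D} {M : Structure L2A}

theorem eval_subst_t {m n : ℕ} (r s : NumTerm L2A m n) (v : Fin m → M.Num) (V : Fin n → M.Str) :
    (D.t.subst ![r, s] Fin.elim0).eval M v V = D.bd M (r.eval M v V) (s.eval M v V) := by
  rw [NumTerm.eval_subst (W := Fin.elim0) fun j => j.elim0]
  congr 1
  funext i
  fin_cases i <;> rfl

theorem eval_recBound {n : ℕ} (j : Fin n) (v : Fin 2 → M.Num) (V : Fin n → M.Str) :
    (recBound D.t j).eval M v V = D.bound M (v 0) (v 1) (V j) := by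
  simp [recBound, eval_subst_t, bound]

theorem isSigma0B_recFormula : (recFormula D.φInit D.φNext D.t).IsSigma0B :=
  .allLT _ (.exLE _ (.and (isSigma0B_rowLength _ _ _) (.and
    (.allLT _ (.iff (.mem _ _) (.and (.lt _ _) (D.hInit.subst _ _))))
    (.allLT _ (.exLE _ (.and (isSigma0B_rowLength _ _ _) (.allLT _ (.iff (.mem _ _)
      (.and (.lt _ _) (D.hNext.subst _ _))))))))))

variable [M.IsFin]

/-- The existentially quantified `ℓ` and `k` are forced to be the lengths of the rows, and a row is
no longer than its string, so their bounds exclude nothing. What remains is the substitution lemma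
for rows. -/
theorem realize_recFormula (b a : M.Num) (X Y : M.Str) :
    (recFormula D.φInit D.φNext D.t).Realize M ![b, a] ![Y, X] ↔ D.RecSpec M b a X Y := by
  unfold recFormula RecSpec
  simp only [Formula.realize_allLT, Formula.realize_exLE, Formula.realize_and,
    Structure.realize_rowLength]
  refine forall_congr' fun y => forall_congr' fun hy => ?_
  have e1 : ∀ {m n : ℕ} (ρ : Fin 2 → Fin m) (v : Fin m → M.Num) (j : Fin n) (V : Fin n → M.Str),
      ((recBound D.t j).rename ρ id).eval M v V =
      D.bound M (v (ρ 0)) (v (ρ 1)) (V j) := fun ρ v j V => by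
    rw [NumTerm.eval_rename, eval_recBound]
    rfl
  constructor
  · rintro ⟨ℓ, -, hℓ, h0, h1⟩
    replace hℓ : ℓ = M.len (M.row X y) := hℓ
    subst hℓ
    constructor
    · intro z hz
      refine (Formula.realize_iff _ _ _ _ _).1 (h0 z (by rw [e1]; exact hz)) |>.trans ?_
      rw [Formula.realize_and, Formula.realize_lt, eval_subst_t,
        Formula.realize_subst (W := ![M.row X y]) ?_ (.inl M.isBasic.ext)]
      · refine and_congr Iff.rfl (iff_of_eq ?_)
        congr 1
        funext i
        fin_cases i; rfl
      · intro j
        fin_cases j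
        exact ⟨rfl, fun z => Structure.mem_row⟩
    · intro x hx z hz
      obtain ⟨k, -, hk, h2⟩ := h1 x hx
      replace hk : k = M.len (M.row Y (M.pair y x)) := hk
      subst hk
      refine (Formula.realize_iff _ _ _ _ _).1 (h2 z (by rw [e1]; exact hz)) |>.trans ?_
      rw [Formula.realize_and, Formula.realize_lt, eval_subst_t,
        Formula.realize_subst (W := ![M.row X y, M.row Y (M.pair y x)]) ?_ (.inl M.isBasic.ext)]
      · refine and_congr Iff.rfl (iff_of_eq ?_)
        congr 1
        funext i
        fin_cases i <;> rfl
      · intro j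
        fin_cases j
        · exact ⟨rfl, fun z => Structure.mem_row⟩
        · exact ⟨rfl, fun z => Structure.mem_row⟩
  · rintro ⟨h0, h1⟩
    refine ⟨M.len (M.row X y), Structure.len_row_le _ _, rfl, fun z hz => ?_, fun x hx =>
      ⟨M.len (M.row Y (M.pair y x)), Structure.len_row_le _ _, rfl, fun z hz => ?_⟩⟩
    · rw [e1] at hz
      refine (Formula.realize_iff _ _ _ _ _).2 ((h0 z hz).trans ?_)
      rw [Formula.realize_and, Formula.realize_lt, eval_subst_t,
        Formula.realize_subst (W := ![M.row X y]) ?_ (.inl M.isBasic.ext)]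
      · refine and_congr Iff.rfl (iff_of_eq ?_)
        congr 1
        funext i
        fin_cases i; rfl
      · intro j
        fin_cases j
        exact ⟨rfl, fun z => Structure.mem_row⟩
    · rw [e1] at hz
      refine (Formula.realize_iff _ _ _ _ _).2 ((h1 x hx z hz).trans ?_)
      rw [Formula.realize_and, Formula.realize_lt, eval_subst_t,
        Formula.realize_subst (W := ![M.row X y, M.row Y (M.pair y x)]) ?_ (.inl M.isBasic.ext)]
      · refine and_congr Iff.rfl (iff_of_eq ?_)
        congr 1
        funext i
        fin_cases i <;> rfl
      · intro j
        fin_cases j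
        · exact ⟨rfl, fun z => Structure.mem_row⟩
        · exact ⟨rfl, fun z => Structure.mem_row⟩

theorem satisfies_recAxiom : M.Satisfies (recAxiom D.φInit D.φNext D.t) ↔
    ∀ a b X, ∃ Y, M.len Y ≤ D.bound M b a X ∧ D.RecSpec M b a X Y := by
  rw [recAxiom, Structure.Satisfies]
  simp only [Formula.realize_allN, Formula.realize_allS, Formula.realize_exSLE, eval_recBound]
  refine forall_congr' fun a => forall_congr' fun b => forall_congr' fun X => exists_congr fun Y =>
    and_congr Iff.rfl ?_
  rw [← realize_recFormula]
  have e1 : (Fin.cons b (Fin.cons a Fin.elim0) : Fin 2 → M.Num) = ![b, a] := by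
    ext i; fin_cases i <;> rfl
  have e2 : (Fin.cons Y (Fin.cons X Fin.elim0) : Fin 2 → M.Str) = ![Y, X] := by
    ext i; fin_cases i <;> rfl
  exact iff_of_eq (congrArg₂ _ e1 e2)

variable (D) in
/-- The string `Z` consists exactly of the rows of the recursion that are required by `RecSpec`. -/
def RecGraph (M : Structure L2A) (b a : M.Num) (X Z : M.Str) : Prop :=
  M.le (M.len Z) (D.bound M b a X) ∧ D.RecSpec M b a X Z ∧
    ∀ z, M.mem z Z → ∃ y, M.lt y b ∧ ∃ x, M.le x a ∧ ∃ w, M.le w z ∧ z = M.pair (M.pair y x) w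

-- `AXIOM_F` says nothing about positions outside the rows `⟨y, x⟩` with `y < b`, `x ≤ a`, so its
-- witness is not unique. Comprehension discards those positions; the specification survives because
-- it inspects only the rows that are kept.
open Formula NumTerm in
theorem exists_recGraph (h : M.Satisfies (recAxiom D.φInit D.φNext D.t)) (b a : M.Num)
    (X : M.Str) : ∃ Z, D.RecGraph M b a X Z := by
  obtain ⟨Y, hY, hs⟩ := satisfies_recAxiom.1 h a b X
  obtain ⟨Z, hZ, hmem⟩ := Structure.exists_comprehension
    (φ := .and (.mem (.var 0) (.var 0)) (exLT (.var 1) (exLE (.var 3) (exLE (.var 2)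
      (eqN (.var 3) (pair (pair (.var 2) (.var 1)) (.var 0)))))))
    (.and (.mem _ _) (.exLT _ (.exLE _ (.exLE _ (.eqN _ _))))) (D.bound M b a X) ![b, a] ![Y]
  simp only [realize_and, realize_exLT, realize_exLE] at hmem
  have hmem : ∀ z, M.mem z Z ↔ M.mem z Y ∧ ∃ y, M.lt y b ∧ ∃ x, M.le x a ∧ ∃ w, M.le w z ∧
      z = M.pair (M.pair y x) w := by
    intro z
    by_cases hz : z < D.bound M b a X
    · exact hmem z hz
    · exact iff_of_false (fun h => hz ((Structure.lt_len_of_mem h).trans_le hZ))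
        fun h => hz ((Structure.lt_len_of_mem h.1).trans_le hY)
  have key : ∀ y, y < b → ∀ x, x ≤ a → ∀ w,
      (M.mem (M.pair (M.pair y x) w) Z ↔ M.mem (M.pair (M.pair y x) w) Y) := by
    intro y hy x hx w
    rw [hmem]
    exact ⟨fun h => h.1, fun h => ⟨h, y, hy, x, hx, w, Structure.right_le_pair _ _, rfl⟩⟩
  refine ⟨Z, hZ, fun y hy => ⟨fun z hz => ?_, fun x hx z hz => ?_⟩, fun z hz => ((hmem z).1 hz).2⟩
  · exact (key y hy _ (zero_le) z).trans ((hs y hy).1 z hz)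
  · have hr : M.row Z (M.pair y x) = M.row Y (M.pair y x) :=
      Structure.str_ext fun z => by
        rw [Structure.mem_row, Structure.mem_row, key y hy x (le_of_lt hx)]
    rw [hr]
    exact (key y hy _ (Structure.lt_iff_add_one_le.1 hx) z).trans ((hs y hy).2 x hx z hz)

-- By induction on the stage `x`, the rows `⟨y, x⟩` of both strings agree for all `y < b`
-- simultaneously. The bound enters the induction formula as a number parameter, which keeps it
-- `Σ^B_0`; positions beyond it are empty because of the lengths.
open Formula NumTerm in
theorem RecGraph.unique {b a : M.Num} {X Z Z' : M.Str} (h : D.RecGraph M b a X Z)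
    (h' : D.RecGraph M b a X Z') : Z = Z' := by
  have key : ∀ x : M.Num, x ≤ a → ∀ y, y < b → ∀ w, w < D.bound M b a X →
      (M.mem (M.pair (M.pair y x) w) Z ↔ M.mem (M.pair (M.pair y x) w) Z') := by
    refine Structure.induction_sigma0B (φ := .imp (.le (.var 0) (.var 1)) (allLT (.var 2)
      (allLT (.var 4) (.iff (.mem (pair (pair (.var 1) (.var 2)) (.var 0)) (.var 0))
        (.mem (pair (pair (.var 1) (.var 2)) (.var 0)) (.var 1))))))
      (.imp (.le _ _) (.allLT _ (.allLT _ (.iff (.mem _ _) (.mem _ _)))))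
      ![a, b, D.bound M b a X] ![Z, Z'] _ (fun x => ?_) (fun _ y hy w hw => ?_)
      fun x ih hx y hy w hw => ?_
    · simp only [realize_imp, realize_allLT, realize_iff]
      exact Iff.rfl
    · exact ((h.2.1 y hy).1 w hw).trans ((h'.2.1 y hy).1 w hw).symm
    · have hx' : x < a := Structure.lt_iff_add_one_le.2 hx
      have hr : M.row Z (M.pair y x) = M.row Z' (M.pair y x) := by
        refine Structure.str_ext fun z => ?_
        rw [Structure.mem_row, Structure.mem_row]
        by_cases hz : z < D.bound M b a X
        · exact ih hx'.le y hy z hz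
        · exact iff_of_false
            (fun hm => hz ((Structure.right_le_pair _ _).trans_lt
              ((Structure.lt_len_of_mem hm).trans_le h.1)))
            (fun hm => hz ((Structure.right_le_pair _ _).trans_lt
              ((Structure.lt_len_of_mem hm).trans_le h'.1)))
      have h1 := (h.2.1 y hy).2 x hx' w hw
      have h2 := (h'.2.1 y hy).2 x hx' w hw
      rw [hr] at h1
      exact h1.trans h2.symm
  refine Structure.str_ext fun z => ⟨fun hz => ?_, fun hz => ?_⟩
  · obtain ⟨y, hy, x, hx, w, -, rfl⟩ := h.2.2 z hz
    exact (key x hx y hy w ((Structure.right_le_pair _ _).trans_lt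
      ((Structure.lt_len_of_mem hz).trans_le h.1))).1 hz
  · obtain ⟨y, hy, x, hx, w, -, rfl⟩ := h'.2.2 z hz
    exact (key x hx y hy w ((Structure.right_le_pair _ _).trans_lt
      ((Structure.lt_len_of_mem hz).trans_le h'.1))).2 hz

end RecData

theorem RecData.isFin {D : RecData} {M : Structure L2A} (hM : M.IsModel D.theory) : M.IsFin :=
  Structure.IsModel.isFin fun φ h => hM φ (.inl h)

end TwoSorted

namespace TwoSorted

/-! ## Straight-line programs -/

/-- One step of a straight-line program with `k` numbers and `n` strings at hand: it computes a
string by bounded comprehension, or the rows of the recursion. -/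
inductive Step (k n : ℕ) : Type
  | comp (φ : Formula L2A (k + 1) n) (h : φ.IsSigma0B) (s : NumTerm L2A k n) : Step k n
  -- Both parameters `b` and `a` of the recursion are taken to be the length of string `i`; the rows
  -- start from string `j`.
  | recur (i j : Fin n) : Step k n

/-- Straight-line programs with `k` number inputs and `l` string inputs that end with `n` strings,
the latest first. -/
inductive Prog (k l : ℕ) : ℕ → Type
  | nil : Prog k l l
  | snoc {n : ℕ} (P : Prog k l n) (S : Step k n) : Prog k l (n + 1)

namespace Step
variable {k n : ℕ} (D : RecData)

/-- The string `Z` is a value of the step. -/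
def Spec (M : Structure L2A) (x : Fin k → M.Num) (V : Fin n → M.Str) (Z : M.Str) :
    Step k n → Prop
  | .comp φ _ s => M.le (M.len Z) (s.eval M x V) ∧
      ∀ z, M.lt z (s.eval M x V) → (M.mem z Z ↔ φ.Realize M (Fin.cons z x) V)
  | .recur i j => D.RecGraph M (M.len (V i)) (M.len (V i)) (V j) Z

/-- The value of a step. -/
noncomputable def val (M : Structure L2A) (x : Fin k → M.Num) (V : Fin n → M.Str)
    (S : Step k n) : M.Str :=
  @Classical.epsilon _ M.str_nonempty fun Z => S.Spec D M x V Z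

variable {D} {M : Structure L2A} {x : Fin k → M.Num} {V : Fin n → M.Str} {S : Step k n}

theorem exists_spec (hM : M.IsModel D.theory) : ∃ Z, S.Spec D M x V Z := by
  have := RecData.isFin hM
  cases S with
  | comp φ h s => exact Structure.exists_comprehension h _ _ _
  | recur i j => exact D.exists_recGraph (hM _ (.inr rfl)) _ _ _

theorem Spec.unique [M.IsFin] {Z Z' : M.Str} (h : S.Spec D M x V Z) (h' : S.Spec D M x V Z') :
    Z = Z' := by
  cases S with
  | comp φ hφ s =>
    refine Structure.str_ext fun z => ?_
    by_cases hz : z < s.eval M x V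
    · exact (h.2 z hz).trans (h'.2 z hz).symm
    · exact iff_of_false (fun hm => hz ((Structure.lt_len_of_mem hm).trans_le h.1))
        fun hm => hz ((Structure.lt_len_of_mem hm).trans_le h'.1)
  | recur i j => exact RecData.RecGraph.unique h h'

theorem spec_val (hM : M.IsModel D.theory) : S.Spec D M x V (S.val D M x V) :=
  Classical.epsilon_spec (exists_spec hM)

theorem Spec.eq_val (hM : M.IsModel D.theory) {Z : M.Str} (h : S.Spec D M x V Z) :
    Z = S.val D M x V :=
  have := RecData.isFin hM
  h.unique (spec_val hM)

variable (D) in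
/-- The bound on the value of a step. -/
def bound : Step k n → NumTerm L2A k n
  | .comp _ _ s => s
  | .recur i j => .pair (.pair (.len (.var i)) (.len (.var i)))
      (D.t.subst ![.len (.var i), .len (.var j)] Fin.elim0)

theorem Spec.len_le {Z : M.Str} (h : S.Spec D M x V Z) :
    M.le (M.len Z) ((S.bound D).eval M x V) := by
  cases S with
  | comp φ hφ s => exact h.1
  | recur i j =>
    have := h.1
    simpa [bound, RecData.eval_subst_t, RecData.bound] using this

open Formula NumTerm in
variable (D) in
/-- The graph of a step; the value is the string variable `0`. -/
def graph : Step k n → Formula L2A k (n + 1)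
  | .comp φ _ s => .and (.le (.len (.var 0)) s.shiftS)
      (allLT s.shiftS (iff (.mem (.var 0) (.var 0)) (φ.rename id Fin.succ)))
  | .recur i j => .and (.le (.len (.var 0)) ((Step.recur i j).bound D).shiftS) (.and
      ((recFormula D.φInit D.φNext D.t).subst (fun _ => .len (.var i.succ)) ![.var 0, .var j.succ])
      (allLT (.len (.var 0)) (imp (.mem (.var 0) (.var 0)) (exLT (.len (.var i.succ))
        (exLE (.len (.var i.succ)) (exLE (.var 2)
          (eqN (.var 3) (pair (pair (.var 2) (.var 1)) (.var 0)))))))))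

theorem isSigma0B_graph : (S.graph D).IsSigma0B := by
  cases S with
  | comp φ h s => exact .and (.le _ _) (.allLT _ (.iff (.mem _ _) (h.rename _ _)))
  | recur i j =>
    exact .and (.le _ _) (.and (RecData.isSigma0B_recFormula.subst _ _) (.allLT _
      (.imp (.mem _ _) (.exLT _ (.exLE _ (.exLE _ (.eqN _ _)))))))

theorem realize_graph [M.IsFin] {Z : M.Str} :
    (S.graph D).Realize M x (Fin.cons Z V) ↔ S.Spec D M x V Z := by
  cases S with
  | comp φ h s => simp [graph, Spec, Formula.realize_rename]
  | recur i j =>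
    simp only [graph, Spec, RecData.RecGraph, Formula.realize_and, Formula.realize_le,
      NumTerm.eval_shiftS, Formula.realize_allLT, Formula.realize_imp, Formula.realize_exLT,
      Formula.realize_exLE]
    refine and_congr ?_ (and_congr ?_ ?_)
    · simp [bound, RecData.eval_subst_t, RecData.bound]
    · rw [Formula.realize_subst (W := ![Z, V j]) ?_ (.inl M.isBasic.ext), ← RecData.realize_recFormula]
      · refine iff_of_eq ?_
        congr 1
        funext i
        fin_cases i <;> simp
      · intro j
        fin_cases j
        · simp [StrArg.Denotes]
        · simp [StrArg.Denotes]
    · constructor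
      · intro hh z hz
        exact hh z (Structure.lt_len_of_mem hz) hz
      · exact fun hh z _ hz => hh z hz

/-- The step with terms substituted for the number variables and with the string variables
renamed. -/
def subst {k' n' : ℕ} (ν : Fin k → NumTerm L2A k' n') (τ : Fin n → Fin n') :
    Step k n → Step k' n'
  | .comp φ h s => .comp (φ.subst (Fin.cons (.var 0) fun i => (ν i).shiftN) fun j => .var (τ j))
      (h.subst _ _) (s.subst ν fun j => .var (τ j))
  | .recur i j => .recur (τ i) (τ j)

theorem spec_subst {k' n' : ℕ} (ν : Fin k → NumTerm L2A k' n') (τ : Fin n → Fin n')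
    {x : Fin k' → M.Num} {V : Fin n' → M.Str} {Z : M.Str} :
    (S.subst ν τ).Spec D M x V Z ↔
      S.Spec D M (fun i => (ν i).eval M x V) (fun j => V (τ j)) Z := by
  cases S with
  | comp φ h s =>
    have hd : ∀ {m : ℕ} (v : Fin m → M.Num) (j : Fin n),
        (StrArg.var (τ j)).Denotes M v V (V (τ j)) := fun v j => by simp [StrArg.Denotes]
    simp only [subst, Spec]
    rw [NumTerm.eval_subst (W := fun j => V (τ j)) fun j => hd x j]
    refine and_congr Iff.rfl (forall_congr' fun z => imp_congr Iff.rfl (iff_congr Iff.rfl ?_))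
    rw [Formula.realize_subst (W := fun j => V (τ j)) (fun j => hd _ j) (.inr fun j => ⟨_, rfl⟩)]
    refine iff_of_eq ?_
    congr 1
    funext i
    refine Fin.cases ?_ (fun i => ?_) i <;> simp
  | recur i j => exact Iff.rfl

theorem val_subst {k' n' : ℕ} (ν : Fin k → NumTerm L2A k' n') (τ : Fin n → Fin n')
    {x : Fin k' → M.Num} {V : Fin n' → M.Str} :
    (S.subst ν τ).val D M x V = S.val D M (fun i => (ν i).eval M x V) (fun j => V (τ j)) := by
  simp only [val, spec_subst]

end Step

namespace Prog
variable {k l n : ℕ} (D : RecData)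

/-- The strings computed by a program. -/
noncomputable def val (M : Structure L2A) (x : Fin k → M.Num) (X : Fin l → M.Str) :
    {n : ℕ} → Prog k l n → Fin n → M.Str
  | _, .nil => X
  | _, .snoc P S => Fin.cons (S.val D M x (P.val M x X)) (P.val M x X)

variable {D}

/-- A program `Q` can be run after a program `P`, with number inputs given by terms and with string
inputs chosen among the strings computed by `P`. -/
theorem exists_run {k' l' n' : ℕ} (P : Prog k l n) (Q : Prog k' l' n')
    (ν : Fin k' → NumTerm L2A k n) (τ : Fin l' → Fin n) :
    ∃ (N : ℕ) (R : Prog k l N) (ε : Fin n → Fin N) (ι : Fin n' → Fin N),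
      ∀ (M : Structure L2A) (x : Fin k → M.Num) (X : Fin l → M.Str),
        (∀ j, R.val D M x X (ε j) = P.val D M x X j) ∧
        ∀ j, R.val D M x X (ι j) = Q.val D M (fun i => (ν i).eval M x (P.val D M x X))
          (fun j => P.val D M x X (τ j)) j := by
  induction Q with
  | nil => exact ⟨n, P, id, τ, fun M x X => ⟨fun _ => rfl, fun _ => rfl⟩⟩
  | snoc Q S ih =>
    obtain ⟨N, R, ε, ι, h⟩ := ih
    -- The terms `ν` speak of strings of `P`, found in `R` through `ε`; the step itself speaks of
    -- strings of `Q`, found through `ι`.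
    refine ⟨N + 1, R.snoc (S.subst (fun i => (ν i).rename id ε) ι), Fin.succ ∘ ε,
      Fin.cons 0 (Fin.succ ∘ ι), fun M x X => ⟨fun j => ?_, fun j => ?_⟩⟩
    · simpa [val] using (h M x X).1 j
    · refine Fin.cases ?_ (fun j => ?_) j
      · simp only [val, Fin.cons_zero, Step.val_subst, NumTerm.eval_rename, id_eq, (h M x X).1,
          (h M x X).2]
      · simpa [val] using (h M x X).2 j

end Prog

/-! ## Definability of the functions computed by programs -/

namespace Formula
variable {m n : ℕ}

/-- `Σ^B_1` is a syntactic class of prenex formulas, so a conjunct has to be moved behind the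
quantifier block. -/
theorem IsSigma1B.and_sigma0B {φ : Formula L2A m n} (h : φ.IsSigma1B) :
    ∀ {ψ : Formula L2A m n}, ψ.IsSigma0B → ∃ χ : Formula L2A m n, χ.IsSigma1B ∧
      ∀ (M : Structure L2A) v V, χ.Realize M v V ↔ ψ.Realize M v V ∧ φ.Realize M v V := by
  induction h with
  | base h => exact fun h' => ⟨_, .base (.and h' h), fun M v V => Iff.rfl⟩
  | exSLE t _ ih =>
    intro ψ hψ
    obtain ⟨χ, hχ, h⟩ := ih (hψ.rename id Fin.succ)
    refine ⟨_, .exSLE t hχ, fun M v V => ?_⟩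
    simp only [realize_exSLE, h, realize_rename, Fin.cons_succ, id_eq]
    constructor
    · rintro ⟨X, h1, h2, h3⟩
      exact ⟨h2, X, h1, h3⟩
    · rintro ⟨h2, X, h1, h3⟩
      exact ⟨X, h1, h2, h3⟩

theorem IsSigma11.and_sigma0B {φ : Formula L2A m n} (h : φ.IsSigma11) :
    ∀ {ψ : Formula L2A m n}, ψ.IsSigma0B → ∃ χ : Formula L2A m n, χ.IsSigma11 ∧
      ∀ (M : Structure L2A) v V, χ.Realize M v V ↔ ψ.Realize M v V ∧ φ.Realize M v V := by
  induction h with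
  | base h => exact fun h' => ⟨_, .base (.and h' h), fun M v V => Iff.rfl⟩
  | exS _ ih =>
    intro ψ hψ
    obtain ⟨χ, hχ, h⟩ := ih (hψ.rename id Fin.succ)
    refine ⟨_, .exS hχ, fun M v V => ?_⟩
    simp only [realize_exS, h, realize_rename, Fin.cons_succ, id_eq]
    exact exists_and_left

/-- A `Σ^B_1` formula need not literally be `Σ¹₁`: the bounds `|X| ≤ t` stand between the string
quantifiers and must be moved into the matrix. -/
theorem IsSigma1B.exists_sigma11 {φ : Formula L2A m n} (h : φ.IsSigma1B) :
    ∃ χ : Formula L2A m n, χ.IsSigma11 ∧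
      ∀ (M : Structure L2A) v V, χ.Realize M v V ↔ φ.Realize M v V := by
  induction h with
  | base h => exact ⟨_, .base h, fun M v V => Iff.rfl⟩
  | exSLE t _ ih =>
    obtain ⟨χ, hχ, h⟩ := ih
    obtain ⟨χ', hχ', h'⟩ := hχ.and_sigma0B (.le (.len (.var 0)) t.shiftS)
    refine ⟨_, .exS hχ', fun M v V => ?_⟩
    simp [h, h']

end Formula

theorem NumDefinable.sigma11 {T : Set Sentence} {k l : ℕ} {f : NumFun k l}
    (h : NumDefinable T Formula.IsSigma1B f) : NumDefinable T Formula.IsSigma11 f := by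
  obtain ⟨φ, hφ, hf, hT⟩ := h
  obtain ⟨χ, hχ, h⟩ := hφ.exists_sigma11
  refine ⟨χ, hχ, fun y x X => (hf y x X).trans (h _ _ _).symm, fun M hM => ?_⟩
  have := hT M hM
  simp only [Formula.satisfies_close, Formula.realize_exUniqueN, h] at this ⊢
  exact this

theorem StrDefinable.sigma11 {T : Set Sentence} {k l : ℕ} {G : StrFun k l}
    (h : StrDefinable T Formula.IsSigma1B G) : StrDefinable T Formula.IsSigma11 G := by
  obtain ⟨φ, hφ, hf, hT⟩ := h
  obtain ⟨χ, hχ, h⟩ := hφ.exists_sigma11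
  refine ⟨χ, hχ, fun y x X => (hf y x X).trans (h _ _ _).symm, fun M hM => ?_⟩
  have := hT M hM
  simp only [Formula.satisfies_close, Formula.realize_exUniqueS, h] at this ⊢
  exact this

namespace Prog
variable {k l n : ℕ} {D : RecData}

/-- A statement on the strings computed by a program is equivalent to a `Σ^B_1` formula. -/
theorem exists_wrap (P : Prog k l n) : ∀ {ψ : Formula L2A k n}, ψ.IsSigma1B →
    ∃ χ : Formula L2A k l, χ.IsSigma1B ∧ ∀ (M : Structure L2A) x X, M.IsModel D.theory →
      (χ.Realize M x X ↔ ψ.Realize M x (P.val D M x X)) := by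
  induction P with
  | nil => exact fun {ψ} h => ⟨ψ, h, fun M x X _ => Iff.rfl⟩
  | snoc P S ih =>
    intro ψ hψ
    -- The last string is replaced by a bounded quantifier over strings satisfying the graph of the
    -- step. Since the value exists, is unique and obeys the bound in every model, this does not
    -- change the meaning.
    obtain ⟨χ, hχ, h⟩ := hψ.and_sigma0B (Step.isSigma0B_graph (S := S) (D := D))
    obtain ⟨χ', hχ', h'⟩ := ih (.exSLE (S.bound D) hχ)
    refine ⟨χ', hχ', fun M x X hM => ?_⟩
    have := RecData.isFin hM
    rw [h' M x X hM]
    simp only [Formula.realize_exSLE, h, Step.realize_graph, val]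
    constructor
    · rintro ⟨Z, -, hZ, h⟩
      rwa [← hZ.eq_val hM]
    · exact fun h => ⟨_, (Step.spec_val hM).len_le, Step.spec_val hM, h⟩

end Prog

end TwoSorted

namespace TwoSorted

/-! ## The standard model -/

/-- The pairing function on the natural numbers. -/
def npair (x y : ℕ) : ℕ := (x + y) * (x + y + 1) + 2 * y

theorem strLen_le_iff {X : Finset ℕ} {a : ℕ} : strLen X ≤ a ↔ ∀ z ∈ X, z < a := by
  simp [strLen, Finset.sup_le_iff]

theorem lt_strLen_of_mem {X : Finset ℕ} {z : ℕ} (h : z ∈ X) : z < strLen X :=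
  strLen_le_iff.1 le_rfl z h

@[simp] theorem strLen_range (n : ℕ) : strLen (Finset.range n) = n := by
  refine le_antisymm (strLen_le_iff.2 fun z hz => Finset.mem_range.1 hz) ?_
  rcases n with - | n
  · exact zero_le
  · exact lt_strLen_of_mem (Finset.self_mem_range_succ n)

theorem mem_of_succ_eq_strLen {X : Finset ℕ} {z : ℕ} (h : z + 1 = strLen X) : z ∈ X := by
  by_contra hz
  have : strLen X ≤ z := strLen_le_iff.2 fun w hw => by
    have h1 := lt_strLen_of_mem hw
    rcases Nat.lt_or_ge w z with h2 | h2
    · exact h2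
    · exact absurd (show w = z by omega) (fun e => hz (e ▸ hw))
  omega

theorem isBasic_N2 : N2.IsBasic where
  add_one_ne_zero x := Nat.succ_ne_zero x
  add_one_inj x y h := Nat.succ_injective h
  add_zero _ := rfl
  add_succ _ _ := rfl
  mul_zero _ := rfl
  mul_succ _ _ := rfl
  le_antisymm _ _ := Nat.le_antisymm
  zero_le := Nat.zero_le
  le_trans _ _ _ := Nat.le_trans
  le_total := Nat.le_total
  le_iff_lt_succ x y := by
    have : ∀ x y : ℕ, x ≤ y ↔ x ≤ y + 1 ∧ x ≠ y + 1 := by omega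
    exact this x y
  exists_pred x h := by
    obtain ⟨y, rfl⟩ := Nat.exists_eq_succ_of_ne_zero h
    exact ⟨y, ⟨Nat.le_succ y, Nat.ne_of_lt (Nat.lt_succ_self y)⟩, rfl⟩
  lt_len_of_mem x X h := ⟨(lt_strLen_of_mem h).le, (lt_strLen_of_mem h).ne⟩
  mem_of_succ_eq_len x X h := mem_of_succ_eq_strLen h
  ext X Y := by
    constructor
    · rintro rfl
      exact ⟨rfl, fun _ _ => Iff.rfl⟩
    · rintro ⟨h, h'⟩
      have h : strLen X = strLen Y := h
      refine Finset.ext fun z => ?_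
      by_cases hz : z < strLen X
      · exact h' z ⟨hz.le, hz.ne⟩
      · exact iff_of_false (fun hm => hz (lt_strLen_of_mem hm))
          fun hm => hz (h ▸ lt_strLen_of_mem hm)

theorem N2_lt_iff {x y : ℕ} : N2.lt x y ↔ x < y := lt_iff_le_and_ne.symm

open Classical in
/-- The finite set of the numbers below `a` with the property `p`. -/
noncomputable def cut (a : ℕ) (p : ℕ → Prop) : Finset ℕ := (Finset.range a).filter p

@[simp] theorem mem_cut {a z : ℕ} {p : ℕ → Prop} : z ∈ cut a p ↔ z < a ∧ p z := by
  simp [cut]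

theorem strLen_cut_le (a : ℕ) (p : ℕ → Prop) : strLen (cut a p) ≤ a :=
  strLen_le_iff.2 fun _ hz => (mem_cut.1 hz).1

theorem isModel_V0_N2 : N2.IsModel V0 := by
  rintro φ (h | ⟨m, n, φ, -, rfl⟩)
  · exact N2.isModel_basicAxioms_iff.2 isBasic_N2 φ h
  · rw [satisfies_comprehension]
    intro v V
    refine ⟨cut (v 0) fun z => φ.Realize N2 (Fin.cons z v) V, strLen_cut_le _ _, fun z hz => ?_⟩
    exact mem_cut.trans (and_iff_right (N2_lt_iff.1 hz))

instance : N2.IsFin := isModel_V0_N2.isFin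

theorem npair_inj {x y x' y' : ℕ} : npair x y = npair x' y' ↔ x = x' ∧ y = y' :=
  Structure.pair_inj (M := N2)
theorem left_le_npair (x y : ℕ) : x ≤ npair x y := Structure.left_le_pair (M := N2) x y
theorem right_le_npair (x y : ℕ) : y ≤ npair x y := Structure.right_le_pair (M := N2) x y
theorem npair_mono {x y x' y' : ℕ} (h : x ≤ x') (h' : y ≤ y') : npair x y ≤ npair x' y' :=
  Structure.pair_mono (M := N2) h h'
theorem npair_lt_npair {x y x' y' : ℕ} (h : x ≤ x') (h' : y < y') : npair x y < npair x' y' :=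
  N2_lt_iff.1 (Structure.pair_lt_of_add_lt (M := N2) (N2_lt_iff.2 (Nat.add_lt_add_of_le_of_lt h h')))
theorem npair_lt_npair' {x y x' y' : ℕ} (h : x < x') (h' : y ≤ y') : npair x y < npair x' y' :=
  N2_lt_iff.1 (Structure.pair_lt_of_add_lt (M := N2) (N2_lt_iff.2 (Nat.add_lt_add_of_lt_of_le h h')))
@[simp] theorem N2_pair (x y : ℕ) : N2.pair x y = npair x y := rfl

/-- The row `X^{[r]}` of a finite set. -/
noncomputable def nrow (X : Finset ℕ) (r : ℕ) : Finset ℕ := cut (strLen X) fun z => npair r z ∈ X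

@[simp] theorem mem_nrow {X : Finset ℕ} {r z : ℕ} : z ∈ nrow X r ↔ npair r z ∈ X := by
  simp only [nrow, mem_cut, and_iff_right_iff_imp]
  exact fun h => (right_le_npair r z).trans_lt (lt_strLen_of_mem h)

theorem N2_row (X : Finset ℕ) (r : ℕ) : N2.row X r = nrow X r :=
  Structure.row_eq (M := N2) fun z => by exact mem_nrow

theorem strLen_nrow_le (X : Finset ℕ) (r : ℕ) : strLen (nrow X r) ≤ strLen X :=
  strLen_cut_le _ _

theorem NumTerm.eval_mono_N2 {m n : ℕ} (t : NumTerm L2A m n) {v v' : Fin m → ℕ}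
    {V V' : Fin n → Finset ℕ} (hv : ∀ i, v i ≤ v' i) (hV : ∀ j, strLen (V j) ≤ strLen (V' j)) :
    t.eval N2 v V ≤ t.eval N2 v' V' := NumTerm.eval_mono (M := N2) t hv hV

namespace RecData
variable (D : RecData)

/-- The function defined by the recursion. -/
noncomputable abbrev fn : ℕ → Finset ℕ → Finset ℕ := boundedRec D.φInit D.φNext D.t

variable {D}

theorem mem_fn_zero {X : Finset ℕ} {w : ℕ} : w ∈ D.fn 0 X ↔
    w < D.bd N2 0 (strLen X) ∧ D.φInit.Realize N2 ![w] ![X] := by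
  simp only [boundedRec, Finset.mem_filter, Finset.mem_range]
  rfl

theorem mem_fn_succ {X : Finset ℕ} {w x : ℕ} : w ∈ D.fn (x + 1) X ↔
    w < D.bd N2 (x + 1) (strLen X) ∧ D.φNext.Realize N2 ![w, x] ![X, D.fn x X] := by
  simp only [boundedRec, Finset.mem_filter, Finset.mem_range]
  rfl

theorem bd_mono {x x' l l' : ℕ} (h : x ≤ x') (h' : l ≤ l') : D.bd N2 x l ≤ D.bd N2 x' l' := by
  refine NumTerm.eval_mono_N2 D.t (fun i => ?_) fun j => j.elim0
  fin_cases i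
  · exact h
  · exact h'

theorem lt_bd_of_mem_fn {X : Finset ℕ} {w x : ℕ} (h : w ∈ D.fn x X) :
    w < D.bd N2 x (strLen X) := by
  cases x with
  | zero => exact (mem_fn_zero.1 h).1
  | succ x => exact (mem_fn_succ.1 h).1

variable (D) in
/-- The set of the numbers `⟨⟨y, x⟩, w⟩` with `y < b`, `x ≤ a` and `w ∈ F(x, X^{[y]})`. -/
noncomputable def rows (b a : ℕ) (X : Finset ℕ) : Finset ℕ :=
  cut (D.bound N2 b a X) fun z =>
    ∃ y < b, ∃ x ≤ a, ∃ w ∈ D.fn x (nrow X y), z = npair (npair y x) w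

/-- The cut loses nothing: `w < t(x, |X^{[y]}|) ≤ t(a, |X|)` by monotonicity of `t`. -/
theorem mem_rows {b a : ℕ} {X : Finset ℕ} {z : ℕ} : z ∈ D.rows b a X ↔
    ∃ y < b, ∃ x ≤ a, ∃ w ∈ D.fn x (nrow X y), z = npair (npair y x) w := by
  rw [rows, mem_cut, and_iff_right_iff_imp]
  rintro ⟨y, hy, x, hx, w, hw, rfl⟩
  exact npair_lt_npair (npair_mono hy.le hx)
    ((lt_bd_of_mem_fn hw).trans_le (bd_mono hx (strLen_nrow_le _ _)))

theorem mem_rows_pair {b a : ℕ} {X : Finset ℕ} {y x w : ℕ} :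
    npair (npair y x) w ∈ D.rows b a X ↔ y < b ∧ x ≤ a ∧ w ∈ D.fn x (nrow X y) := by
  rw [mem_rows]
  constructor
  · rintro ⟨y', hy, x', hx, w', hw, h⟩
    obtain ⟨h', rfl⟩ := npair_inj.1 h
    obtain ⟨rfl, rfl⟩ := npair_inj.1 h'
    exact ⟨hy, hx, hw⟩
  · rintro ⟨hy, hx, hw⟩
    exact ⟨y, hy, x, hx, w, hw, rfl⟩

theorem strLen_rows_le (b a : ℕ) (X : Finset ℕ) : strLen (D.rows b a X) ≤ D.bound N2 b a X :=
  strLen_cut_le _ _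

theorem recSpec_rows (b a : ℕ) (X : Finset ℕ) : D.RecSpec N2 b a X (D.rows b a X) := by
  intro y hy
  replace hy := N2_lt_iff.1 hy
  refine ⟨fun z _ => ?_, fun x hx z _ => ?_⟩
  · rw [N2_row, N2_lt_iff]
    refine (mem_rows_pair (y := y) (x := 0) (w := z)).trans ?_
    rw [mem_fn_zero]
    exact ⟨fun h => h.2.2, fun h => ⟨hy, Nat.zero_le _, h⟩⟩
  · replace hx := N2_lt_iff.1 hx
    have hr : nrow (D.rows b a X) (npair y x) = D.fn x (nrow X y) := by
      ext w
      rw [mem_nrow, mem_rows_pair]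
      exact ⟨fun h => h.2.2, fun h => ⟨hy, hx.le, h⟩⟩
    rw [N2_row, N2_row, N2_lt_iff]
    refine (mem_rows_pair (y := y) (x := x + 1) (w := z)).trans ?_
    rw [mem_fn_succ, N2_pair, hr]
    exact ⟨fun h => h.2.2, fun h => ⟨hy, hx, h⟩⟩

theorem recGraph_rows (b a : ℕ) (X : Finset ℕ) : D.RecGraph N2 b a X (D.rows b a X) := by
  refine ⟨strLen_rows_le b a X, recSpec_rows b a X, fun z hz => ?_⟩
  obtain ⟨y, hy, x, hx, w, -, rfl⟩ := mem_rows.1 hz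
  exact ⟨y, N2_lt_iff.2 hy, x, hx, w, right_le_npair _ _, rfl⟩

variable (D) in
-- Soundness of the theory; it also identifies the values of steps in `N2` with the concrete finite
-- sets `cut` and `rows`.
theorem isModel_N2 : N2.IsModel D.theory := by
  rintro φ (h | rfl)
  · exact isModel_V0_N2 φ h
  · exact satisfies_recAxiom.2 fun a b X => ⟨_, strLen_rows_le b a X, recSpec_rows b a X⟩

end RecData

variable {D : RecData} {k l n : ℕ}

theorem Step.val_comp {φ : Formula L2A (k + 1) n} (h : φ.IsSigma0B) (s : NumTerm L2A k n)
    (x : Fin k → ℕ) (V : Fin n → Finset ℕ) :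
    (Step.comp φ h s).val D N2 x V =
      cut (s.eval N2 x V) fun z => φ.Realize N2 (Fin.cons z x) V :=
  (Step.Spec.eq_val D.isModel_N2 (S := .comp φ h s) (x := x) (V := V)
    ⟨strLen_cut_le _ _, fun _ hz => mem_cut.trans (and_iff_right (N2_lt_iff.1 hz))⟩).symm

theorem Step.val_recur (i j : Fin n) (x : Fin k → ℕ) (V : Fin n → Finset ℕ) :
    (Step.recur i j : Step k n).val D N2 x V = D.rows (strLen (V i)) (strLen (V i)) (V j) := by
  have h : (Step.recur i j : Step k n).Spec D N2 x V
      (D.rows (strLen (V i)) (strLen (V i)) (V j)) :=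
    RecData.recGraph_rows (strLen (V i)) (strLen (V i)) (V j)
  exact (h.eq_val D.isModel_N2).symm

/-- The string functions computed by straight-line programs. -/
def RecData.PF (D : RecData) (k l : ℕ) : Set (StrFun k l) :=
  {G | ∃ (n : ℕ) (P : Prog k l n) (j : Fin n), ∀ x X, G x X = P.val D N2 x X j}

/-- The number functions computed by straight-line programs, in unary. -/
def RecData.PFnum (D : RecData) (k l : ℕ) : Set (NumFun k l) :=
  {f | (fun x X => Finset.range (f x X)) ∈ D.PF k l}

/-- In every model the graph is the statement that `Y` equals a value of the program. Unique
existence is then immediate, since the value is a definite string of the model. -/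
theorem RecData.strDefinable_of_mem_PF {G : StrFun k l} (h : G ∈ D.PF k l) :
    StrDefinable D.theory Formula.IsSigma1B G := by
  obtain ⟨n, P, j, hP⟩ := h
  -- The candidate `Y` is carried along as an additional input string `0`, so that the equation can
  -- be stated about the final strings.
  obtain ⟨N, R, ε, ι, hR⟩ := Prog.exists_run (D := D) (.nil : Prog k (l + 1) (l + 1)) P .var Fin.succ
  obtain ⟨χ, hχ, h⟩ := R.exists_wrap (D := D) (ψ := .eqS (.var (ε 0)) (.var (ι j)))
    (.base (.eqS _ _))
  have key : ∀ (M : Structure L2A), M.IsModel D.theory → ∀ Y x X,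
      χ.Realize M x (Fin.cons Y X) ↔ Y = P.val D M x X j := by
    intro M hM Y x X
    rw [h M _ _ hM]
    simp [(hR M _ _).1, (hR M _ _).2, Prog.val]
  refine ⟨χ, hχ, fun Y x X => ?_, fun M hM => ?_⟩
  · rw [key N2 D.isModel_N2, hP]
  · rw [Formula.satisfies_close]
    intro x X
    simp [Formula.realize_exUniqueS, key M hM]

theorem RecData.numDefinable_of_mem_PFnum {f : NumFun k l} (h : f ∈ D.PFnum k l) :
    NumDefinable D.theory Formula.IsSigma1B f := by
  obtain ⟨n, P, j, hP⟩ := h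
  obtain ⟨N, R, ε, ι, hR⟩ := Prog.exists_run (D := D) (.nil : Prog (k + 1) l l) P
    (fun i => .var i.succ) id
  obtain ⟨χ, hχ, h⟩ := R.exists_wrap (D := D) (ψ := .eqN (.var 0) (.len (.var (ι j))))
    (.base (.eqN _ _))
  have key : ∀ (M : Structure L2A), M.IsModel D.theory → ∀ y x X,
      χ.Realize M (Fin.cons y x) X ↔ y = M.len (P.val D M x X j) := by
    intro M hM Y x X
    rw [h M _ _ hM]
    simp [(hR M _ _).2, Prog.val]
  refine ⟨χ, hχ, fun y x X => ?_, fun M hM => ?_⟩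
  · rw [key N2 D.isModel_N2, ← hP]
    simp
  · rw [Formula.satisfies_close]
    intro x X
    simp [Formula.realize_exUniqueN, key M hM]

end TwoSorted

namespace TwoSorted

/-! ## Closure properties of the functions computed by programs -/

variable {D : RecData} {k l n : ℕ}

theorem Prog.exists_input (P : Prog k l n) : ∃ τ : Fin l → Fin n, ∀ (M : Structure L2A)
    (x : Fin k → M.Num) (X : Fin l → M.Str) j, P.val D M x X (τ j) = X j := by
  induction P with
  | nil => exact ⟨id, fun M x X j => rfl⟩
  | snoc P S ih =>
    obtain ⟨τ, h⟩ := ih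
    exact ⟨Fin.succ ∘ τ, fun M x X j => by simp [val, h]⟩

namespace RecData

theorem proj_mem_PF (j : Fin l) : (fun _ X => X j) ∈ D.PF k l := ⟨l, .nil, j, fun _ _ => rfl⟩

/-- Programs on the same inputs can be concatenated, because the inputs remain available throughout.
-/
theorem exists_joint : ∀ {n : ℕ} (Gs : Fin n → StrFun k l), (∀ j, Gs j ∈ D.PF k l) →
    ∃ (N : ℕ) (P : Prog k l N) (ι : Fin n → Fin N), ∀ x X j, Gs j x X = P.val D N2 x X (ι j)
  | 0, _, _ => ⟨l, .nil, Fin.elim0, fun _ _ j => j.elim0⟩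
  | n + 1, Gs, h => by
    obtain ⟨N, P, ι, hP⟩ := exists_joint (fun j => Gs j.succ) fun j => h _
    obtain ⟨N', Q, i, hQ⟩ := h 0
    obtain ⟨τ, hτ⟩ := P.exists_input (D := D)
    obtain ⟨N'', R, ε, ι', hR⟩ := P.exists_run (D := D) Q .var τ
    refine ⟨N'', R, Fin.cons (ι' i) (ε ∘ ι), fun x X j => ?_⟩
    refine Fin.cases ?_ (fun j => ?_) j
    · simp [hQ, (hR N2 x X).2, hτ]
    · simp [hP, (hR N2 x X).1]

/-- The class is closed under composition. -/
theorem compose_mem_PF {k' l' : ℕ} {G : StrFun k' l'} (hG : G ∈ D.PF k' l')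
    {fs : Fin k' → NumFun k l} (hf : ∀ i, fs i ∈ D.PFnum k l) {Gs : Fin l' → StrFun k l}
    (hGs : ∀ j, Gs j ∈ D.PF k l) :
    (fun x X => G (fun i => fs i x X) fun j => Gs j x X) ∈ D.PF k l := by
  -- Number arguments are computed in unary, as strings `Finset.range (f x X)`, and handed to the
  -- outer program as lengths.
  obtain ⟨N, P, ι, hP⟩ := exists_joint
    (Fin.append (fun i x X => Finset.range (fs i x X)) Gs : Fin (k' + l') → StrFun k l)
    (fun j => by
      refine Fin.addCases (fun i => ?_) (fun i => ?_) j
      · rw [Fin.append_left]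
        exact hf i
      · rw [Fin.append_right]
        exact hGs i)
  obtain ⟨N', Q, i, hQ⟩ := hG
  obtain ⟨N'', R, ε, ι', hR⟩ := P.exists_run (D := D) Q
    (fun i => .len (.var (ι (Fin.castAdd l' i)))) (fun j => ι (Fin.natAdd k' j))
  refine ⟨N'', R, ι' i, fun x X => ?_⟩
  rw [(hR N2 x X).2]
  refine (hQ _ _).trans ?_
  congr 1
  · funext i
    simp [← hP]
  · funext i
    simp [← hP]

theorem step_mem_PF {m : ℕ} (S : Step m n) {fs : Fin m → NumFun k l}
    (hf : ∀ i, fs i ∈ D.PFnum k l) {Gs : Fin n → StrFun k l} (hGs : ∀ j, Gs j ∈ D.PF k l) :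
    (fun x X => S.val D N2 (fun i => fs i x X) fun j => Gs j x X) ∈ D.PF k l :=
  compose_mem_PF (G := fun x X => S.val D N2 x X) ⟨_, Prog.nil.snoc S, 0, fun _ _ => rfl⟩ hf hGs

/-- Bounded comprehension in the class. -/
theorem mem_PF_of_formula {m : ℕ} {G : StrFun k l} {φ : Formula L2A (m + 1) n} (hφ : φ.IsSigma0B)
    (s : NumTerm L2A m n) {fs : Fin m → NumFun k l} (hf : ∀ i, fs i ∈ D.PFnum k l)
    {Gs : Fin n → StrFun k l} (hGs : ∀ j, Gs j ∈ D.PF k l)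
    (h : ∀ x X z, z ∈ G x X ↔ z < s.eval N2 (fun i => fs i x X) (fun j => Gs j x X) ∧
      φ.Realize N2 (Fin.cons z fun i => fs i x X) fun j => Gs j x X) : G ∈ D.PF k l := by
  convert step_mem_PF (.comp φ hφ s) hf hGs with x X
  rw [Step.val_comp]
  ext z
  rw [h, mem_cut]

theorem coord_mem_PFnum (i : Fin k) : (fun x _ => x i) ∈ D.PFnum k l :=
  ⟨_, Prog.nil.snoc (.comp .tru .tru (.var i)), 0, fun x X => by
    simp only [Prog.val, Fin.cons_zero, Step.val_comp]
    ext z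
    simp⟩

/-- Terms in functions of the class. -/
theorem eval_mem_PFnum {m : ℕ} (s : NumTerm L2A m n) {fs : Fin m → NumFun k l}
    (hf : ∀ i, fs i ∈ D.PFnum k l) {Gs : Fin n → StrFun k l} (hGs : ∀ j, Gs j ∈ D.PF k l) :
    (fun x X => s.eval N2 (fun i => fs i x X) fun j => Gs j x X) ∈ D.PFnum k l :=
  mem_PF_of_formula .tru s hf hGs fun x X z => by simp

theorem compose_mem_PFnum {k' l' : ℕ} {f : NumFun k' l'} (hG : f ∈ D.PFnum k' l')
    {fs : Fin k' → NumFun k l} (hf : ∀ i, fs i ∈ D.PFnum k l) {Gs : Fin l' → StrFun k l}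
    (hGs : ∀ j, Gs j ∈ D.PF k l) :
    (fun x X => f (fun i => fs i x X) fun j => Gs j x X) ∈ D.PFnum k l :=
  compose_mem_PF hG hf hGs

theorem strLen_mem_PFnum {G : StrFun k l} (hG : G ∈ D.PF k l) :
    (fun x X => strLen (G x X)) ∈ D.PFnum k l :=
  eval_mem_PFnum (.len (.var 0) : NumTerm L2A 0 1) (fs := Fin.elim0) (fun i => i.elim0)
    (Gs := ![G]) (by simpa using hG)

/-- The least number below a term with a bounded property. -/
theorem mem_PFnum_of_least {m : ℕ} {f : NumFun k l} {φ : Formula L2A (m + 1) n} (hφ : φ.IsSigma0B)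
    (s : NumTerm L2A m n) {fs : Fin m → NumFun k l} (hf : ∀ i, fs i ∈ D.PFnum k l)
    {Gs : Fin n → StrFun k l} (hGs : ∀ j, Gs j ∈ D.PF k l)
    (h : ∀ x X z, z < f x X ↔ z < s.eval N2 (fun i => fs i x X) (fun j => Gs j x X) ∧
      ∀ y ≤ z, ¬ φ.Realize N2 (Fin.cons y fun i => fs i x X) fun j => Gs j x X) :
    f ∈ D.PFnum k l := by
  -- In unary the minimum is the set of numbers below it: those below the bound with no witness up
  -- to and including themselves. So comprehension computes it outright.
  refine mem_PF_of_formula (φ := (Formula.not φ).allBelow) hφ.not.allBelow s hf hGs fun x X z => ?_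
  rw [Formula.realize_allBelow, Finset.mem_range, h]
  rfl

theorem rows_self_mem_PF {f : NumFun k l} (hf : f ∈ D.PFnum k l) {G : StrFun k l}
    (hG : G ∈ D.PF k l) : (fun x X => D.rows (f x X) (f x X) (G x X)) ∈ D.PF k l := by
  convert step_mem_PF (.recur 0 1 : Step 0 2) (fs := Fin.elim0) (fun i => i.elim0)
    (Gs := ![fun x X => Finset.range (f x X), G]) ?_ with x X
  · rw [Step.val_recur]
    simp
  · intro j
    fin_cases j
    · exact hf
    · exact hG

-- A recursion step uses one number for both parameters. The run with `f + g` contains all the rows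
-- wanted, and comprehension deletes the surplus.
open Formula NumTerm in
theorem rows_mem_PF {f g : NumFun k l} (hf : f ∈ D.PFnum k l) (hg : g ∈ D.PFnum k l)
    {G : StrFun k l} (hG : G ∈ D.PF k l) :
    (fun x X => D.rows (f x X) (g x X) (G x X)) ∈ D.PF k l := by
  have hfg : (fun x X => f x X + g x X) ∈ D.PFnum k l :=
    eval_mem_PFnum (.add (.var 0) (.var 1) : NumTerm L2A 2 0) (fs := ![f, g])
      (fun i => by fin_cases i; exacts [hf, hg]) (Gs := Fin.elim0) fun j => j.elim0
  refine mem_PF_of_formula (φ := .and (.mem (.var 0) (.var 0)) (exLT (.var 1) (exLE (.var 3)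
    (exLE (.var 2) (eqN (.var 3) (pair (pair (.var 2) (.var 1)) (.var 0)))))))
    (.and (.mem _ _) (.exLT _ (.exLE _ (.exLE _ (.eqN _ _))))) (.len (.var 0))
    (fs := ![f, g]) (fun i => by fin_cases i; exacts [hf, hg])
    (Gs := ![fun x X => D.rows (f x X + g x X) (f x X + g x X) (G x X)])
    (fun j => by fin_cases j; exact rows_self_mem_PF hfg hG) fun x X z => ?_
  simp only [realize_and, realize_exLT, realize_exLE]
  constructor
  · intro hz
    obtain ⟨y, hy, u, hu, w, hw, rfl⟩ := mem_rows.1 hz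
    have h1 : npair (npair y u) w ∈ D.rows (f x X + g x X) (f x X + g x X) (G x X) :=
      mem_rows_pair.2 ⟨hy.trans_le (Nat.le_add_right _ _), hu.trans (Nat.le_add_left _ _), hw⟩
    exact ⟨lt_strLen_of_mem h1, h1, y, N2_lt_iff.2 hy, u, hu, w, right_le_npair _ _, rfl⟩
  · rintro ⟨-, h1, y, hy, u, hu, w, hw, h⟩
    replace h : z = npair (npair y u) w := h
    subst h
    exact mem_rows_pair.2 ⟨N2_lt_iff.1 hy, hu, (mem_rows_pair.1 h1).2.2⟩

end RecData

/-- Bounded formulas are closed under replacing all strings by their rows. -/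
theorem Formula.IsSigma0B.exists_rows {m : ℕ} {φ : Formula L2A m n} (h : φ.IsSigma0B)
    (r : Fin m) : ∃ ψ : Formula L2A m n, ψ.IsSigma0B ∧ ∀ v V, ψ.Realize N2 v V ↔
      φ.Realize N2 v fun j => nrow (V j) (v r) := by
  -- The strings are replaced one at a time; `p` counts those already replaced. Each replacement
  -- costs one bounded quantifier for the length of the row.
  have key : ∀ p : ℕ, ∃ ψ : Formula L2A m n, ψ.IsSigma0B ∧ ∀ v V, ψ.Realize N2 v V ↔
      φ.Realize N2 v fun j => if j.val < p then nrow (V j) (v r) else V j := by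
    intro p
    induction p with
    | zero => exact ⟨φ, h, fun v V => by simp⟩
    | succ p ih =>
      obtain ⟨ψ, hψ, hv⟩ := ih
      by_cases hp : p < n
      · refine ⟨.exLE (.len (.var ⟨p, hp⟩)) (.and (rowLength (.var 0) (.var r.succ) ⟨p, hp⟩)
          (ψ.subst (fun i => .var i.succ) fun j => if j = ⟨p, hp⟩ then
            .row (.var 0) (.var r.succ) ⟨p, hp⟩ else .var j)),
          .exLE _ (.and (isSigma0B_rowLength _ _ _) (hψ.subst _ _)), fun v V => ?_⟩
        simp only [realize_exLE, realize_and, Structure.realize_rowLength, NumTerm.eval_var,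
          Fin.cons_zero, Fin.cons_succ, N2_row]
        have e : ∀ ℓ, ℓ = strLen (nrow (V ⟨p, hp⟩) (v r)) →
            ((ψ.subst (fun i => .var i.succ) fun j => if j = ⟨p, hp⟩ then
              .row (.var 0) (.var r.succ) ⟨p, hp⟩ else .var j).Realize N2
                (Fin.cons ℓ v : Fin (m + 1) → ℕ) V ↔
            φ.Realize N2 v fun j => if j.val < p + 1 then nrow (V j) (v r) else V j) := by
          rintro ℓ rfl
          rw [realize_subst (W := fun j => if j = ⟨p, hp⟩ then nrow (V j) (v r) else V j) ?_
            (.inl isBasic_N2.ext)]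
          · simp only [NumTerm.eval_var, Fin.cons_succ, hv]
            refine iff_of_eq ?_
            congr 1
            funext j
            have : j = ⟨p, hp⟩ ↔ j.val = p := Fin.ext_iff
            simp only [this]
            split_ifs <;> first | rfl | omega
          · intro j
            by_cases hj : j = ⟨p, hp⟩
            · subst hj
              simp only [if_true]
              exact ⟨rfl, fun z => mem_nrow⟩
            · simp [hj, StrArg.Denotes]
        constructor
        · rintro ⟨ℓ, -, hℓ, h⟩
          exact (e ℓ hℓ).1 h
        · exact fun h => ⟨_, strLen_nrow_le _ _, rfl, (e _ rfl).2 h⟩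
      · refine ⟨ψ, hψ, fun v V => (hv v V).trans (iff_of_eq ?_)⟩
        congr 1
        funext j
        rw [if_pos (by omega), if_pos (by omega)]
  obtain ⟨ψ, hψ, hv⟩ := key n
  exact ⟨ψ, hψ, fun v V => by simpa using hv v V⟩

/-- The string `{⟨z, w⟩ : z < x₀, w ∈ G(z, x₁, …)}` that collects the values of `G` for all first
arguments below `x₀`. -/
noncomputable def collect (G : StrFun (k + 1) l) : StrFun (k + 1) l := fun x X =>
  (Finset.range (x 0)).biUnion fun z => (G (Fin.cons z (Fin.tail x)) X).image (npair z)

theorem mem_collect {G : StrFun (k + 1) l} {x : Fin (k + 1) → ℕ} {X : Fin l → Finset ℕ} {u : ℕ} :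
    u ∈ collect G x X ↔ ∃ z < x 0, ∃ w ∈ G (Fin.cons z (Fin.tail x)) X, u = npair z w := by
  simp [collect, eq_comm]

theorem mem_collect_pair {G : StrFun (k + 1) l} {x : Fin (k + 1) → ℕ} {X : Fin l → Finset ℕ}
    {z w : ℕ} : npair z w ∈ collect G x X ↔ z < x 0 ∧ w ∈ G (Fin.cons z (Fin.tail x)) X := by
  rw [mem_collect]
  constructor
  · rintro ⟨z', hz, w', hw, h⟩
    obtain ⟨rfl, rfl⟩ := npair_inj.1 h
    exact ⟨hz, hw⟩
  · rintro ⟨hz, hw⟩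
    exact ⟨z, hz, w, hw, rfl⟩

theorem nrow_collect {G : StrFun (k + 1) l} {x : Fin (k + 1) → ℕ} {X : Fin l → Finset ℕ}
    {z : ℕ} (hz : z < x 0) : nrow (collect G x X) z = G (Fin.cons z (Fin.tail x)) X := by
  ext w
  simp [mem_collect_pair, hz]

namespace RecData

-- The point is that the strings `Gs` are evaluated at the full input and not at `z`: if the bits of
-- `G` at `z` can be read from them and from the number `z`, one comprehension over the pairs `⟨z,
-- w⟩` collects all values.
open Formula NumTerm in
theorem collect_mem_PF_of_formula {G : StrFun (k + 1) l} {ψ : Formula L2A (k + 2) n}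
    (hψ : ψ.IsSigma0B) (s : NumTerm L2A (k + 1) n) {Gs : Fin n → StrFun (k + 1) l}
    (hGs : ∀ j, Gs j ∈ D.PF (k + 1) l)
    (h : ∀ x X z w, z < x 0 → (w ∈ G (Fin.cons z (Fin.tail x)) X ↔
      ψ.Realize N2 (Fin.cons w (Fin.cons z (Fin.tail x) : Fin (k + 1) → ℕ)) fun j => Gs j x X))
    (hs : ∀ x X z w, z < x 0 → w ∈ G (Fin.cons z (Fin.tail x)) X →
      w < s.eval N2 x fun j => Gs j x X) : collect G ∈ D.PF (k + 1) l := by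
  refine mem_PF_of_formula (φ := exLT (.var 1) (exLE (.var 1) (.and
    (eqN (.var 2) (pair (.var 1) (.var 0)))
    (ψ.rename (Fin.cons 0 (Fin.cons 1 fun i => i.succ.succ.succ.succ)) id))))
    (.exLT _ (.exLE _ (.and (.eqN _ _) (hψ.rename _ _)))) (.pair (.var 0) s)
    coord_mem_PFnum hGs fun x X u => ?_
  have e : ∀ w z, (fun i => (Fin.cons w (Fin.cons z (Fin.cons u x : Fin (k + 2) → ℕ) :
      Fin (k + 3) → ℕ) : Fin (k + 4) → ℕ)
      ((Fin.cons 0 (Fin.cons 1 fun i => i.succ.succ.succ.succ : Fin (k + 1) → Fin (k + 4)) :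
        Fin (k + 2) → Fin (k + 4)) i)) =
      (Fin.cons w (Fin.cons z (Fin.tail x) : Fin (k + 1) → ℕ) : Fin (k + 2) → ℕ) := by
    intro w z
    funext i
    refine Fin.cases rfl (fun i => Fin.cases rfl (fun i => ?_) i) i
    simp [Fin.tail]
  simp only [realize_exLT, realize_exLE, realize_and, realize_rename, mem_collect, e]
  constructor
  · rintro ⟨z, hz, w, hw, rfl⟩
    have h1 : npair z w < npair (x 0) (s.eval N2 x fun j => Gs j x X) :=
      npair_lt_npair hz.le (hs x X z w hz hw)
    refine ⟨?_, z, N2_lt_iff.2 hz, w, right_le_npair _ _, rfl, (h x X z w hz).1 hw⟩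
    simpa using h1
  · rintro ⟨-, z, hz, w, -, hu, hw⟩
    exact ⟨z, N2_lt_iff.1 hz, w, (h x X z w (N2_lt_iff.1 hz)).2 hw, hu⟩

-- For each `z` a run of the recursion is wanted, itself with many rows `y`. The pair `⟨z, y⟩` is
-- used as a single row index: `A` regroups `⟨z, ⟨y, w⟩⟩` as `⟨⟨z, y⟩, w⟩`, so that row `⟨z, y⟩` of
-- `A` is row `y` of the string `H` at `z`. One run on `A` then contains all of them, and
-- comprehension extracts the wanted parts.
open Formula NumTerm in
theorem collect_recur_mem_PF {G H : StrFun (k + 1) l} (hG : collect G ∈ D.PF (k + 1) l)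
    (hH : collect H ∈ D.PF (k + 1) l) :
    collect (fun x X => D.rows (strLen (G x X)) (strLen (G x X)) (H x X)) ∈ D.PF (k + 1) l := by
  have hlen : (fun x X => strLen (collect G x X)) ∈ D.PFnum (k + 1) l := strLen_mem_PFnum hG
  obtain ⟨A, hA⟩ : ∃ A : StrFun (k + 1) l, ∀ x X u, u ∈ A x X ↔
      ∃ z y w, npair z (npair y w) ∈ collect H x X ∧ u = npair (npair z y) w := by
    refine ⟨fun x X => cut (npair (npair (strLen (collect H x X)) (strLen (collect H x X)))
      (strLen (collect H x X))) fun u =>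
        ∃ z y w, npair z (npair y w) ∈ collect H x X ∧ u = npair (npair z y) w, fun x X u => ?_⟩
    rw [mem_cut, and_iff_right_iff_imp]
    rintro ⟨z, y, w, h, rfl⟩
    have h1 := lt_strLen_of_mem h
    have h2 := right_le_npair z (npair y w)
    have h3 := right_le_npair y w
    have h4 := left_le_npair y w
    have h5 := left_le_npair z (npair y w)
    exact npair_lt_npair (npair_mono (by omega) (by omega)) (by omega)
  have hAmem : A ∈ D.PF (k + 1) l := by
    refine mem_PF_of_formula (m := 0) (φ := exLE (.var 0) (exLE (.var 1) (exLE (.var 2) (.and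
      (.mem (pair (.var 2) (pair (.var 1) (.var 0))) (.var 0))
      (eqN (.var 3) (pair (pair (.var 2) (.var 1)) (.var 0)))))))
      (.exLE _ (.exLE _ (.exLE _ (.and (.mem _ _) (.eqN _ _)))))
      (.pair (.pair (.len (.var 0)) (.len (.var 0))) (.len (.var 0)))
      (fs := Fin.elim0) (fun i => i.elim0) (Gs := ![collect H]) (by simpa using hH)
      fun x X u => ?_
    simp only [realize_exLE, hA]
    constructor
    · rintro ⟨z, y, w, h, rfl⟩
      have h1 := lt_strLen_of_mem h
      have h2 := right_le_npair z (npair y w)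
      have h3 := right_le_npair y w
      have h4 := left_le_npair y w
      have h5 := left_le_npair z (npair y w)
      have h6 : npair (npair z y) w < npair (npair (strLen (collect H x X))
        (strLen (collect H x X))) (strLen (collect H x X)) :=
        npair_lt_npair (npair_mono (by omega) (by omega)) (by omega)
      have h7 := left_le_npair (npair z y) w
      refine ⟨by simpa using h6, z, (left_le_npair z y).trans h7, y,
        (right_le_npair z y).trans h7, w, right_le_npair _ _, h, rfl⟩
    · rintro ⟨-, z, -, y, -, w, -, h, hu⟩
      exact ⟨z, y, w, h, hu⟩
  have hrow : ∀ x X z y, z < x 0 →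
      nrow (A x X) (npair z y) = nrow (H (Fin.cons z (Fin.tail x)) X) y := by
    intro x X z y hz
    ext w
    rw [mem_nrow, mem_nrow, hA]
    constructor
    · rintro ⟨z', y', w', h, h'⟩
      obtain ⟨h1, rfl⟩ := npair_inj.1 h'
      obtain ⟨rfl, rfl⟩ := npair_inj.1 h1
      exact (mem_collect_pair.1 h).2
    · exact fun h => ⟨z, y, w, mem_collect_pair.2 ⟨hz, h⟩, rfl⟩
  -- Each value of `G` is a row of `collect G`, hence no longer. So this number exceeds every index
  -- `⟨z, y⟩` that occurs and is at least every stage that is needed.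
  have hc : (fun x X => npair (x 0) (strLen (collect G x X))) ∈ D.PFnum (k + 1) l :=
    eval_mem_PFnum (.pair (.var 0) (.len (.var 0)) : NumTerm L2A 1 1) (fs := ![fun x _ => x 0])
      (fun i => by fin_cases i; exact coord_mem_PFnum 0) (Gs := ![collect G]) (by simpa using hG)
  have hR := rows_self_mem_PF hc hAmem
  have key : ∀ x X z w, z < x 0 → ∀ y u w',
      (y < strLen (G (Fin.cons z (Fin.tail x)) X) ∧ u ≤ strLen (G (Fin.cons z (Fin.tail x)) X) ∧
        w = npair (npair y u) w') →
      (w' ∈ D.fn u (nrow (H (Fin.cons z (Fin.tail x)) X) y) ↔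
        npair (npair (npair z y) u) w' ∈ D.rows (npair (x 0) (strLen (collect G x X)))
          (npair (x 0) (strLen (collect G x X))) (A x X)) := by
    rintro x X z w hz y u w' ⟨hy, hu, rfl⟩
    have hl : strLen (G (Fin.cons z (Fin.tail x)) X) ≤ strLen (collect G x X) := by
      have := strLen_nrow_le (collect G x X) z
      rwa [nrow_collect hz] at this
    rw [mem_rows_pair, hrow x X z y hz]
    refine ⟨fun h => ⟨npair_lt_npair' hz (by omega), ?_, h⟩, fun h => h.2.2⟩
    exact (hu.trans hl).trans (right_le_npair _ _)
  -- The length of the value of `G` at `z`, which limits `y` and `u`, is recovered as the length of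
  -- row `z` of `collect G`.
  refine collect_mem_PF_of_formula (n := 2) (ψ := exLE (.len (.var 0)) (.and
    (rowLength (.var 0) (.var 2) 0) (exLT (.var 0) (exLE (.var 1) (exLE (.var 3) (.and
      (eqN (.var 4) (pair (pair (.var 2) (.var 1)) (.var 0)))
      (.mem (pair (pair (pair (.var 5) (.var 2)) (.var 1)) (.var 0)) (.var 1))))))))
    (.exLE _ (.and (isSigma0B_rowLength _ _ _) (.exLT _ (.exLE _ (.exLE _ (.and (.eqN _ _) (.mem _ _)))))))
    (.len (.var 1)) (Gs := ![collect G, fun x X => D.rows (npair (x 0) (strLen (collect G x X)))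
      (npair (x 0) (strLen (collect G x X))) (A x X)])
    (fun j => by fin_cases j; exacts [hG, hR]) (fun x X z w hz => ?_) fun x X z w hz hw => ?_
  · simp only [realize_exLE, realize_and, realize_exLT, Structure.realize_rowLength, N2_row]
    rw [mem_rows]
    constructor
    · rintro ⟨y, hy, u, hu, w', hw', rfl⟩
      refine ⟨strLen (G (Fin.cons z (Fin.tail x)) X), ?_, ?_, y, N2_lt_iff.2 hy, u, hu, w',
        right_le_npair _ _, rfl, (key x X z _ hz y u w' ⟨hy, hu, rfl⟩).1 hw'⟩
      · have := strLen_nrow_le (collect G x X) z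
        rw [nrow_collect hz] at this
        exact this
      · exact congrArg strLen (nrow_collect hz).symm
    · rintro ⟨ℓ, -, hℓ, y, hy, u, hu, w', -, hw, hw'⟩
      replace hw : w = npair (npair y u) w' := hw
      subst hw
      replace hℓ : ℓ = strLen (nrow (collect G x X) z) := hℓ
      rw [nrow_collect hz] at hℓ
      subst hℓ
      replace hy := N2_lt_iff.1 hy
      exact ⟨y, hy, u, hu, w', (key x X z _ hz y u w' ⟨hy, hu, rfl⟩).2 hw', rfl⟩
  · obtain ⟨y, hy, u, hu, w', hw', rfl⟩ := mem_rows.1 hw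
    have h1 := lt_strLen_of_mem ((key x X z _ hz y u w' ⟨hy, hu, rfl⟩).1 hw')
    have h2 : npair (npair y u) w' ≤ npair (npair (npair z y) u) w' :=
      npair_mono (npair_mono (right_le_npair _ _) le_rfl) le_rfl
    exact h2.trans_lt h1

/-- The values of a function of the class for all first arguments below a bound are collected by a
function of the class. -/
theorem collect_mem_PF {G : StrFun (k + 1) l} (hG : G ∈ D.PF (k + 1) l) :
    collect G ∈ D.PF (k + 1) l := by
  obtain ⟨n, P, j, hP⟩ := hG
  suffices h : ∀ j, collect (fun x X => P.val D N2 x X j) ∈ D.PF (k + 1) l by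
    rw [show G = fun x X => P.val D N2 x X j from funext fun x => funext fun X => hP x X]
    exact h j
  clear hP j
  -- Every string of the program is collected, step by step.
  induction P with
  | nil =>
    intro j
    refine collect_mem_PF_of_formula (ψ := .mem (.var 0) (.var j)) (.mem _ _) (.len (.var j))
      proj_mem_PF (fun x X z w _ => Iff.rfl) fun x X z w _ hw => ?_
    exact lt_strLen_of_mem hw
  | snoc P S ih =>
    intro j
    refine Fin.cases ?_ (fun j => ih j) j
    cases S with
    | recur a b =>
      simp only [Prog.val, Fin.cons_zero, Step.val_recur]
      exact collect_recur_mem_PF (ih a) (ih b)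
    | comp φ hφ s =>
      simp only [Prog.val, Fin.cons_zero, Step.val_comp]
      -- The earlier strings at `z` are the rows `z` of their collections, so the formula of the
      -- step is applied to rows. Its bound `s` depends on those strings as well and is therefore
      -- made part of the formula.
      obtain ⟨ψ, hψ, h⟩ := (hφ.and (.lt (.var 0) s.shiftN)).exists_rows 1
      have hr : ∀ (x : Fin (k + 1) → ℕ) (X : Fin l → Finset ℕ) z, z < x 0 →
          (fun j => nrow (collect (fun x X => P.val D N2 x X j) x X) z) =
            P.val D N2 (Fin.cons z (Fin.tail x) : Fin (k + 1) → ℕ) X := fun x X z hz =>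
        funext fun j => nrow_collect hz
      refine collect_mem_PF_of_formula hψ s ih (fun x X z w hz => ?_) fun x X z w hz hw => ?_
      · rw [mem_cut, h, Formula.realize_and, Formula.realize_lt, NumTerm.eval_shiftN, N2_lt_iff,
          and_comm]
        have e : (Fin.cons w (Fin.cons z (Fin.tail x) : Fin (k + 1) → ℕ) : Fin (k + 2) → ℕ) 1 = z :=
          rfl
        rw [e, hr x X z hz]
        rfl
      · refine (mem_cut.1 hw).1.trans_le ?_
        rw [← hr x X z hz]
        refine s.eval_mono_N2 (fun i => ?_) fun j => strLen_nrow_le _ _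
        refine Fin.cases ?_ (fun i => ?_) i
        · exact hz.le
        · exact le_rfl

end RecData

end TwoSorted

namespace TwoSorted

/-! ## The functions of `L_FC` are computed by programs -/

/-- The bounded minimum is described through the numbers below it, which is the form that the unary
representation requires. -/
theorem lt_sInf_iff_of_least {s w : ℕ} {p : ℕ → Prop} :
    w < sInf {z : ℕ | z = s ∨ (z < s ∧ p z)} ↔ w < s ∧ ∀ y ≤ w, ¬ p y := by
  have hne : {z : ℕ | z = s ∨ (z < s ∧ p z)}.Nonempty := ⟨s, .inl rfl⟩
  constructor
  · intro h
    have hs : w < s := h.trans_le (Nat.sInf_le (.inl rfl))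
    exact ⟨hs, fun y hy hp => absurd (h.trans_le (Nat.sInf_le (.inr ⟨hy.trans_lt hs, hp⟩)))
      (not_lt.2 hy)⟩
  · rintro ⟨h1, h2⟩
    rcases Nat.sInf_mem hne with h | ⟨-, h⟩
    · rwa [h]
    · exact lt_of_not_ge fun hle => h2 _ hle h

namespace RecData
variable (D : RecData) {k l m n : ℕ}

/-- The class of the functions computed by programs. -/
def progClass : FunClass where
  num := D.PFnum
  str := D.PF

variable {D}

/-- The string `A` has the input as its row `0`. Hence `F(x, X)` is row `⟨0, x⟩` of a run with `b =
1` and `a = x`. -/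
theorem recFun_mem_PF : recFun D.φInit D.φNext D.t ∈ D.PF 1 1 := by
  obtain ⟨A, hA⟩ : ∃ A : StrFun 1 1, ∀ x X u, u ∈ A x X ↔ ∃ z ∈ X 0, u = npair 0 z :=
    ⟨fun _ X => (X 0).image (npair 0), fun x X u => by simp [eq_comm]⟩
  have hAm : A ∈ D.PF 1 1 := by
    refine mem_PF_of_formula (m := 0) (n := 1) (φ := .exLE (.var 0) (.and (.mem (.var 0) (.var 0))
      (.eqN (.var 1) (.pair .zero (.var 0))))) (.exLE _ (.and (.mem _ _) (.eqN _ _)))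
      (.pair .zero (.len (.var 0))) (fs := Fin.elim0) (fun i => i.elim0) proj_mem_PF
      fun x X u => ?_
    rw [hA]
    simp only [Formula.realize_exLE]
    constructor
    · rintro ⟨z, hz, rfl⟩
      exact ⟨npair_lt_npair le_rfl (lt_strLen_of_mem hz), z, right_le_npair _ _, hz, rfl⟩
    · rintro ⟨-, z, -, hz, hu⟩
      exact ⟨z, hz, hu⟩
  have hrow : ∀ x X, nrow (A x X) 0 = X 0 := by
    intro x X
    ext w
    rw [mem_nrow, hA]
    constructor
    · rintro ⟨z, hz, h⟩
      rwa [(npair_inj.1 h).2]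
    · exact fun h => ⟨w, h, rfl⟩
  have h1 : (fun _ _ => 1) ∈ D.PFnum 1 1 :=
    eval_mem_PFnum (.one : NumTerm L2A 0 0) (fs := Fin.elim0) (fun i => i.elim0)
      (Gs := Fin.elim0) fun j => j.elim0
  refine mem_PF_of_formula (m := 1) (φ := .mem (.pair (.pair .zero (.var 1)) (.var 0)) (.var 0))
    (.mem _ _) (.len (.var 0)) coord_mem_PFnum (Gs := ![fun x X => D.rows 1 (x 0) (A x X)])
    (fun j => by fin_cases j; exact rows_mem_PF h1 (coord_mem_PFnum 0) hAm) fun x X z => ?_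
  have key : npair (npair 0 (x 0)) z ∈ D.rows 1 (x 0) (A x X) ↔ z ∈ D.fn (x 0) (X 0) := by
    rw [mem_rows_pair, hrow]
    simp
  constructor
  · intro hz
    have := key.2 hz
    exact ⟨(right_le_npair _ _).trans_lt (lt_strLen_of_mem this), this⟩
  · rintro ⟨-, h⟩
    exact key.1 h

mutual
theorem numTerm_eval_mem : ∀ s : NumTerm D.progClass.vocab m n,
    (fun v V => s.eval D.progClass.std v V) ∈ D.PFnum m n
  | .var i => coord_mem_PFnum i
  | .zero => eval_mem_PFnum .zero coord_mem_PFnum proj_mem_PF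
  | .one => eval_mem_PFnum .one coord_mem_PFnum proj_mem_PF
  | .add s t => eval_mem_PFnum (.add (.var 0) (.var 1) : NumTerm L2A 2 n)
      (fs := ![fun v V => s.eval D.progClass.std v V, fun v V => t.eval D.progClass.std v V])
      (Fin.forall_fin_two.2 ⟨numTerm_eval_mem s, numTerm_eval_mem t⟩) proj_mem_PF
  | .mul s t => eval_mem_PFnum (.mul (.var 0) (.var 1) : NumTerm L2A 2 n)
      (fs := ![fun v V => s.eval D.progClass.std v V, fun v V => t.eval D.progClass.std v V])
      (Fin.forall_fin_two.2 ⟨numTerm_eval_mem s, numTerm_eval_mem t⟩) proj_mem_PF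
  | .len T => strLen_mem_PFnum (strTerm_eval_mem T)
  | .fn f s T => compose_mem_PFnum f.2 (fun i => numTerm_eval_mem (s i))
      fun j => strTerm_eval_mem (T j)
theorem strTerm_eval_mem : ∀ T : StrTerm D.progClass.vocab m n,
    (fun v V => T.eval D.progClass.std v V) ∈ D.PF m n
  | .var j => proj_mem_PF j
  | .fn f s T => compose_mem_PF f.2 (fun i => numTerm_eval_mem (s i))
      fun j => strTerm_eval_mem (T j)
end

variable (D) in
/-- The truth value of a formula over the class, as a string that may contain `0`. -/
noncomputable def charFn (α : Formula D.progClass.vocab m n) : StrFun m n := fun v V =>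
  cut 1 fun _ => α.Realize D.progClass.std v V

/-- An open formula over the class is no formula of the base vocabulary, since its terms nest
functions of the class. At a single tuple its truth value is computed by evaluating the terms by
composition and then the connectives on truth values. -/
theorem charFn_mem_PF : ∀ {m n : ℕ} (α : Formula D.progClass.vocab m n), α.IsOpen →
    D.charFn α ∈ D.PF m n := by
  have hone : ∀ {m n : ℕ} (x : Fin m → ℕ) (X : Fin n → Finset ℕ),
      (NumTerm.one : NumTerm L2A m n).eval N2 x X = 1 := fun _ _ => NumTerm.eval_one _ _ _
  intro m n α hα
  induction α with
  | tru => exact mem_PF_of_formula .tru .one coord_mem_PFnum proj_mem_PF fun x X z => mem_cut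
  | fls => exact mem_PF_of_formula .fls .one coord_mem_PFnum proj_mem_PF fun x X z => mem_cut
  | @eqN m n s t =>
    exact mem_PF_of_formula (m := 2) (φ := .eqN (.var 1) (.var 2)) (.eqN _ _) .one
      (fs := ![fun v V => s.eval D.progClass.std v V, fun v V => t.eval D.progClass.std v V])
      (Fin.forall_fin_two.2 ⟨numTerm_eval_mem s, numTerm_eval_mem t⟩) proj_mem_PF
      fun x X z => mem_cut
  | @le m n s t =>
    exact mem_PF_of_formula (m := 2) (φ := .le (.var 1) (.var 2)) (.le _ _) .one
      (fs := ![fun v V => s.eval D.progClass.std v V, fun v V => t.eval D.progClass.std v V])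
      (Fin.forall_fin_two.2 ⟨numTerm_eval_mem s, numTerm_eval_mem t⟩) proj_mem_PF
      fun x X z => mem_cut
  | @eqS m n S T =>
    exact mem_PF_of_formula (n := 2) (φ := .eqS (.var 0) (.var 1)) (.eqS _ _) .one
      coord_mem_PFnum
      (Gs := ![fun v V => S.eval D.progClass.std v V, fun v V => T.eval D.progClass.std v V])
      (Fin.forall_fin_two.2 ⟨strTerm_eval_mem S, strTerm_eval_mem T⟩) fun x X z => mem_cut
  | @mem m n s T =>
    exact mem_PF_of_formula (m := 1) (n := 1) (φ := .mem (.var 1) (.var 0)) (.mem _ _) .one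
      (fs := ![fun v V => s.eval D.progClass.std v V]) (Fin.forall_fin_one.2 (numTerm_eval_mem s))
      (Gs := ![fun v V => T.eval D.progClass.std v V]) (Fin.forall_fin_one.2 (strTerm_eval_mem T))
      fun x X z => mem_cut
  | not φ ih =>
    refine mem_PF_of_formula (n := 1) (φ := .not (.mem (.var 0) (.var 0))) (.not (.mem _ _)) .one
      coord_mem_PFnum (Gs := ![D.charFn φ]) (Fin.forall_fin_one.2 (ih hα)) fun x X z => ?_
    rw [charFn, mem_cut, hone]
    refine and_congr_right fun hz => ?_
    show _ ↔ ¬ z ∈ cut 1 _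
    rw [mem_cut]
    simp [hz]
  | and φ ψ ih ih' =>
    refine mem_PF_of_formula (n := 2)
      (φ := .and (.mem (.var 0) (.var 0)) (.mem (.var 0) (.var 1))) (.and (.mem _ _) (.mem _ _)) .one
      coord_mem_PFnum (Gs := ![D.charFn φ, D.charFn ψ])
      (Fin.forall_fin_two.2 ⟨ih hα.1, ih' hα.2⟩) fun x X z => ?_
    rw [charFn, mem_cut, hone]
    refine and_congr_right fun hz => ?_
    show _ ↔ z ∈ cut 1 _ ∧ z ∈ cut 1 _
    rw [mem_cut, mem_cut]
    simp [hz]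
  | or φ ψ ih ih' =>
    refine mem_PF_of_formula (n := 2)
      (φ := .or (.mem (.var 0) (.var 0)) (.mem (.var 0) (.var 1))) (.or (.mem _ _) (.mem _ _)) .one
      coord_mem_PFnum (Gs := ![D.charFn φ, D.charFn ψ])
      (Fin.forall_fin_two.2 ⟨ih hα.1, ih' hα.2⟩) fun x X z => ?_
    rw [charFn, mem_cut, hone]
    refine and_congr_right fun hz => ?_
    show _ ↔ z ∈ cut 1 _ ∨ z ∈ cut 1 _
    rw [mem_cut, mem_cut]
    simp [hz]
  | exN => exact hα.elim
  | allN => exact hα.elim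
  | exS => exact hα.elim
  | allS => exact hα.elim

/-- The truth values of an open formula for all values of the first variable below a term. -/
theorem exists_charFn_collect (α : Formula D.progClass.vocab (k + 1) l) (hα : α.IsOpen)
    (t : NumTerm L2A k l) : ∃ K ∈ D.PF k l, ∀ x X z, npair z 0 ∈ K x X ↔
      z < t.eval N2 x X ∧ α.Realize D.progClass.std (Fin.cons z x) X := by
  refine ⟨_, compose_mem_PF (collect_mem_PF (charFn_mem_PF α hα))
    (fs := Fin.cons (fun x X => t.eval N2 x X) fun i x _ => x i) (fun i => ?_) proj_mem_PF,
    fun x X z => ?_⟩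
  · refine Fin.cases ?_ (fun i => ?_) i
    · exact eval_mem_PFnum t coord_mem_PFnum proj_mem_PF
    · exact coord_mem_PFnum i
  · have : (fun i => (Fin.cons (fun x X => t.eval N2 x X) fun i x _ => x i :
        Fin (k + 1) → NumFun k l) i x X) = Fin.cons (t.eval N2 x X) x := by
      funext i
      refine Fin.cases rfl (fun i => rfl) i
    simp only [this]
    rw [mem_collect_pair, charFn, mem_cut]
    simp

/-- For comprehension and minimization the open formula is needed at all `z` below the bound
simultaneously. Its collected truth values reduce it to an atomic formula of the base vocabulary,
with `z` as the only changing argument. -/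
theorem isClosed_progClass : D.progClass.IsClosed (recFun D.φInit D.φNext D.t) where
  zero_mem := eval_mem_PFnum .zero coord_mem_PFnum proj_mem_PF
  one_mem := eval_mem_PFnum .one coord_mem_PFnum proj_mem_PF
  add_mem := eval_mem_PFnum (.add (.var 0) (.var 1)) coord_mem_PFnum proj_mem_PF
  mul_mem := eval_mem_PFnum (.mul (.var 0) (.var 1)) coord_mem_PFnum proj_mem_PF
  len_mem := eval_mem_PFnum (.len (.var 0)) coord_mem_PFnum proj_mem_PF
  pd_mem := by
    refine mem_PF_of_formula (m := 1) (φ := .lt (.add (.var 0) .one) (.var 1)) (.lt _ _) (.var 0)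
      coord_mem_PFnum proj_mem_PF fun x X z => ?_
    rw [Finset.mem_range, Formula.realize_lt, N2_lt_iff]
    have : z < x 0 - 1 ↔ z < x 0 ∧ z + 1 < x 0 := by omega
    exact this
  fSE_mem := by
    refine mem_PFnum_of_least (n := 2)
      (φ := .not (.iff (.mem (.var 0) (.var 0)) (.mem (.var 0) (.var 1))))
      (.not (.iff (.mem _ _) (.mem _ _))) (.len (.var 0)) coord_mem_PFnum proj_mem_PF
      fun x X z => ?_
    rw [lt_sInf_iff_of_least]
    simp only [Formula.realize_not, Formula.realize_iff]
    exact Iff.rfl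
  rec_mem := recFun_mem_PF
  bitFun_mem {k l} α t hα := by
    obtain ⟨K, hK, h⟩ := exists_charFn_collect α hα t
    refine mem_PF_of_formula (n := 1) (φ := .mem (.pair (.var 0) .zero) (.var 0)) (.mem _ _)
      (.len (.var 0)) coord_mem_PFnum (Gs := ![K]) (Fin.forall_fin_one.2 hK) fun x X z => ?_
    simp only [FunClass.bitFun, Finset.mem_filter, Finset.mem_range]
    refine (h x X z).symm.trans ⟨fun hz => ⟨?_, hz⟩, fun hz => hz.2⟩
    exact (left_le_npair _ _).trans_lt (lt_strLen_of_mem hz)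
  minFun_mem {k l} α t hα := by
    obtain ⟨K, hK, h⟩ := exists_charFn_collect α hα t
    refine mem_PFnum_of_least (m := 1) (n := 1) (φ := .mem (.pair (.var 0) .zero) (.var 0))
      (.mem _ _) (.var 0) (fs := ![fun x X => t.eval N2 x X])
      (Fin.forall_fin_one.2 (eval_mem_PFnum t coord_mem_PFnum proj_mem_PF))
      (Gs := ![K]) (Fin.forall_fin_one.2 hK) fun x X z => ?_
    rw [FunClass.minFun, lt_sInf_iff_of_least]
    refine and_congr_right fun hz => forall_congr' fun y => imp_congr_right fun hy => not_congr ?_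
    refine Iff.trans ?_ (h x X y).symm
    exact (and_iff_right (hy.trans_lt hz)).symm

theorem mem_PF_of_mem_LFC {G : StrFun k l}
    (h : G ∈ (FunClass.LFC (recFun D.φInit D.φNext D.t)).str k l) : G ∈ D.PF k l :=
  h _ isClosed_progClass

theorem mem_PFnum_of_mem_LFC {f : NumFun k l}
    (h : f ∈ (FunClass.LFC (recFun D.φInit D.φNext D.t)).num k l) : f ∈ D.PFnum k l :=
  h _ isClosed_progClass

end RecData

end TwoSorted

namespace TwoSorted

/-! ## Functions computed by programs are `AC⁰`-reducible to the recursion -/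

variable {D : RecData} {k l m n : ℕ}

theorem NumTerm.eval_reduct {L : Vocab} (numFn : ∀ k l : ℕ, L.NumFn k l → NumFun k l)
    (strFn : ∀ k l : ℕ, L.StrFn k l → StrFun k l) (s : NumTerm L2A m n) (v : Fin m → ℕ)
    (V : Fin n → Finset ℕ) :
    s.eval (stdStructure L numFn strFn).reduct v V = s.eval N2 v V := by
  induction s using NumTerm.baseInduction with
  | var i => rfl
  | zero => rfl
  | one => rfl
  | len j => rfl
  | add s t hs ht => exact congrArg₂ (· + ·) hs ht
  | mul s t hs ht => exact congrArg₂ (· * ·) hs ht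

theorem NumTerm.exists_polynomial (s : NumTerm L2A k l) :
    ∃ p : MvPolynomial (Fin k ⊕ Fin l) ℕ, ∀ (x : Fin k → ℕ) (X : Fin l → Finset ℕ),
      s.eval N2 x X = MvPolynomial.eval (Sum.elim x fun j => strLen (X j)) p := by
  induction s using NumTerm.baseInduction with
  | var i => exact ⟨.X (.inl i), fun x X => by simp⟩
  | zero => exact ⟨0, fun x X => by simp⟩
  | one => exact ⟨1, fun x X => by simp⟩
  | len j => exact ⟨.X (.inr j), fun x X => by simp⟩
  | add s t hs ht =>
    obtain ⟨p, hp⟩ := hs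
    obtain ⟨q, hq⟩ := ht
    exact ⟨p + q, fun x X => by rw [NumTerm.eval_add, hp, hq, map_add]⟩
  | mul s t hs ht =>
    obtain ⟨p, hp⟩ := hs
    obtain ⟨q, hq⟩ := ht
    exact ⟨p * q, fun x X => by rw [NumTerm.eval_mul, hp, hq, map_mul]⟩

theorem NumTerm.exists_of_polynomial (p : MvPolynomial (Fin k ⊕ Fin l) ℕ) :
    ∃ s : NumTerm L2A k l, ∀ (x : Fin k → ℕ) (X : Fin l → Finset ℕ),
      s.eval N2 x X = MvPolynomial.eval (Sum.elim x fun j => strLen (X j)) p := by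
  induction p using MvPolynomial.induction_on with
  | C a =>
    simp only [MvPolynomial.eval_C]
    induction a with
    | zero => exact ⟨.zero, fun x X => by simp⟩
    | succ a ih =>
      obtain ⟨s, hs⟩ := ih
      exact ⟨.add s .one, fun x X => by rw [NumTerm.eval_add, hs, NumTerm.eval_one]⟩
  | add p q hp hq =>
    obtain ⟨s, hs⟩ := hp
    obtain ⟨t, ht⟩ := hq
    exact ⟨.add s t, fun x X => by rw [NumTerm.eval_add, hs, ht, map_add]⟩
  | mul_X p i hp =>
    obtain ⟨s, hs⟩ := hp
    rcases i with i | j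
    · exact ⟨.mul s (.var i), fun x X => by rw [NumTerm.eval_mul, hs, map_mul]; simp⟩
    · exact ⟨.mul s (.len (.var j)), fun x X => by rw [NumTerm.eval_mul, hs, map_mul]; simp⟩

/-- A bound on a term whose string variables have bounded lengths. -/
theorem NumTerm.exists_bound (s : NumTerm L2A m n) (B : Fin n → NumTerm L2A m l) :
    ∃ s' : NumTerm L2A m l, ∀ (v : Fin m → ℕ) (V : Fin n → Finset ℕ) (X : Fin l → Finset ℕ),
      (∀ j, strLen (V j) ≤ (B j).eval N2 v X) → s.eval N2 v V ≤ s'.eval N2 v X := by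
  induction s using NumTerm.baseInduction with
  | var i => exact ⟨.var i, fun v V X _ => by simp⟩
  | zero => exact ⟨.zero, fun v V X _ => by simp⟩
  | one => exact ⟨.one, fun v V X _ => by simp⟩
  | len j => exact ⟨B j, fun v V X h => by simpa using h j⟩
  | add s t hs ht =>
    obtain ⟨s', hs⟩ := hs
    obtain ⟨t', ht⟩ := ht
    exact ⟨.add s' t', fun v V X h => by
      rw [NumTerm.eval_add, NumTerm.eval_add]
      exact Nat.add_le_add (hs v V X h) (ht v V X h)⟩
  | mul s t hs ht =>
    obtain ⟨s', hs⟩ := hs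
    obtain ⟨t', ht⟩ := ht
    exact ⟨.mul s' t', fun v V X h => by
      rw [NumTerm.eval_mul, NumTerm.eval_mul]
      exact Nat.mul_le_mul (hs v V X h) (ht v V X h)⟩

variable (D) in
theorem Prog.exists_bound (P : Prog k l n) : ∃ B : Fin n → NumTerm L2A k l,
    ∀ (x : Fin k → ℕ) (X : Fin l → Finset ℕ) j,
      strLen (P.val D N2 x X j) ≤ (B j).eval N2 x X := by
  induction P with
  | nil => exact ⟨fun j => .len (.var j), fun x X j => le_rfl⟩
  | snoc P S ih =>
    obtain ⟨B, hB⟩ := ih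
    obtain ⟨s, hs⟩ := (S.bound D).exists_bound B
    refine ⟨Fin.cons s B, fun x X j => ?_⟩
    refine Fin.cases ?_ (fun j => ?_) j
    · exact le_trans (Step.spec_val D.isModel_N2).len_le (hs x _ X (hB x X))
    · exact hB x X j

-- Base formulas with string terms of a larger vocabulary substituted.

section Translate
variable {L : Vocab} {numFn : ∀ k l : ℕ, L.NumFn k l → NumFun k l}
  {strFn : ∀ k l : ℕ, L.StrFn k l → StrFun k l}

/-- Substitution, in a term of the base vocabulary, of string terms of a larger vocabulary. -/
theorem NumTerm.exists_translate {T : Fin n → StrTerm L m l} (s : NumTerm L2A m n) :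
    ∃ s' : NumTerm L m l, ∀ (v : Fin m → ℕ) (X : Fin l → Finset ℕ),
      s'.eval (stdStructure L numFn strFn) v X =
        s.eval N2 v fun j => (T j).eval (stdStructure L numFn strFn) v X := by
  induction s using NumTerm.baseInduction with
  | var i => exact ⟨.var i, fun v X => by simp⟩
  | zero => exact ⟨.zero, fun v X => by simp⟩
  | one => exact ⟨.one, fun v X => by simp⟩
  | len j => exact ⟨.len (T j), fun v X => by simp⟩
  | add s t hs ht =>
    obtain ⟨s', hs⟩ := hs
    obtain ⟨t', ht⟩ := ht
    exact ⟨.add s' t', fun v X => by rw [NumTerm.eval_add, NumTerm.eval_add, hs, ht]⟩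
  | mul s t hs ht =>
    obtain ⟨s', hs⟩ := hs
    obtain ⟨t', ht⟩ := ht
    exact ⟨.mul s' t', fun v X => by rw [NumTerm.eval_mul, NumTerm.eval_mul, hs, ht]⟩

/-- Substitution, in a bounded formula of the base vocabulary, of string terms of a larger
vocabulary whose lengths are bounded by terms of the base vocabulary. -/
theorem Formula.IsSigma0B.exists_translate {φ : Formula L2A m n} (h : φ.IsSigma0B) :
    ∀ {ρ : Fin k → Fin m} {Gs : Fin n → StrFun k l} {B : Fin n → NumTerm L2A k l}
      (_ : ∀ x X j, strLen (Gs j x X) ≤ (B j).eval N2 x X)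
      {T : ∀ m : ℕ, (Fin k → Fin m) → Fin n → StrTerm L m l}
      (_ : ∀ m ρ j (v : Fin m → ℕ) X, (T m ρ j).eval (stdStructure L numFn strFn) v X =
        Gs j (fun i => v (ρ i)) X),
    ∃ φ' : Formula L m l, φ'.IsSigma0B ∧ ∀ (v : Fin m → ℕ) (X : Fin l → Finset ℕ),
      φ'.Realize (stdStructure L numFn strFn) v X ↔
        φ.Realize N2 v fun j => Gs j (fun i => v (ρ i)) X := by
  have hex : ∀ {m n : ℕ} (t : NumTerm L2A m n) (φ : Formula L2A (m + 1) n)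
      {ρ : Fin k → Fin m} {Gs : Fin n → StrFun k l} {B : Fin n → NumTerm L2A k l}
      (_ : ∀ x X j, strLen (Gs j x X) ≤ (B j).eval N2 x X)
      {T : ∀ m : ℕ, (Fin k → Fin m) → Fin n → StrTerm L m l}
      (_ : ∀ m ρ j (v : Fin m → ℕ) X, (T m ρ j).eval (stdStructure L numFn strFn) v X =
        Gs j (fun i => v (ρ i)) X),
      (∃ φ' : Formula L (m + 1) l, φ'.IsSigma0B ∧ ∀ (v : Fin (m + 1) → ℕ) (X : Fin l → Finset ℕ),
        φ'.Realize (stdStructure L numFn strFn) v X ↔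
          φ.Realize N2 v fun j => Gs j (fun i => v (ρ i).succ) X) →
      ∃ φ' : Formula L m l, φ'.IsSigma0B ∧ ∀ (v : Fin m → ℕ) (X : Fin l → Finset ℕ),
        φ'.Realize (stdStructure L numFn strFn) v X ↔
          (Formula.exLE t φ).Realize N2 v fun j => Gs j (fun i => v (ρ i)) X := by
    rintro m n t φ ρ Gs B hB T hT ⟨φ', hφ', h⟩
    -- A bounding term must belong to the base vocabulary, but after the substitution `t` may
    -- mention lengths of new string terms. A larger base term `t'` bounds the quantifier, and the
    -- exact bound `s` goes into the matrix.
    obtain ⟨t', ht'⟩ := t.exists_bound fun j => (B j).rename ρ id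
    obtain ⟨s, hs⟩ := t.shiftN.exists_translate (T := T (m + 1) fun i => (ρ i).succ)
      (numFn := numFn) (strFn := strFn)
    refine ⟨Formula.exLE t' (Formula.and (Formula.le (.var 0) s) φ'), .exLE _ (.and (.le _ _) hφ'), fun v X => ?_⟩
    rw [realize_exLE', realize_exLE, NumTerm.eval_reduct]
    have hv : t.eval N2 v (fun j => Gs j (fun i => v (ρ i)) X) ≤ t'.eval N2 v X :=
      ht' v _ X fun j => by
        rw [NumTerm.eval_rename]
        exact hB _ _ j
    have key : ∀ y : ℕ, (Formula.and (.le (.var 0) s) φ').Realize (stdStructure L numFn strFn)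
        (Fin.cons y v : Fin (m + 1) → ℕ) X ↔
        y ≤ t.eval N2 v (fun j => Gs j (fun i => v (ρ i)) X) ∧
          φ.Realize N2 (Fin.cons y v : Fin (m + 1) → ℕ) fun j => Gs j (fun i => v (ρ i)) X := by
      intro y
      rw [realize_and, realize_le, hs, h]
      simp only [hT, Fin.cons_succ]
      rw [NumTerm.eval_shiftN]
      exact Iff.rfl
    constructor
    · rintro ⟨y, -, hy⟩
      exact ⟨y, (key y).1 hy⟩
    · rintro ⟨y, hy, h⟩
      exact ⟨y, Nat.le_trans hy hv, (key y).2 ⟨hy, h⟩⟩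
  induction h with
  | tru => exact fun _ _ _ => ⟨.tru, .tru, fun v X => Iff.rfl⟩
  | fls => exact fun _ _ _ => ⟨.fls, .fls, fun v X => Iff.rfl⟩
  | eqN s t =>
    intro ρ Gs B hB T hT
    obtain ⟨s', hs⟩ := s.exists_translate (T := T _ ρ) (numFn := numFn) (strFn := strFn)
    obtain ⟨t', ht⟩ := t.exists_translate (T := T _ ρ) (numFn := numFn) (strFn := strFn)
    exact ⟨.eqN s' t', .eqN _ _, fun v X => by
      rw [realize_eqN, realize_eqN, hs, ht]; simp only [hT]⟩
  | le s t =>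
    intro ρ Gs B hB T hT
    obtain ⟨s', hs⟩ := s.exists_translate (T := T _ ρ) (numFn := numFn) (strFn := strFn)
    obtain ⟨t', ht⟩ := t.exists_translate (T := T _ ρ) (numFn := numFn) (strFn := strFn)
    exact ⟨.le s' t', .le _ _, fun v X => by
      rw [realize_le, realize_le, hs, ht]; simp only [hT]⟩
  | eqS S S' =>
    intro ρ Gs B hB T hT
    obtain ⟨i, rfl⟩ := S.exists_eq_var
    obtain ⟨j, rfl⟩ := S'.exists_eq_var
    exact ⟨.eqS (T _ ρ i) (T _ ρ j), .eqS _ _, fun v X => by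
      rw [realize_eqS, realize_eqS, hT, hT, StrTerm.eval_var, StrTerm.eval_var]⟩
  | mem s S =>
    intro ρ Gs B hB T hT
    obtain ⟨j, rfl⟩ := S.exists_eq_var
    obtain ⟨s', hs⟩ := s.exists_translate (T := T _ ρ) (numFn := numFn) (strFn := strFn)
    exact ⟨.mem s' (T _ ρ j), .mem _ _, fun v X => by
      rw [realize_mem, realize_mem, hs, hT, StrTerm.eval_var]; simp only [hT]⟩
  | not _ ih =>
    intro ρ Gs B hB T hT
    obtain ⟨φ', hφ', h⟩ := ih hB hT
    exact ⟨.not φ', .not hφ', fun v X => not_congr (h v X)⟩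
  | and _ _ ih ih' =>
    intro ρ Gs B hB T hT
    obtain ⟨φ', hφ', h⟩ := ih hB hT
    obtain ⟨ψ', hψ', h'⟩ := ih' hB hT
    exact ⟨.and φ' ψ', .and hφ' hψ', fun v X => and_congr (h v X) (h' v X)⟩
  | or _ _ ih ih' =>
    intro ρ Gs B hB T hT
    obtain ⟨φ', hφ', h⟩ := ih hB hT
    obtain ⟨ψ', hψ', h'⟩ := ih' hB hT
    exact ⟨.or φ' ψ', .or hφ' hψ', fun v X => or_congr (h v X) (h' v X)⟩
  | exLE t _ ih =>
    intro ρ Gs B hB T hT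
    exact hex t _ hB hT (ih hB hT)
  | @allLE m n t φ _ ih =>
    intro ρ Gs B hB T hT
    obtain ⟨φ', hφ', h⟩ := ih (ρ := fun i => (ρ i).succ) hB hT
    obtain ⟨ψ, hψ, h'⟩ := hex t (.not φ) hB hT
      ⟨.not φ', .not hφ', fun v X => not_congr (h v X)⟩
    refine ⟨.not ψ, .not hψ, fun v X => (not_congr (h' v X)).trans ?_⟩
    simp

end Translate

/-- Rows, as a string function. -/
noncomputable def rowFn : StrFun 1 1 := fun x X => nrow (X 0) (x 0)

open FunClass Formula NumTerm

theorem strPBounded_of_term {G : StrFun k l} (s : NumTerm L2A k l)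
    (h : ∀ x X, strLen (G x X) ≤ s.eval N2 x X) : StrPBounded G := by
  obtain ⟨p, hp⟩ := s.exists_polynomial
  refine ⟨p + 1, fun x X => ?_⟩
  rw [map_add, map_one, ← hp]
  exact Nat.lt_succ_of_le (h x X)

namespace Prog

variable (D) in
/-- The strings computed by a program are inputs or are computed by a chain. -/
theorem exists_chain (P : Prog k l n) : ∃ Gs : List ((k l : ℕ) × StrFun k l),
    (single (recFun D.φInit D.φNext D.t)).IsChain Gs ∧ ⟨1, 1, rowFn⟩ ∈ Gs ∧
    ∀ j, (∃ i, ∀ x X, P.val D N2 x X j = X i) ∨ ⟨k, l, fun x X => P.val D N2 x X j⟩ ∈ Gs := by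
  induction P with
  | nil =>
    -- The chain begins with the row function, so that later formulas can apply `F` to rows of a
    -- string.
    refine ⟨[⟨1, 1, rowFn⟩], .cons .nil ⟨strPBounded_of_term (.len (.var 0)) fun x X => ?_,
      .mem (.pair (.var 1) (.var 0)) (.var 0), .mem _ _, fun z x X => ?_⟩, by simp,
      fun j => .inl ⟨j, fun x X => rfl⟩⟩
    · exact strLen_nrow_le _ _
    · exact mem_nrow
  | @snoc n P S ih =>
    obtain ⟨Gs, hGs, hrow, hP⟩ := ih
    obtain ⟨B, hB⟩ := P.exists_bound D
    -- The term is provided for every number of variables and every position of the `k` arguments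
    -- among them, because quantifiers enlarge the context while the arguments stay the same.
    have hT : ∀ j, ∃ T : ∀ m : ℕ, (Fin k → Fin m) →
        StrTerm ((single (recFun D.φInit D.φNext D.t)).adjoin Gs).vocab m l,
        ∀ m ρ (v : Fin m → ℕ) X, (T m ρ).eval (FunClass.std _) v X =
          P.val D N2 (fun i => v (ρ i)) X j := by
      intro j
      rcases hP j with ⟨i, hi⟩ | h
      · exact ⟨fun m ρ => .var i, fun m ρ v X => by rw [StrTerm.eval_var]; exact (hi _ _).symm⟩
      · exact ⟨fun m ρ => .fn ⟨_, .inr h⟩ (fun i => .var (ρ i)) .var, fun m ρ v X => rfl⟩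
    choose T hT using hT
    have hB' : ∃ s : NumTerm L2A k l, ∀ x X,
        strLen ((P.snoc S).val D N2 x X 0) ≤ s.eval N2 x X := by
      obtain ⟨B, hB⟩ := (P.snoc S).exists_bound D
      exact ⟨B 0, fun x X => hB x X 0⟩
    obtain ⟨s, hs⟩ := hB'
    refine ⟨⟨k, l, fun x X => (P.snoc S).val D N2 x X 0⟩ :: Gs, .cons hGs
      ⟨strPBounded_of_term s hs, ?_⟩, List.mem_cons_of_mem _ hrow, fun j => ?_⟩
    · cases S with
      | comp φ hφ t =>
        obtain ⟨φ', hφ', h⟩ := (hφ.and (.lt (.var 0) t.shiftN)).exists_translate (ρ := Fin.succ) hB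
          (T := fun m ρ j => T j m ρ) (fun m ρ j => hT j m ρ)
        refine ⟨φ', hφ', fun z x X => ?_⟩
        refine Iff.trans ?_ (h _ _).symm
        simp only [val, Fin.cons_zero, Step.val_comp, mem_cut, realize_and, realize_lt,
          NumTerm.eval_var, N2_lt_iff, Fin.cons_succ, NumTerm.eval_shiftN]
        exact and_comm
      | recur a b =>
        -- The bits of the run are expressed by `F` directly: the candidate `z` is decoded as `⟨⟨y,
        -- u⟩, w⟩`, and `w` is tested for membership in `F(u, X^{[y]})`. The components of a code do
        -- not exceed it, whence the bounds.
        refine ⟨.exLE (.var 0) (.exLE (.var 1) (.exLE (.var 2) (.and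
          (.and (.lt (.var 2) (.len (T a _ fun i => i.succ.succ.succ.succ)))
            (.le (.var 1) (.len (T a _ fun i => i.succ.succ.succ.succ)))) (.and
          (.eqN (.var 3) (.pair (.pair (.var 2) (.var 1)) (.var 0)))
          (.mem (.var 0) (.fn ⟨recFun D.φInit D.φNext D.t, .inl rfl⟩ ![.var 1]
            ![.fn ⟨rowFn, .inr hrow⟩ ![.var 2] ![T b _ fun i => i.succ.succ.succ.succ]])))))),
          .exLE _ (.exLE _ (.exLE _ (.and (.and (.lt _ _) (.le _ _)) (.and (.eqN _ _) (.mem _ _))))),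
          fun z x X => ?_⟩
        simp only [realize_exLE', NumTerm.eval_reduct, val, Fin.cons_zero, Step.val_recur,
          RecData.mem_rows]
        have key : ∀ y u w : ℕ, (Formula.and
            (.and (.lt (.var 2) (.len (T a _ fun i => i.succ.succ.succ.succ)))
              (.le (.var 1) (.len (T a _ fun i => i.succ.succ.succ.succ)))) (.and
            (.eqN (.var 3) (.pair (.pair (.var 2) (.var 1)) (.var 0)))
            (.mem (.var 0) (.fn ⟨recFun D.φInit D.φNext D.t, .inl rfl⟩ ![.var 1]
              ![.fn ⟨rowFn, .inr hrow⟩ ![.var 2] ![T b _ fun i => i.succ.succ.succ.succ]])))).Realize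
            (FunClass.std _) (Fin.cons w (Fin.cons u (Fin.cons y (Fin.cons z x : Fin (k + 1) → ℕ) :
              Fin (k + 2) → ℕ) : Fin (k + 3) → ℕ) : Fin (k + 4) → ℕ) X ↔
            (y < strLen (P.val D N2 x X a) ∧ u ≤ strLen (P.val D N2 x X a)) ∧
              z = npair (npair y u) w ∧ w ∈ D.fn u (nrow (P.val D N2 x X b) y) := by
          intro y u w
          have e := fun j => hT j (k + 4) (fun i => i.succ.succ.succ.succ) (Fin.cons w (Fin.cons u
            (Fin.cons y (Fin.cons z x : Fin (k + 1) → ℕ) :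
              Fin (k + 2) → ℕ) : Fin (k + 3) → ℕ) : Fin (k + 4) → ℕ) X
          simp only [Fin.cons_succ] at e
          rw [← e a, ← e b]
          refine and_congr (and_congr ?_ Iff.rfl) Iff.rfl
          exact lt_iff_le_and_ne.symm
        constructor
        · rintro ⟨y, hy, u, hu, w, hw, rfl⟩
          have h1 := left_le_npair (npair y u) w
          exact ⟨y, (left_le_npair y u).trans h1, u, (right_le_npair y u).trans h1, w,
            right_le_npair _ _, (key y u w).2 ⟨⟨hy, hu⟩, rfl, hw⟩⟩
        · rintro ⟨y, -, u, -, w, -, h⟩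
          obtain ⟨⟨hy, hu⟩, hz, hw⟩ := (key y u w).1 h
          exact ⟨y, hy, u, hu, w, hw, hz⟩
    · refine Fin.cases (.inr (List.mem_cons_self ..)) (fun j => ?_) j
      rcases hP j with h | h
      · exact .inl h
      · exact .inr (List.mem_cons_of_mem _ h)

end Prog

namespace RecData

theorem exists_chain_of_mem_PF {G : StrFun k l} (h : G ∈ D.PF k l) :
    ∃ Gs : List ((k l : ℕ) × StrFun k l), (single (recFun D.φInit D.φNext D.t)).IsChain Gs ∧
      StrPBounded G ∧ ∃ T : ∀ m : ℕ, (Fin k → Fin m) →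
        StrTerm ((single (recFun D.φInit D.φNext D.t)).adjoin Gs).vocab m l,
        ∀ m ρ (v : Fin m → ℕ) X, (T m ρ).eval (FunClass.std _) v X = G (fun i => v (ρ i)) X := by
  obtain ⟨n, P, j, hP⟩ := h
  obtain ⟨Gs, hGs, -, h⟩ := P.exists_chain D
  obtain ⟨B, hB⟩ := P.exists_bound D
  obtain rfl : G = fun x X => P.val D N2 x X j := funext fun x => funext fun X => hP x X
  refine ⟨Gs, hGs, strPBounded_of_term (B j) fun x X => hB x X j, ?_⟩
  rcases h j with ⟨i, hi⟩ | h
  · exact ⟨fun m ρ => .var i, fun m ρ v X => by rw [StrTerm.eval_var]; exact (hi _ _).symm⟩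
  · exact ⟨fun m ρ => .fn ⟨_, .inr h⟩ (fun i => .var (ρ i)) .var, fun m ρ v X => rfl⟩

theorem strAC0Reducible_of_mem_PF {G : StrFun k l} (h : G ∈ D.PF k l) :
    (single (recFun D.φInit D.φNext D.t)).StrAC0Reducible G := by
  obtain ⟨Gs, hGs, hb, T, hT⟩ := exists_chain_of_mem_PF h
  refine ⟨Gs, hGs, hb, .mem (.var 0) (T _ Fin.succ), .mem _ _, fun z x X => ?_⟩
  rw [realize_mem, hT]
  rfl

theorem numAC0Reducible_of_mem_PFnum {f : NumFun k l} (h : f ∈ D.PFnum k l) :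
    (single (recFun D.φInit D.φNext D.t)).NumAC0Reducible f := by
  obtain ⟨Gs, hGs, ⟨p, hp⟩, T, hT⟩ := exists_chain_of_mem_PF h
  refine ⟨Gs, hGs, ⟨p, fun x X => by simpa using hp x X⟩, .eqN (.var 0) (.len (T _ Fin.succ)),
    .eqN _ _, fun z x X => ?_⟩
  rw [realize_eqN, NumTerm.eval_len, hT]
  simp

end RecData

end TwoSorted

namespace TwoSorted

/-! ## Functions that are `AC⁰`-reducible to the recursion belong to `L_FC` -/

namespace FunClass

variable {C C' : FunClass} {F : StrFun 1 1} {k l m n : ℕ}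

/-- Inclusion of classes. -/
structure IsSubclass (C C' : FunClass) : Prop where
  num : ∀ {k l : ℕ} {f : NumFun k l}, f ∈ C.num k l → f ∈ C'.num k l
  str : ∀ {k l : ℕ} {G : StrFun k l}, G ∈ C.str k l → G ∈ C'.str k l

mutual
/-- A number term over a class is a number term over every larger class. -/
def liftNum (h : C.IsSubclass C') : NumTerm C.vocab m n → NumTerm C'.vocab m n
  | .var i => .var i
  | .zero => .zero
  | .one => .one
  | .add s t => .add (liftNum h s) (liftNum h t)
  | .mul s t => .mul (liftNum h s) (liftNum h t)
  | .len T => .len (liftStr h T)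
  | .fn f s T => .fn (L := C'.vocab) ⟨f.1, h.num f.2⟩ (fun i => liftNum h (s i))
      fun j => liftStr h (T j)
/-- A string term over a class is a string term over every larger class. -/
def liftStr (h : C.IsSubclass C') : StrTerm C.vocab m n → StrTerm C'.vocab m n
  | .var j => .var j
  | .fn f s T => .fn (L := C'.vocab) ⟨f.1, h.str f.2⟩ (fun i => liftNum h (s i))
      fun j => liftStr h (T j)
end

mutual
theorem eval_liftNum (h : C.IsSubclass C') (v : Fin m → ℕ) (V : Fin n → Finset ℕ) :
    ∀ s : NumTerm C.vocab m n, (liftNum h s).eval C'.std v V = s.eval C.std v V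
  | .var _ => rfl
  | .zero => rfl
  | .one => rfl
  | .add s t => congrArg₂ (· + ·) (eval_liftNum h v V s) (eval_liftNum h v V t)
  | .mul s t => congrArg₂ (· * ·) (eval_liftNum h v V s) (eval_liftNum h v V t)
  | .len T => congrArg strLen (eval_liftStr h v V T)
  | .fn f s T => congrArg₂ f.1 (funext fun i => eval_liftNum h v V (s i))
      (funext fun j => eval_liftStr h v V (T j))
theorem eval_liftStr (h : C.IsSubclass C') (v : Fin m → ℕ) (V : Fin n → Finset ℕ) :
    ∀ T : StrTerm C.vocab m n, (liftStr h T).eval C'.std v V = T.eval C.std v V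
  | .var _ => rfl
  | .fn f s T => congrArg₂ f.1 (funext fun i => eval_liftNum h v V (s i))
      (funext fun j => eval_liftStr h v V (T j))
end

/-- The type of formulas depends on the class through its vocabulary, so even an inclusion of
classes calls for a translation. -/
theorem exists_lift_of_isOpen (h : C.IsSubclass C') {m n : ℕ} (α : Formula C.vocab m n) :
    α.IsOpen → ∃ α' : Formula C'.vocab m n, α'.IsOpen ∧ ∀ (v : Fin m → ℕ) (V : Fin n → Finset ℕ),
      α'.Realize C'.std v V ↔ α.Realize C.std v V := by
  induction α with
  | tru => exact fun _ => ⟨.tru, trivial, fun v V => Iff.rfl⟩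
  | fls => exact fun _ => ⟨.fls, trivial, fun v V => Iff.rfl⟩
  | eqN s t => exact fun _ => ⟨.eqN (liftNum h s) (liftNum h t), trivial, fun v V => by
      rw [Formula.realize_eqN, Formula.realize_eqN, eval_liftNum, eval_liftNum]⟩
  | eqS S T => exact fun _ => ⟨.eqS (liftStr h S) (liftStr h T), trivial, fun v V => by
      rw [Formula.realize_eqS, Formula.realize_eqS, eval_liftStr, eval_liftStr]⟩
  | le s t => exact fun _ => ⟨.le (liftNum h s) (liftNum h t), trivial, fun v V => by
      rw [Formula.realize_le, Formula.realize_le, eval_liftNum, eval_liftNum]⟩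
  | mem s T => exact fun _ => ⟨.mem (liftNum h s) (liftStr h T), trivial, fun v V => by
      rw [Formula.realize_mem, Formula.realize_mem, eval_liftNum, eval_liftStr]⟩
  | not φ ih =>
    intro hα
    obtain ⟨φ', hφ, h⟩ := ih hα
    exact ⟨.not φ', hφ, fun v V => not_congr (h v V)⟩
  | and φ ψ ih ih' =>
    intro hα
    obtain ⟨φ', hφ, h⟩ := ih hα.1
    obtain ⟨ψ', hψ, h'⟩ := ih' hα.2
    exact ⟨.and φ' ψ', ⟨hφ, hψ⟩, fun v V => and_congr (h v V) (h' v V)⟩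
  | or φ ψ ih ih' =>
    intro hα
    obtain ⟨φ', hφ, h⟩ := ih hα.1
    obtain ⟨ψ', hψ, h'⟩ := ih' hα.2
    exact ⟨.or φ' ψ', ⟨hφ, hψ⟩, fun v V => or_congr (h v V) (h' v V)⟩
  | exN => exact fun hα => hα.elim
  | allN => exact fun hα => hα.elim
  | exS => exact fun hα => hα.elim
  | allS => exact fun hα => hα.elim

theorem isSubclass_LFC (h : C.IsClosed F) : (LFC F).IsSubclass C where
  num hf := hf C h
  str hG := hG C h

/-- `LFC` is the intersection of the closed classes. An open formula over it can be read over each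
closed class with the same meaning, so the functions it yields belong to all of them. -/
theorem isClosed_LFC : (LFC F).IsClosed F where
  zero_mem _ h := h.zero_mem
  one_mem _ h := h.one_mem
  add_mem _ h := h.add_mem
  mul_mem _ h := h.mul_mem
  len_mem _ h := h.len_mem
  pd_mem _ h := h.pd_mem
  fSE_mem _ h := h.fSE_mem
  rec_mem _ h := h.rec_mem
  bitFun_mem α t hα C h := by
    obtain ⟨α', hα', e⟩ := exists_lift_of_isOpen (isSubclass_LFC h) α hα
    convert h.bitFun_mem α' t hα' using 1
    funext x X
    ext z
    simp only [bitFun, Finset.mem_filter, e]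
  minFun_mem α t hα C h := by
    obtain ⟨α', hα', e⟩ := exists_lift_of_isOpen (isSubclass_LFC h) α hα
    convert h.minFun_mem α' t hα' using 1
    funext x X
    simp only [minFun, e]

/-- Elimination of bounded quantifiers. -/
theorem exists_isOpen_of_isSigma0B (hC : C'.IsClosed F) (hsub : C.IsSubclass C')
    {φ : Formula C.vocab m n} (h : φ.IsSigma0B) : ∃ α : Formula C'.vocab m n, α.IsOpen ∧
      ∀ (v : Fin m → ℕ) (V : Fin n → Finset ℕ), α.Realize C'.std v V ↔ φ.Realize C.std v V := by
  have hex : ∀ {m n : ℕ} (t : NumTerm L2A m n) (φ : Formula C'.vocab (m + 1) n),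
      φ.IsOpen → ∃ α : Formula C'.vocab m n, α.IsOpen ∧
        ∀ (v : Fin m → ℕ) (V : Fin n → Finset ℕ), α.Realize C'.std v V ↔
          ∃ y ≤ t.eval N2 v V, φ.Realize C'.std (Fin.cons y v) V := by
    intro m n t φ hφ
    -- A witness `y ≤ t` exists if and only if the minimum below `t + 1` is at most `t`; the default
    -- value `t + 1` signals that there is none.
    refine ⟨.le (.fn (L := C'.vocab) ⟨_, hC.minFun_mem φ (.add t .one) hφ⟩ .var .var) t.ofBase,
      trivial, fun v V => ?_⟩
    have e : (NumTerm.add t .one).eval N2 v V = t.eval N2 v V + 1 := rfl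
    rw [Formula.realize_le, NumTerm.eval_ofBase, NumTerm.eval_reduct]
    show C'.minFun φ (.add t .one) v V ≤ t.eval N2 v V ↔ _
    rw [← not_lt, minFun, lt_sInf_iff_of_least, e]
    push Not
    exact ⟨fun h => h (Nat.lt_succ_self _), fun h _ => h⟩
  induction h with
  | tru => exact exists_lift_of_isOpen hsub _ trivial
  | fls => exact exists_lift_of_isOpen hsub _ trivial
  | eqN => exact exists_lift_of_isOpen hsub _ trivial
  | eqS => exact exists_lift_of_isOpen hsub _ trivial
  | le => exact exists_lift_of_isOpen hsub _ trivial
  | mem => exact exists_lift_of_isOpen hsub _ trivial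
  | not _ ih =>
    obtain ⟨α, hα, h⟩ := ih
    exact ⟨.not α, hα, fun v V => not_congr (h v V)⟩
  | and _ _ ih ih' =>
    obtain ⟨α, hα, h⟩ := ih
    obtain ⟨β, hβ, h'⟩ := ih'
    exact ⟨.and α β, ⟨hα, hβ⟩, fun v V => and_congr (h v V) (h' v V)⟩
  | or _ _ ih ih' =>
    obtain ⟨α, hα, h⟩ := ih
    obtain ⟨β, hβ, h'⟩ := ih'
    exact ⟨.or α β, ⟨hα, hβ⟩, fun v V => or_congr (h v V) (h' v V)⟩
  | exLE t _ ih =>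
    obtain ⟨α, hα, h⟩ := ih
    obtain ⟨β, hβ, h'⟩ := hex t α hα
    refine ⟨β, hβ, fun v V => (h' v V).trans ?_⟩
    rw [Formula.realize_exLE', NumTerm.eval_reduct]
    exact exists_congr fun y => and_congr_right fun _ => h _ _
  | allLE t _ ih =>
    obtain ⟨α, hα, h⟩ := ih
    obtain ⟨β, hβ, h'⟩ := hex t (.not α) hα
    refine ⟨.not β, hβ, fun v V => (not_congr (h' v V)).trans ?_⟩
    rw [Formula.realize_allLE', NumTerm.eval_reduct]
    simp only [Formula.realize_not, h]
    push Not
    exact Iff.rfl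

theorem str_mem_of_definable (hC : C'.IsClosed F) (h : C.IsSubclass C') {G : StrFun k l}
    (hG : C.StrSigma0BDefinable G) : G ∈ C'.str k l := by
  obtain ⟨⟨p, hp⟩, φ, hφ, hG⟩ := hG
  obtain ⟨α, hα, e⟩ := exists_isOpen_of_isSigma0B hC h hφ
  obtain ⟨s, hs⟩ := NumTerm.exists_of_polynomial p
  convert hC.bitFun_mem α s hα using 1
  funext x X
  ext z
  simp only [bitFun, Finset.mem_filter, Finset.mem_range, e, ← hG, hs]
  exact ⟨fun hz => ⟨(lt_strLen_of_mem hz).trans (hp x X), hz⟩, fun hz => hz.2⟩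

/-- The value is the only number satisfying the graph and lies below a polynomial bound, so
minimization finds it. -/
theorem num_mem_of_definable (hC : C'.IsClosed F) (h : C.IsSubclass C') {f : NumFun k l}
    (hf : C.NumSigma0BDefinable f) : f ∈ C'.num k l := by
  obtain ⟨⟨p, hp⟩, φ, hφ, hf⟩ := hf
  obtain ⟨α, hα, e⟩ := exists_isOpen_of_isSigma0B hC h hφ
  obtain ⟨s, hs⟩ := NumTerm.exists_of_polynomial p
  convert hC.minFun_mem α s hα using 1
  funext x X
  refine eq_of_forall_lt_iff fun z => ?_
  simp only [minFun, lt_sInf_iff_of_least, e, ← hf, hs]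
  refine ⟨fun hz => ⟨hz.trans (hp x X), fun y hy e => ?_⟩, fun ⟨_, h⟩ => ?_⟩
  · exact absurd (hy.trans_lt hz) (by rw [e]; exact lt_irrefl _)
  · exact lt_of_not_ge fun hle => h _ hle rfl

theorem isSubclass_single (hC : C.IsClosed F) : (single F).IsSubclass C where
  num hf := hf.elim
  str {k l G} hG := by
    cases hG
    exact hC.rec_mem

theorem isSubclass_adjoin (hC : C'.IsClosed F) (h : C.IsSubclass C')
    {Gs : List ((k l : ℕ) × StrFun k l)} (hGs : C.IsChain Gs) : (C.adjoin Gs).IsSubclass C' := by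
  induction hGs with
  | nil =>
    exact ⟨h.num, fun hG => hG.elim h.str fun hG => absurd hG List.not_mem_nil⟩
  | cons _ hG ih =>
    refine ⟨h.num, fun {k l G} hG' => ?_⟩
    rcases hG' with hG' | hG'
    · exact h.str hG'
    · rcases List.mem_cons.1 hG' with hG' | hG'
      · cases hG'
        exact str_mem_of_definable hC ih hG
      · exact ih.str (.inr hG')

theorem StrAC0Reducible.mem_LFC {G : StrFun k l} (h : (single F).StrAC0Reducible G) :
    G ∈ (LFC F).str k l := by
  obtain ⟨Gs, hGs, hG⟩ := h
  exact str_mem_of_definable isClosed_LFC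
    (isSubclass_adjoin isClosed_LFC (isSubclass_single isClosed_LFC) hGs) hG

theorem NumAC0Reducible.mem_LFC {f : NumFun k l} (h : (single F).NumAC0Reducible f) :
    f ∈ (LFC F).num k l := by
  obtain ⟨Gs, hGs, hf⟩ := h
  exact num_mem_of_definable isClosed_LFC
    (isSubclass_adjoin isClosed_LFC (isSubclass_single isClosed_LFC) hGs) hf

end FunClass

end TwoSorted

namespace TwoSorted

/-! ## Witnessing: provably total `Σ¹₁` functions are computed by programs

The functions computed by programs, modulo an ultrafilter on the set of inputs, form a model of
the theory. If for every ultrafilter the value of a function coincides in this sense with a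
function computed by a program, then finitely many programs suffice by compactness. -/

open Filter

/-- Values of the arguments of a function. -/
abbrev Input (k l : ℕ) : Type := (Fin k → ℕ) × (Fin l → Finset ℕ)

namespace RecData
variable (D : RecData) {k l m n : ℕ} (U : Ultrafilter (Input k l))

/-- The functions computed by programs, modulo an ultrafilter. -/
def ultra : Structure L2A where
  Num := {g : Germ (U : Filter (Input k l)) ℕ //
    ∃ f ∈ D.PFnum k l, g = ↑(fun p : Input k l => f p.1 p.2)}
  Str := {g : Germ (U : Filter (Input k l)) (Finset ℕ) //
    ∃ G ∈ D.PF k l, g = ↑(fun p : Input k l => G p.1 p.2)}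
  str_nonempty := ⟨⟨_, _, mem_PF_of_formula (m := 0) (n := 0) (G := fun _ _ => ∅) .fls .zero
    (fs := Fin.elim0) (fun i => i.elim0) (Gs := Fin.elim0) (fun j => j.elim0)
    fun x X z => by simp, rfl⟩⟩
  zero := ⟨_, _, eval_mem_PFnum .zero coord_mem_PFnum proj_mem_PF, rfl⟩
  one := ⟨_, _, eval_mem_PFnum .one coord_mem_PFnum proj_mem_PF, rfl⟩
  add a b := ⟨Germ.map₂ (· + ·) a.1 b.1, by
    obtain ⟨-, f, hf, rfl⟩ := a
    obtain ⟨-, g, hg, rfl⟩ := b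
    exact ⟨_, eval_mem_PFnum (.add (.var 0) (.var 1) : NumTerm L2A 2 0) (fs := ![f, g])
      (Fin.forall_fin_two.2 ⟨hf, hg⟩) (Gs := Fin.elim0) fun j => j.elim0, rfl⟩⟩
  mul a b := ⟨Germ.map₂ (· * ·) a.1 b.1, by
    obtain ⟨-, f, hf, rfl⟩ := a
    obtain ⟨-, g, hg, rfl⟩ := b
    exact ⟨_, eval_mem_PFnum (.mul (.var 0) (.var 1) : NumTerm L2A 2 0) (fs := ![f, g])
      (Fin.forall_fin_two.2 ⟨hf, hg⟩) (Gs := Fin.elim0) fun j => j.elim0, rfl⟩⟩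
  len A := ⟨Germ.map strLen A.1, by
    obtain ⟨-, G, hG, rfl⟩ := A
    exact ⟨_, strLen_mem_PFnum hG, rfl⟩⟩
  le a b := Germ.LiftRel (· ≤ ·) a.1 b.1
  mem a A := Germ.LiftRel (· ∈ ·) a.1 A.1
  numFn f := nomatch f
  strFn f := nomatch f

/-- The class of a number function. -/
def numGerm (f : D.PFnum k l) : (D.ultra U).Num := ⟨_, f.1, f.2, rfl⟩

/-- The class of a string function. -/
def strGerm (G : D.PF k l) : (D.ultra U).Str := ⟨_, G.1, G.2, rfl⟩

variable {D U}

theorem exists_numGerm (a : (D.ultra U).Num) : ∃ f, D.numGerm U f = a := by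
  obtain ⟨-, f, hf, rfl⟩ := a
  exact ⟨⟨f, hf⟩, rfl⟩

theorem exists_strGerm (A : (D.ultra U).Str) : ∃ G, D.strGerm U G = A := by
  obtain ⟨-, G, hG, rfl⟩ := A
  exact ⟨⟨G, hG⟩, rfl⟩

theorem numGerm_cons (f₀ : D.PFnum k l) (f : Fin m → D.PFnum k l) :
    (fun i => D.numGerm U ((Fin.cons f₀ f : Fin (m + 1) → D.PFnum k l) i)) =
      Fin.cons (D.numGerm U f₀) fun i => D.numGerm U (f i) :=
  funext fun i => Fin.cases rfl (fun _ => rfl) i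

theorem strGerm_cons (G₀ : D.PF k l) (G : Fin n → D.PF k l) :
    (fun j => D.strGerm U ((Fin.cons G₀ G : Fin (n + 1) → D.PF k l) j)) =
      Fin.cons (D.strGerm U G₀) fun j => D.strGerm U (G j) :=
  funext fun j => Fin.cases rfl (fun _ => rfl) j

theorem PFnum_cons (f₀ : D.PFnum k l) (f : Fin m → D.PFnum k l) (x : Fin k → ℕ)
    (X : Fin l → Finset ℕ) : (fun i => ((Fin.cons f₀ f : Fin (m + 1) → D.PFnum k l) i).1 x X) =
      Fin.cons (f₀.1 x X) fun i => (f i).1 x X :=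
  funext fun i => Fin.cases rfl (fun _ => rfl) i

theorem PF_cons (G₀ : D.PF k l) (G : Fin n → D.PF k l) (x : Fin k → ℕ)
    (X : Fin l → Finset ℕ) : (fun j => ((Fin.cons G₀ G : Fin (n + 1) → D.PF k l) j).1 x X) =
      Fin.cons (G₀.1 x X) fun j => (G j).1 x X :=
  funext fun j => Fin.cases rfl (fun _ => rfl) j

theorem numGerm_inj {f g : D.PFnum k l} : D.numGerm U f = D.numGerm U g ↔
    ∀ᶠ p in (U : Filter (Input k l)), f.1 p.1 p.2 = g.1 p.1 p.2 :=
  Subtype.ext_iff.trans Germ.coe_eq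

theorem strGerm_inj {G H : D.PF k l} : D.strGerm U G = D.strGerm U H ↔
    ∀ᶠ p in (U : Filter (Input k l)), G.1 p.1 p.2 = H.1 p.1 p.2 :=
  Subtype.ext_iff.trans Germ.coe_eq

theorem numGerm_le {f g : D.PFnum k l} : (D.ultra U).le (D.numGerm U f) (D.numGerm U g) ↔
    ∀ᶠ p in (U : Filter (Input k l)), f.1 p.1 p.2 ≤ g.1 p.1 p.2 := Iff.rfl

theorem numGerm_mem {f : D.PFnum k l} {G : D.PF k l} :
    (D.ultra U).mem (D.numGerm U f) (D.strGerm U G) ↔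
      ∀ᶠ p in (U : Filter (Input k l)), f.1 p.1 p.2 ∈ G.1 p.1 p.2 := Iff.rfl

theorem len_strGerm (G : D.PF k l) : (D.ultra U).len (D.strGerm U G) =
    D.numGerm U ⟨_, strLen_mem_PFnum G.2⟩ := rfl

theorem eval_ultra (s : NumTerm L2A m n) (f : Fin m → D.PFnum k l) (G : Fin n → D.PF k l) :
    s.eval (D.ultra U) (fun i => D.numGerm U (f i)) (fun j => D.strGerm U (G j)) =
      D.numGerm U ⟨_, eval_mem_PFnum s (fun i => (f i).2) fun j => (G j).2⟩ := by
  induction s using NumTerm.baseInduction with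
  | var i => rfl
  | zero => rfl
  | one => rfl
  | len j => rfl
  | add s t hs ht => exact congrArg₂ (D.ultra U).add hs ht
  | mul s t hs ht => exact congrArg₂ (D.ultra U).mul hs ht

/-- Łoś's theorem for bounded formulas. -/
theorem realize_ultra {φ : Formula L2A m n} (h : φ.IsSigma0B) :
    ∀ (f : Fin m → D.PFnum k l) (G : Fin n → D.PF k l),
      φ.Realize (D.ultra U) (fun i => D.numGerm U (f i)) (fun j => D.strGerm U (G j)) ↔
        ∀ᶠ p in (U : Filter (Input k l)), φ.Realize N2 (fun i => (f i).1 p.1 p.2) fun j => (G j).1 p.1 p.2 := by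
  have hex : ∀ {m n : ℕ} (t : NumTerm L2A m n) {φ : Formula L2A (m + 1) n}, φ.IsSigma0B →
      (∀ (f : Fin (m + 1) → D.PFnum k l) (G : Fin n → D.PF k l),
        φ.Realize (D.ultra U) (fun i => D.numGerm U (f i)) (fun j => D.strGerm U (G j)) ↔
        ∀ᶠ p in (U : Filter (Input k l)),
          φ.Realize N2 (fun i => (f i).1 p.1 p.2) fun j => (G j).1 p.1 p.2) →
      ∀ (f : Fin m → D.PFnum k l) (G : Fin n → D.PF k l),
      (Formula.exLE t φ).Realize (D.ultra U) (fun i => D.numGerm U (f i))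
          (fun j => D.strGerm U (G j)) ↔
        ∀ᶠ p in (U : Filter (Input k l)), (Formula.exLE t φ).Realize N2 (fun i => (f i).1 p.1 p.2)
          fun j => (G j).1 p.1 p.2 := by
    intro m n t φ hφ ih f G
    have hle : ∀ f₀ : D.PFnum k l, (D.ultra U).le (D.numGerm U f₀)
        (t.eval (D.ultra U) (fun i => D.numGerm U (f i)) fun j => D.strGerm U (G j)) ↔
        ∀ᶠ p in (U : Filter (Input k l)),
          f₀.1 p.1 p.2 ≤ t.eval N2 (fun i => (f i).1 p.1 p.2) fun j => (G j).1 p.1 p.2 := by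
      intro f₀
      rw [eval_ultra, numGerm_le]
    have hφ' : ∀ f₀ : D.PFnum k l, φ.Realize (D.ultra U)
        (Fin.cons (D.numGerm U f₀) fun i => D.numGerm U (f i)) (fun j => D.strGerm U (G j)) ↔
        ∀ᶠ p in (U : Filter (Input k l)), φ.Realize N2
          (Fin.cons (f₀.1 p.1 p.2) fun i => (f i).1 p.1 p.2) fun j => (G j).1 p.1 p.2 := by
      intro f₀
      rw [← numGerm_cons, ih]
      simp only [PFnum_cons]
    simp only [Formula.realize_exLE]
    constructor
    · rintro ⟨a, h1, h2⟩
      obtain ⟨f₀, rfl⟩ := exists_numGerm a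
      filter_upwards [(hle f₀).1 h1, (hφ' f₀).1 h2] with p h1 h2
      exact ⟨_, h1, h2⟩
    · intro h
      -- The witness has to be the germ of a function of the class. The least one below `t + 1` is
      -- such a function; this is where boundedness of the quantifier enters.
      obtain ⟨f₀, hf₀⟩ : ∃ f₀ : NumFun k l, ∀ x X z, z < f₀ x X ↔
          z < t.eval N2 (fun i => (f i).1 x X) (fun j => (G j).1 x X) + 1 ∧
            ∀ y ≤ z, ¬ φ.Realize N2 (Fin.cons y fun i => (f i).1 x X) fun j => (G j).1 x X :=
        ⟨_, fun x X z => lt_sInf_iff_of_least⟩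
      have hf : f₀ ∈ D.PFnum k l :=
        mem_PFnum_of_least hφ (.add t .one) (fun i => (f i).2) (fun j => (G j).2) hf₀
      have key : ∀ᶠ p in (U : Filter (Input k l)),
          f₀ p.1 p.2 ≤ t.eval N2 (fun i => (f i).1 p.1 p.2) (fun j => (G j).1 p.1 p.2) ∧
          φ.Realize N2 (Fin.cons (f₀ p.1 p.2) fun i => (f i).1 p.1 p.2)
            fun j => (G j).1 p.1 p.2 := by
        filter_upwards [h] with p ⟨y, hy, h⟩
        have hle : f₀ p.1 p.2 ≤ y := not_lt.1 fun hlt => ((hf₀ _ _ _).1 hlt).2 y le_rfl h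
        refine ⟨hle.trans hy, ?_⟩
        by_contra hn
        refine lt_irrefl _ ((hf₀ p.1 p.2 _).2 ⟨Nat.lt_succ_of_le (hle.trans hy), fun z hz => ?_⟩)
        rcases hz.lt_or_eq with hz | rfl
        · exact ((hf₀ _ _ _).1 hz).2 z le_rfl
        · exact hn
      exact ⟨D.numGerm U ⟨f₀, hf⟩, (hle _).2 (key.mono fun p h => h.1),
        (hφ' _).2 (key.mono fun p h => h.2)⟩
  induction h with
  | tru => exact fun f G => by simp
  | fls => exact fun f G => by simp [U.neBot.ne]
  | eqN s t =>
    intro f G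
    rw [Formula.realize_eqN, eval_ultra, eval_ultra, numGerm_inj]
    rfl
  | eqS S T =>
    intro f G
    obtain ⟨i, rfl⟩ := S.exists_eq_var
    obtain ⟨j, rfl⟩ := T.exists_eq_var
    exact strGerm_inj
  | le s t =>
    intro f G
    rw [Formula.realize_le, eval_ultra, eval_ultra, numGerm_le]
    rfl
  | mem s T =>
    intro f G
    obtain ⟨j, rfl⟩ := T.exists_eq_var
    rw [Formula.realize_mem, eval_ultra, StrTerm.eval_var, numGerm_mem]
    rfl
  | not _ ih =>
    intro f G
    rw [Formula.realize_not, ih]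
    exact Ultrafilter.eventually_not.symm
  | and _ _ ih ih' =>
    intro f G
    rw [Formula.realize_and, ih, ih']
    exact eventually_and.symm
  | or _ _ ih ih' =>
    intro f G
    rw [Formula.realize_or, ih, ih']
    exact Ultrafilter.eventually_or.symm
  | exLE t hφ ih => exact hex t hφ ih
  | @allLE m n t φ hφ ih =>
    intro f G
    have h := hex t hφ.not (fun f G => by
      rw [Formula.realize_not, ih]
      exact Ultrafilter.eventually_not.symm) f G
    have e : ∀ (M : Structure L2A) v V,
        (Formula.allLE t φ).Realize M v V ↔ ¬ (Formula.exLE t (.not φ)).Realize M v V := by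
      intro M v V
      simp
    simp only [e]
    rw [h]
    exact Ultrafilter.eventually_not.symm

/-- Łoś's theorem is available here for bounded formulas only. A string quantifier holds in the
ultrapower as soon as a function of the class selects witnesses. -/
theorem realize_ultra_exSLE {φ : Formula L2A m (n + 1)} (hφ : φ.IsSigma0B) {t : NumTerm L2A m n}
    (f : Fin m → D.PFnum k l) (G : Fin n → D.PF k l) {G₀ : StrFun k l} (hG₀ : G₀ ∈ D.PF k l)
    (h : ∀ x X, strLen (G₀ x X) ≤ t.eval N2 (fun i => (f i).1 x X) (fun j => (G j).1 x X) ∧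
      φ.Realize N2 (fun i => (f i).1 x X) (Fin.cons (G₀ x X) fun j => (G j).1 x X)) :
    (Formula.exSLE t φ).Realize (D.ultra U) (fun i => D.numGerm U (f i))
      fun j => D.strGerm U (G j) := by
  rw [Formula.realize_exSLE]
  refine ⟨D.strGerm U ⟨G₀, hG₀⟩, ?_, ?_⟩
  · rw [eval_ultra, len_strGerm, numGerm_le]
    exact .of_forall fun p => (h p.1 p.2).1
  · rw [← strGerm_cons, realize_ultra hφ]
    simp only [PF_cons]
    exact .of_forall fun p => (h p.1 p.2).2

theorem satisfies_ultra_of_isSigma0B {φ : Formula L2A m n} (hφ : φ.IsSigma0B)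
    (h : N2.Satisfies φ.close) : (D.ultra U).Satisfies φ.close := by
  rw [Formula.satisfies_close] at h ⊢
  intro v V
  choose f hf using fun i => exists_numGerm (v i)
  choose G hG using fun j => exists_strGerm (V j)
  obtain rfl := funext hf
  obtain rfl := funext hG
  exact (realize_ultra hφ f G).2 (.of_forall fun p => h _ _)

-- The basic axioms are universal closures of `Σ^B_0` formulas and transfer from `N2`. Comprehension
-- and `AXIOM_F` each ask for one string, which the class supplies through `cut` and `rows`.
open Formula IsSigma0B in
theorem isModel_ultra : (D.ultra U).IsModel D.theory := by
  rintro φ ((hφ | ⟨m, n, φ, hφ, rfl⟩) | rfl)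
  · have h := isModel_V0_N2 φ (.inl hφ)
    simp only [basicAxioms, Set.mem_insert_iff, Set.mem_singleton_iff] at hφ
    rcases hφ with rfl | rfl | rfl | rfl | rfl | rfl | rfl | rfl | rfl | rfl | rfl | rfl | rfl |
      rfl | rfl
    · exact satisfies_ultra_of_isSigma0B (.not (.eqN _ _)) h
    · exact satisfies_ultra_of_isSigma0B (.imp (.eqN _ _) (.eqN _ _)) h
    · exact satisfies_ultra_of_isSigma0B (.eqN _ _) h
    · exact satisfies_ultra_of_isSigma0B (.eqN _ _) h
    · exact satisfies_ultra_of_isSigma0B (.eqN _ _) h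
    · exact satisfies_ultra_of_isSigma0B (.eqN _ _) h
    · exact satisfies_ultra_of_isSigma0B (.imp (.and (.le _ _) (.le _ _)) (.eqN _ _)) h
    · exact satisfies_ultra_of_isSigma0B (.le _ _) h
    · exact satisfies_ultra_of_isSigma0B (.imp (.and (.le _ _) (.le _ _)) (.le _ _)) h
    · exact satisfies_ultra_of_isSigma0B (.or (.le _ _) (.le _ _)) h
    · exact satisfies_ultra_of_isSigma0B (.iff (.le _ _) (.lt _ _)) h
    · exact satisfies_ultra_of_isSigma0B (.imp (.not (.eqN _ _)) (.exLT _ (.eqN _ _))) h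
    · exact satisfies_ultra_of_isSigma0B (.imp (.mem _ _) (.lt _ _)) h
    · exact satisfies_ultra_of_isSigma0B (.imp (.eqN _ _) (.mem _ _)) h
    · exact satisfies_ultra_of_isSigma0B (.iff (.eqS _ _) (.and (.eqN _ _)
        (.allLT _ (.iff (.mem _ _) (.mem _ _))))) h
  · rw [comprehension, Formula.satisfies_close]
    intro v V
    choose f hf using fun i => exists_numGerm (v i)
    choose G hG using fun j => exists_strGerm (V j)
    obtain rfl := funext hf
    obtain rfl := funext hG
    refine realize_ultra_exSLE (.allLT _ (.iff (.mem _ _) (hφ.rename _ _))) f G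
      (G₀ := fun x X => cut ((f 0).1 x X) fun z =>
        φ.Realize N2 (Fin.cons z fun i => (f i).1 x X) fun j => (G j).1 x X)
      (mem_PF_of_formula hφ (.var 0) (fun i => (f i).2) (fun j => (G j).2) fun x X z => mem_cut)
      fun x X => ⟨strLen_cut_le _ _, ?_⟩
    simp only [realize_allLT, realize_iff, realize_rename]
    intro z hz
    refine mem_cut.trans ((and_iff_right (N2_lt_iff.1 hz)).trans (iff_of_eq ?_))
    rfl
  · rw [recAxiom]
    intro a b A
    obtain ⟨f, rfl⟩ := exists_numGerm a
    obtain ⟨g, rfl⟩ := exists_numGerm b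
    obtain ⟨G, rfl⟩ := exists_strGerm A
    have := realize_ultra_exSLE (U := U) (t := recBound D.t 0) (isSigma0B_recFormula (D := D))
      ![g, f] ![G] (rows_mem_PF g.2 f.2 G.2) fun x X => ?_
    · refine (iff_of_eq ?_).1 this
      congr 1
      · funext i
        fin_cases i <;> rfl
      · funext j
        fin_cases j; rfl
    · have e1 : (fun i => ((![g, f] : Fin 2 → D.PFnum k l) i).1 x X) = ![g.1 x X, f.1 x X] := by
        funext i
        fin_cases i <;> rfl
      have e2 : (fun j => ((![G] : Fin 1 → D.PF k l) j).1 x X) = ![G.1 x X] := by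
        funext i
        fin_cases i; rfl
      rw [e1, e2, eval_recBound]
      exact ⟨strLen_rows_le _ _ _, realize_recFormula (M := N2) (g.1 x X) (f.1 x X) (G.1 x X)
        (D.rows _ _ _) |>.2 (recSpec_rows _ _ _)⟩

/-- A `Σ¹₁` formula that holds in the ultrapower holds on a set of inputs that is decided by a
program. -/
theorem exists_of_realize_ultra {φ : Formula L2A m n} (h : φ.IsSigma11) :
    ∀ (f : Fin m → D.PFnum k l) (G : Fin n → D.PF k l),
      φ.Realize (D.ultra U) (fun i => D.numGerm U (f i)) (fun j => D.strGerm U (G j)) →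
        ∃ H ∈ D.PF k l, (∀ᶠ p in (U : Filter (Input k l)), 0 ∈ H p.1 p.2) ∧ ∀ x X, 0 ∈ H x X →
          φ.Realize N2 (fun i => (f i).1 x X) fun j => (G j).1 x X := by
  induction h with
  | base hφ =>
    rename_i φ
    intro f G h
    have key : ∀ x X, 0 ∈ (cut 1 fun z => φ.Realize N2 (fun i => (f i).1 x X)
        fun j => (G j).1 x X) ↔ φ.Realize N2 (fun i => (f i).1 x X) fun j => (G j).1 x X := by
      intro x X
      simp
    refine ⟨fun x X => cut 1 fun z => φ.Realize N2 (fun i => (f i).1 x X) fun j => (G j).1 x X,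
      mem_PF_of_formula (hφ.rename Fin.succ id) .one (fun i => (f i).2) (fun j => (G j).2)
        fun x X z => ?_, ?_, fun x X h => (key x X).1 h⟩
    · rw [mem_cut, Formula.realize_rename]
      exact Iff.rfl
    · filter_upwards [(realize_ultra hφ f G).1 h] with p hp
      exact (key p.1 p.2).2 hp
  | exS _ ih =>
    rintro f G ⟨A, h⟩
    -- The strings of this restricted ultrapower are germs of functions computed by programs, so the
    -- witness comes with a program.
    obtain ⟨G₀, rfl⟩ := exists_strGerm A
    rw [← strGerm_cons] at h
    obtain ⟨H, hH, hU, h⟩ := ih f _ h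
    refine ⟨H, hH, hU, fun x X hx => ⟨G₀.1 x X, ?_⟩⟩
    have := h x X hx
    rwa [PF_cons] at this

/-- Compactness: a function that is locally computed by programs is computed by a program. -/
theorem mem_PF_of_locally {G : StrFun k l}
    (h : ∀ U : Ultrafilter (Input k l), ∃ H ∈ D.PF k l, ∃ G₀ ∈ D.PF k l,
      (∀ᶠ p in (U : Filter (Input k l)), 0 ∈ H p.1 p.2) ∧ ∀ x X, 0 ∈ H x X → G x X = G₀ x X) :
    G ∈ D.PF k l := by
  -- These sets form an ideal: each is contained in a set decided by a program on which `G` agrees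
  -- with a function of the class. The claim is that the whole space belongs to it.
  let p : Set (Input k l) → Prop := fun A =>
    ∃ H ∈ D.PF k l, ∃ G₀ ∈ D.PF k l, (∀ q ∈ A, 0 ∈ H q.1 q.2) ∧
      ∀ x X, 0 ∈ H x X → G x X = G₀ x X
  have hempty : (fun _ _ => ∅) ∈ D.PF k l :=
    mem_PF_of_formula (m := 0) (n := 0) .fls .zero
      (fs := Fin.elim0) (fun i => i.elim0) (Gs := Fin.elim0) (fun j => j.elim0)
      fun x X z => by simp
  have hunion : ∀ A, p A → ∀ B, p B → p (A ∪ B) := by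
    rintro A ⟨H, hH, G₀, hG₀, hA, h⟩ B ⟨H', hH', G₁, hG₁, hB, h'⟩
    -- On a union the two functions are combined by cases, according to the test `0 ∈ H x X`.
    refine ⟨fun x X => H x X ∪ H' x X, mem_PF_of_formula (m := 0) (n := 2)
      (φ := .or (.mem (.var 0) (.var 0)) (.mem (.var 0) (.var 1))) (.or (.mem _ _) (.mem _ _))
      (.add (.len (.var 0)) (.len (.var 1))) (fs := Fin.elim0) (fun i => i.elim0) (Gs := ![H, H'])
      (Fin.forall_fin_two.2 ⟨hH, hH'⟩) fun x X z => ?_,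
      fun x X => if 0 ∈ H x X then G₀ x X else G₁ x X, mem_PF_of_formula (m := 0) (n := 3)
      (φ := .or (.and (.mem .zero (.var 0)) (.mem (.var 0) (.var 1)))
        (.and (.not (.mem .zero (.var 0))) (.mem (.var 0) (.var 2))))
      (.or (.and (.mem _ _) (.mem _ _)) (.and (.not (.mem _ _)) (.mem _ _)))
      (.add (.len (.var 1)) (.len (.var 2))) (fs := Fin.elim0) (fun i => i.elim0)
      (Gs := ![H, G₀, G₁]) ?_ fun x X z => ?_, ?_, ?_⟩
    · rw [Finset.mem_union]
      show _ ↔ z < strLen (H x X) + strLen (H' x X) ∧ (z ∈ H x X ∨ z ∈ H' x X)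
      refine (and_iff_right_of_imp ?_).symm
      rintro (h | h)
      · exact (lt_strLen_of_mem h).trans_le (Nat.le_add_right _ _)
      · exact (lt_strLen_of_mem h).trans_le (Nat.le_add_left _ _)
    · intro j
      fin_cases j
      exacts [hH, hG₀, hG₁]
    · show _ ↔ z < strLen (G₀ x X) + strLen (G₁ x X) ∧
        ((0 ∈ H x X ∧ z ∈ G₀ x X) ∨ (¬ 0 ∈ H x X ∧ z ∈ G₁ x X))
      have h1 := @lt_strLen_of_mem (G₀ x X) z
      have h2 := @lt_strLen_of_mem (G₁ x X) z
      split_ifs with h0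
      · simp only [h0, true_and, not_true, false_and, or_false]
        exact ⟨fun h => ⟨by have := h1 h; omega, h⟩, fun h => h.2⟩
      · simp only [h0, true_and, not_false_iff, false_and, false_or]
        exact ⟨fun h => ⟨by have := h2 h; omega, h⟩, fun h => h.2⟩
    · rintro q (hq | hq)
      · exact Finset.mem_union_left _ (hA q hq)
      · exact Finset.mem_union_right _ (hB q hq)
    · intro x X hx
      show _ = if 0 ∈ H x X then G₀ x X else G₁ x X
      split_ifs with h0
      · exact h x X h0
      · exact h' x X ((Finset.mem_union.1 hx).resolve_left h0)
  let 𝓕 : Filter (Input k l) := Filter.comk p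
    ⟨_, hempty, _, hempty, fun q hq => hq.elim, fun x X h => absurd h (Finset.notMem_empty _)⟩
    (fun A ⟨H, hH, G₀, hG₀, hA, h⟩ B hB => ⟨H, hH, G₀, hG₀, fun q hq => hA q (hB hq), h⟩) hunion
  have hp : p Set.univ := by
    by_contra hp
    have : 𝓕.NeBot := ⟨fun h => hp (by
      have : ∅ ∈ 𝓕 := h ▸ mem_bot
      simpa [𝓕] using this)⟩
    -- If the ideal were proper, its dual filter would extend to an ultrafilter. The set that the
    -- hypothesis provides for it would be large, yet it belongs to the ideal, so its complement is
    -- large as well.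
    obtain ⟨H, hH, G₀, hG₀, hU, h⟩ := h (Ultrafilter.of 𝓕)
    have h' : {q : Input k l | ¬ 0 ∈ H q.1 q.2} ∈ 𝓕 := by
      rw [Filter.mem_comk]
      exact ⟨H, hH, G₀, hG₀, fun q hq => not_not.1 hq, h⟩
    exact (hU.and (Ultrafilter.of_le 𝓕 h')).exists.elim fun q hq => hq.2 hq.1
  obtain ⟨H, -, G₀, hG₀, hH, h⟩ := hp
  rwa [show G = G₀ from funext fun x => funext fun X => h x X (hH (x, X) trivial)]

/-- The defining formula is evaluated in the ultrapower at the generic input, the germs of the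
coordinate functions. Totality gives a value `G₀` there; on the decided set where the formula holds
in `N2`, it forces `G₀` to agree with `G`. -/
theorem mem_PF_of_strDefinable {G : StrFun k l} (h : StrDefinable D.theory Formula.IsSigma11 G) :
    G ∈ D.PF k l := by
  obtain ⟨φ, hφ, hG, hT⟩ := h
  refine mem_PF_of_locally fun U => ?_
  obtain ⟨A, hA, -⟩ := (Formula.realize_exUniqueS ..).1 ((Formula.satisfies_close _ _).1
    (hT _ (isModel_ultra (U := U))) (fun i => D.numGerm U ⟨_, coord_mem_PFnum i⟩)
    fun j => D.strGerm U ⟨_, proj_mem_PF j⟩)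
  obtain ⟨G₀, rfl⟩ := exists_strGerm A
  simp only [← strGerm_cons] at hA
  obtain ⟨H, hH, hU, h⟩ := exists_of_realize_ultra hφ _ _ hA
  refine ⟨H, hH, G₀.1, G₀.2, hU, fun x X hx => ((hG _ x X).2 ?_).symm⟩
  have := h x X hx
  rwa [PF_cons] at this

theorem mem_PFnum_of_numDefinable {f : NumFun k l}
    (h : NumDefinable D.theory Formula.IsSigma11 f) : f ∈ D.PFnum k l := by
  obtain ⟨φ, hφ, hf, hT⟩ := h
  refine mem_PF_of_locally fun U => ?_
  obtain ⟨a, ha, -⟩ := (Formula.realize_exUniqueN ..).1 ((Formula.satisfies_close _ _).1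
    (hT _ (isModel_ultra (U := U))) (fun i => D.numGerm U ⟨_, coord_mem_PFnum i⟩)
    fun j => D.strGerm U ⟨_, proj_mem_PF j⟩)
  obtain ⟨f₀, rfl⟩ := exists_numGerm a
  simp only [← numGerm_cons] at ha
  obtain ⟨H, hH, hU, h⟩ := exists_of_realize_ultra hφ _ _ ha
  refine ⟨H, hH, _, f₀.2, hU, fun x X hx => congrArg Finset.range ((hf _ x X).2 ?_).symm⟩
  have := h x X hx
  rwa [PFnum_cons] at this

end RecData

end TwoSorted

-- The main theorem.

open TwoSorted
theorem corollaryt (φInit : Formula L2A 1 1) (φNext : Formula L2A 2 2) (t : NumTerm L2A 2 0)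
    (hInit : φInit.IsSigma0B) (hNext : φNext.IsSigma0B) :
    FinitelyAxiomatizable (recTheory φInit φNext t) ∧
    (∀ (k l : ℕ) (f : NumFun k l),
      (NumDefinable (recTheory φInit φNext t) Formula.IsSigma11 f ↔
        f ∈ (FunClass.LFC (recFun φInit φNext t)).num k l) ∧
      (NumDefinable (recTheory φInit φNext t) Formula.IsSigma1B f ↔
        f ∈ (FunClass.LFC (recFun φInit φNext t)).num k l) ∧
      (f ∈ (FunClass.LFC (recFun φInit φNext t)).num k l ↔
        (FunClass.single (recFun φInit φNext t)).NumAC0Reducible f)) ∧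
    (∀ (k l : ℕ) (G : StrFun k l),
      (StrDefinable (recTheory φInit φNext t) Formula.IsSigma11 G ↔
        G ∈ (FunClass.LFC (recFun φInit φNext t)).str k l) ∧
      (StrDefinable (recTheory φInit φNext t) Formula.IsSigma1B G ↔
        G ∈ (FunClass.LFC (recFun φInit φNext t)).str k l) ∧
      (G ∈ (FunClass.LFC (recFun φInit φNext t)).str k l ↔
        (FunClass.single (recFun φInit φNext t)).StrAC0Reducible G)) := by
  let D : RecData := ⟨φInit, φNext, t, hInit, hNext⟩
  refine ⟨finitelyAxiomatizable_V0_union (Set.finite_singleton _), fun k l f => ?_, fun k l G => ?_⟩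
  · have red : f ∈ D.PFnum k l → (FunClass.single (recFun φInit φNext t)).NumAC0Reducible f :=
      D.numAC0Reducible_of_mem_PFnum
    have prog : f ∈ (FunClass.LFC (recFun φInit φNext t)).num k l → f ∈ D.PFnum k l :=
      D.mem_PFnum_of_mem_LFC
    have wit : NumDefinable (recTheory φInit φNext t) Formula.IsSigma11 f → f ∈ D.PFnum k l :=
      D.mem_PFnum_of_numDefinable
    have dfn : f ∈ D.PFnum k l → NumDefinable (recTheory φInit φNext t) Formula.IsSigma1B f :=
      D.numDefinable_of_mem_PFnum
    -- Each equivalence is a path in the cycle `Σ¹₁` → program → `AC⁰` → `L_FC` → program → `Σ^B_1`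
    -- → `Σ¹₁`.
    exact ⟨⟨fun h => (red (wit h)).mem_LFC, fun h => (dfn (prog h)).sigma11⟩,
      ⟨fun h => (red (wit h.sigma11)).mem_LFC, fun h => dfn (prog h)⟩,
      ⟨fun h => red (prog h), fun h => h.mem_LFC⟩⟩
  · have red : G ∈ D.PF k l → (FunClass.single (recFun φInit φNext t)).StrAC0Reducible G :=
      D.strAC0Reducible_of_mem_PF
    have prog : G ∈ (FunClass.LFC (recFun φInit φNext t)).str k l → G ∈ D.PF k l :=
      D.mem_PF_of_mem_LFC
    have wit : StrDefinable (recTheory φInit φNext t) Formula.IsSigma11 G → G ∈ D.PF k l :=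
      D.mem_PF_of_strDefinable
    have dfn : G ∈ D.PF k l → StrDefinable (recTheory φInit φNext t) Formula.IsSigma1B G :=
      D.strDefinable_of_mem_PF
    exact ⟨⟨fun h => (red (wit h)).mem_LFC, fun h => (dfn (prog h)).sigma11⟩,
      ⟨fun h => (red (wit h.sigma11)).mem_LFC, fun h => dfn (prog h)⟩,
      ⟨fun h => red (prog h), fun h => h.mem_LFC⟩⟩
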